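/- Let $(V_0,R,V_0^\vee,R^\vee)$ be a finite reduced real root system, not necessarily crystallographic, with pairing $(\cdot,\cdot):V_0\times V_0^\vee\to\mathbb R$; $R$ and $R^\vee$ span $V_0$ and $V_0^\vee$. Let $W$ be its reflection group, $\Delta\subset R$ a set of simple roots with positive roots $R_+$, and $c:R\to\mathbb R$, $\alpha\mapsto c_\alpha$, a $W$-invariant function. Put $V^\vee=\mathbb C\otimes_{\mathbb R}V_0^\vee$. For $J\subseteq\Delta$ let $V_J^\vee\subseteq V^\vee$ be the complex span of the coroots $\alpha^\vee$, $\alpha\in J$, and let $R_J$ be the set of roots in the span of $J$. A point $\gamma\in V^\vee$ is *distinguished* if $$|\{\alpha\in R:(\alpha,\gamma)=c_\alpha\}|=|\{\alpha\in R:(\alpha,\gamma)=0\}|+|\Delta| .$$ It is *nilpotent associated to* $J\subseteq\Delta$ if it is $W$-conjugate to some $\gamma'\in V_J^\vee$ with $|\{\alpha\in R_J:(\alpha,\gamma')=c_\alpha\}|=|\{\alpha\in R_J:(\alpha,\gamma')=0\}|+|J|$. It is *solvable* if for some $J\subseteq\Delta$ it is nilpotent associated to $J$ and $$|\{\alpha\in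 R:(\alpha,\gamma)=c_\alpha\}|=|\{\alpha\in R:(\alpha,\gamma)=0\}|+|J| .$$ **(a)** Suppose $c_\alpha\neq0$ for some $\alpha\in R$. **(1)** Let $R$ be of type $I_2(n)$, $n\ge3$, with $\Delta=\{\alpha_1,\alpha_2\}$, and suppose that $\langle\cdot,\cdot\rangle$ is a $W$-invariant inner product on $V_0^\vee$ with $\langle\alpha^\vee,\alpha^\vee\rangle=2$ for all $\alpha\in R$. For $i=0,\dots,n-1$ there is $\beta_i\in R_+$ with $$\sin\tfrac{\pi}{n}\,\beta_i=\sin\tfrac{(i+1)\pi}{n}\,\alpha_1+\sin\tfrac{i\pi}{n}\,\alpha_2,\qquad \sin\tfrac{\pi}{n}\,\beta_i^\vee=\sin\tfrac{(i+1)\pi}{n}\,\alpha_1^\vee+\sin\tfrac{i\pi}{n}\,\alpha_2^\vee .$$ For $k=1,\dots,\lfloor n/2\rfloor$ let $\{\beta_{k-1}^*,\beta_{n-k}^*\}$ be the basis of $V_0^\vee$ dual to $\{\beta_{k-1}^\vee,\beta_{n-k}^\vee\}$ with respect to $\langle\cdot,\cdot\rangle$, and put $\gamma_k=c_{\beta_{k-1}}\beta_{k-1}^*+c_{\beta_{n-k}}\beta_{n-k}^*$.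 (i) If $n$ is odd, let $c$ also denote the common value of $c_\alpha$, $\alpha\in R$, and put $\gamma_{(n+1)/2}=\frac{c}{2}\beta_{(n-1)/2}^\vee$. Then $\gamma\in V^\vee$ is solvable if and only if it is $W$-conjugate to some $\gamma_k$, $1\le k\le(n+1)/2$. For all these $k$ $$\gamma_k=\frac{c}{4\sin\left(\frac{2k-1}{2n}\pi\right)\sin\frac{\pi}{2n}}\,(\alpha_1^\vee+\alpha_2^\vee),$$ and $\gamma_k$ is distinguished if and only if $k\ne(n+1)/2$. (ii) If $n$ is even, then $\gamma\in V^\vee$ is solvable if and only if it is $W$-conjugate to some $\gamma_k$, $1\le k\le n/2$, and $\gamma_k$ is distinguished if and only if $$\Big(c_{\beta_{k-1}}+c_{\beta_{n-k}}\cos\tfrac{(2k-1)\pi}{n}\Big)\Big(c_{\beta_{k-1}}\cos\tfrac{(2k-1)\pi}{n}+c_{\beta_{n-k}}\Big)\ne0 .$$ **(2)** If $R$ is of type $H_3$ or $H_4$, then $\gamma\in V^\vee$ is solvable if and only if it is distinguished. **(b)** If $c_\alpha=0$ for all $\alpha\in R$, then $\gamma\in V^\vee$ is solvable if and only if $\gamma=0$.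 -/

import Mathlib

open scoped TensorProduct NNReal

noncomputable section

namespace SolvablePoints

variable {ι M N : Type*} [AddCommGroup M] [Module ℝ M] [AddCommGroup N] [Module ℝ N]

/-- `Δ` (a set of indices) is a set of simple roots: the roots in `Δ` are linearly independent,
and every root is a combination of them with real coefficients that are all nonnegative or all
nonpositive. (Mathlib's `RootPairing.Base` asks for integral coefficients, which is too strong for
root systems that are not crystallographic.) -/
structure IsSimpleSystem (P : RootPairing ι ℝ M N) (Δ : Set ι) : Prop where
  linearIndepOn_root : LinearIndepOn ℝ P.root Δ
  nonneg_or_nonpos : ∀ i, P.root i ∈ Submodule.span ℝ≥0 (P.root '' Δ) ∨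
    -P.root i ∈ Submodule.span ℝ≥0 (P.root '' Δ)

/-- The root with index `i` is positive with respect to `Δ`. -/
def IsPositive (P : RootPairing ι ℝ M N) (Δ : Set ι) (i : ι) : Prop :=
  P.root i ∈ Submodule.span ℝ≥0 (P.root '' Δ)

/-- The simple roots in `Δ`, listed by `a`, have the Coxeter diagram with edge labels `m i j`:
the angle between the `i`-th and the `j`-th simple root is `π - π / m i j`, that is,
`(α, β^∨) (β, α^∨) = 4 cos² (π / m i j)` and `(α, β^∨) ≤ 0`. -/
structure HasDiagram (P : RootPairing ι ℝ M N) (Δ : Set ι) {r : ℕ}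
    (m : Matrix (Fin r) (Fin r) ℕ) (a : Fin r → ι) : Prop where
  injective : Function.Injective a
  range_eq : Set.range a = Δ
  pairing_nonpos : ∀ i j, i ≠ j → P.pairing (a i) (a j) ≤ 0
  pairing_mul_pairing : ∀ i j, i ≠ j →
    P.pairing (a i) (a j) * P.pairing (a j) (a i) = 4 * Real.cos (Real.pi / m i j) ^ 2

/-- The parameter function `c` is invariant under the reflection group. -/
def IsInvariant (P : RootPairing ι ℝ M N) (c : ι → ℝ) : Prop :=
  ∀ i j, c (P.reflectionPerm i j) = c j

/-- The reflection group `W`, acting on the coroot space. -/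
def coweyl (P : RootPairing ι ℝ M N) : Subgroup (N ≃ₗ[ℝ] N) :=
  Subgroup.closure (Set.range P.coreflection)

/-- The points `x` and `y` of the complexified coroot space are conjugate under `W`. -/
def IsConjugate (P : RootPairing ι ℝ M N) (x y : ℂ ⊗[ℝ] N) : Prop :=
  ∃ w ∈ coweyl P, x = LinearMap.baseChange ℂ (w : N →ₗ[ℝ] N) y

/-- The value `(α, γ)` of the root `α` with index `i` at a point `γ` of the complexified
coroot space. -/
def eval (P : RootPairing ι ℝ M N) (i : ι) (γ : ℂ ⊗[ℝ] N) : ℂ :=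
  Module.Dual.baseChange ℂ (P.root' i) γ

/-- The complex span of the coroots with index in `J`. -/
def corootSpan (P : RootPairing ι ℝ M N) (J : Set ι) : Submodule ℂ (ℂ ⊗[ℝ] N) :=
  Submodule.span ℂ ((fun j => (1 : ℂ) ⊗ₜ[ℝ] P.coroot j) '' J)

/-- The (indices of the) roots lying in the span of the roots with index in `J`. -/
def subroots (P : RootPairing ι ℝ M N) (J : Set ι) : Set ι :=
  {i | P.root i ∈ Submodule.span ℝ (P.root '' J)}

/-- The equation `#{α ∈ S : (α, γ) = c_α} = #{α ∈ S : (α, γ) = 0} + d`, for a set `S` of roots. -/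
def CountEq (P : RootPairing ι ℝ M N) (c : ι → ℝ) (S : Set ι) (d : ℕ) (γ : ℂ ⊗[ℝ] N) : Prop :=
  {i ∈ S | eval P i γ = (c i : ℂ)}.ncard = {i ∈ S | eval P i γ = 0}.ncard + d

/-- Distinguished points of the complexified coroot space. -/
def IsDistinguished (P : RootPairing ι ℝ M N) (Δ : Set ι) (c : ι → ℝ) (γ : ℂ ⊗[ℝ] N) : Prop :=
  CountEq P c Set.univ Δ.ncard γ

/-- `γ` is a nilpotent point associated to `J`: it is conjugate to a point of the span of the
coroots in `J` that is distinguished for the subsystem of `J`. -/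
def IsNilpotentFor (P : RootPairing ι ℝ M N) (c : ι → ℝ) (J : Set ι) (γ : ℂ ⊗[ℝ] N) : Prop :=
  ∃ γ' ∈ corootSpan P J, IsConjugate P γ γ' ∧ CountEq P c (subroots P J) J.ncard γ'

/-- Solvable points of the complexified coroot space. -/
def IsSolvable (P : RootPairing ι ℝ M N) (Δ : Set ι) (c : ι → ℝ) (γ : ℂ ⊗[ℝ] N) : Prop :=
  ∃ J ⊆ Δ, IsNilpotentFor P c J γ ∧ CountEq P c Set.univ J.ncard γ

/-- `B` is a `W`-invariant inner product on the real coroot space for which all coroots have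
squared length `2`. -/
structure IsNormalizedInner (P : RootPairing ι ℝ M N) (B : N →ₗ[ℝ] N →ₗ[ℝ] ℝ) : Prop where
  symm : ∀ x y, B x y = B y x
  pos : ∀ x, x ≠ 0 → 0 < B x x
  invariant : ∀ i x y, B (P.coreflection i x) (P.coreflection i y) = B x y
  coroot_self : ∀ i, B (P.coroot i) (P.coroot i) = 2

/-- The roots `β_0, …, β_{n-1}` of the dihedral root system with simple roots `a 0`, `a 1`:
`sin (π/n) β_i = sin ((i+1)π/n) α₁ + sin (iπ/n) α₂`, and likewise for the coroots. -/
def IsDihedralRoots (P : RootPairing ι ℝ M N) (Δ : Set ι) (n : ℕ) (a : Fin 2 → ι)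
    (β : ℕ → ι) : Prop :=
  ∀ i < n, IsPositive P Δ (β i) ∧
    Real.sin (Real.pi / n) • P.root (β i) =
      Real.sin ((i + 1) * Real.pi / n) • P.root (a 0) +
        Real.sin (i * Real.pi / n) • P.root (a 1) ∧
    Real.sin (Real.pi / n) • P.coroot (β i) =
      Real.sin ((i + 1) * Real.pi / n) • P.coroot (a 0) +
        Real.sin (i * Real.pi / n) • P.coroot (a 1)

/-- The basis `e` of the coroot space is dual, with respect to `B`, to the pair of coroots with
indices `i` and `j`. -/
def IsDualPair (P : RootPairing ι ℝ M N) (B : N →ₗ[ℝ] N →ₗ[ℝ] ℝ) (i j : ι)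
    (e : Module.Basis (Fin 2) ℝ N) : Prop :=
  B (e 0) (P.coroot i) = 1 ∧ B (e 0) (P.coroot j) = 0 ∧
    B (e 1) (P.coroot i) = 0 ∧ B (e 1) (P.coroot j) = 1

end SolvablePoints

end

/-!
The parameter function is constant on the orbits of `W`, so all counting equations are invariant
under conjugation (`CountEq.conj`), and a solvable point may be studied through the values that the
roots take at it. If the parameters vanish, the two counts agree, which forces `J = ∅` and hence the
point `0`. If they do not all vanish, `J = ∅` is impossible (`not_isNilpotentFor_empty`), and a
distinguished point is always solvable with `J = Δ`.

*Dihedral types.* The roots are listed by their angles, multiples of `π / n` (`IsDihedralList`), and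
the value of a root at a fixed point is a trigonometric function of its angle. For `J = Δ` the
counting equation provides two roots that take their parameters as values. If the two values agree,
the point lies on the bisector of the two roots; a nonzero value is then taken by no third root, and
whether a root vanishes is a question of parity. Hence up to conjugacy, which can move the two roots
to the positions `k - 1` and `n - k` (`exists_conj_standard`), the point is `γ_k`. If `J` is a
single simple root, the point is conjugate to half its coroot times the parameter
(`isNilpotentFor_singleton_iff`), which for odd `n` is the additional point and for even `n` is a
`γ_k` exactly when another root takes its parameter as value. For even `n` this is the case in which
`γ_k` is not distinguished.

*Types `H₃` and `H₄`.* It has to be shown that a proper nonempty subset `J` of `Δ` cannot occur. The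
labels of the diagram determine the Cartan matrix, with entries in the ring `ℤ[φ]` of golden
integers, and all parameters agree, so that they may be taken to be `1`. The positive roots are then
known explicitly (`IsPositiveRootList`). The point may be assumed to be dominant for the subsystem
of `J` (`IsSimpleSystem.exists_dominant`), so that the roots of the subsystem with value `1` are
positive, and by the counting equation for the subsystem there are at least `|J|` of them. So some
`|J|` positive roots of the subsystem have value `1`. These `|J|` linear equations in `|J| ≤ 3`
unknowns are solved by Cramer's rule over `ℤ[φ]`. The equations are either inconsistent or have a
unique solution, and that solution violates one of the two counting equations. The finitely many
cases are checked by evaluation (`parabolicExcluded_H₃`, `parabolicExcluded_H₄`), and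
`AllExcluded.not_valueCountEq` is the soundness of the check.
-/

open scoped TensorProduct NNReal

namespace SolvablePoints

section General

variable {ι M N : Type*} [AddCommGroup M] [Module ℝ M] [AddCommGroup N] [Module ℝ N]
  (P : RootPairing ι ℝ M N)

/-! ### Evaluation at points of the complexified coroot space -/

/-- The values of all elements of the root space, not only of the roots, at points of the
complexified coroot space; real-linear in the first argument. -/
noncomputable def evalLin : M →ₗ[ℝ] Module.Dual ℂ (ℂ ⊗[ℝ] N) :=
  Module.Dual.baseChange ℂ ∘ₗ P.toLinearMap

lemma eval_eq (i : ι) (x : ℂ ⊗[ℝ] N) : eval P i x = evalLin P (P.root i) x := rfl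

@[simp] lemma evalLin_tmul (m : M) (z : ℂ) (y : N) :
    evalLin P m (z ⊗ₜ y) = (P.toLinearMap m y : ℂ) * z := by
  simp [evalLin, Module.Dual.baseChange_apply_tmul]

lemma eval_add (i : ι) (x y : ℂ ⊗[ℝ] N) : eval P i (x + y) = eval P i x + eval P i y := by
  simp [eval_eq]

lemma eval_sub (i : ι) (x y : ℂ ⊗[ℝ] N) : eval P i (x - y) = eval P i x - eval P i y := by
  simp [eval_eq]

lemma eval_smul (i : ι) (z : ℂ) (x : ℂ ⊗[ℝ] N) : eval P i (z • x) = z * eval P i x := by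
  simp [eval_eq]

@[simp] lemma eval_zero (i : ι) : eval P i 0 = 0 := by
  simp [eval_eq]

lemma eval_tmul (i : ι) (z : ℂ) (y : N) : eval P i (z ⊗ₜ y) = (P.root' i y : ℂ) * z := by
  rw [eval_eq, evalLin_tmul]

lemma eval_coroot (i j : ι) : eval P i ((1 : ℂ) ⊗ₜ P.coroot j) = P.pairing i j := by
  rw [eval_tmul, mul_one]; rfl

/-- The action of a reflection on the complexified coroot space. -/
lemma baseChange_coreflection (j : ι) (x : ℂ ⊗[ℝ] N) :
    LinearMap.baseChange ℂ (P.coreflection j : N →ₗ[ℝ] N) x =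
      x - eval P j x • ((1 : ℂ) ⊗ₜ[ℝ] P.coroot j) := by
  induction x with
  | zero => simp
  | tmul z y =>
    rw [LinearMap.baseChange_tmul, eval_tmul]
    simp only [LinearEquiv.coe_coe, P.coreflection_apply, TensorProduct.tmul_sub,
      TensorProduct.tmul_smul, TensorProduct.smul_tmul', smul_eq_mul, mul_one]
    rw [← Complex.real_smul]
  | add x y hx hy =>
    rw [map_add, hx, hy, eval_add, add_smul]; abel

lemma evalLin_coreflection (m : M) (j : ι) (x : ℂ ⊗[ℝ] N) :
    evalLin P m (LinearMap.baseChange ℂ (P.coreflection j : N →ₗ[ℝ] N) x) =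
      evalLin P m x - eval P j x * (P.toLinearMap m (P.coroot j) : ℂ) := by
  rw [baseChange_coreflection, map_sub, map_smul, evalLin_tmul, smul_eq_mul, mul_one]

lemma eval_coreflection (i j : ι) (x : ℂ ⊗[ℝ] N) :
    eval P i (LinearMap.baseChange ℂ (P.coreflection j : N →ₗ[ℝ] N) x) =
      eval P (P.reflectionPerm j i) x := by
  rw [eval_eq, evalLin_coreflection, eval_eq P (P.reflectionPerm j i), P.root_reflectionPerm,
    P.reflection_apply_root, map_sub, map_smul, LinearMap.sub_apply, LinearMap.smul_apply,
    Complex.real_smul, mul_comm]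
  rfl

/-! ### Conjugacy under the reflection group -/

variable {P}

lemma IsConjugate.refl (x : ℂ ⊗[ℝ] N) : IsConjugate P x x :=
  ⟨1, one_mem _, by
    rw [show ((1 : N ≃ₗ[ℝ] N) : N →ₗ[ℝ] N) = LinearMap.id from rfl, LinearMap.baseChange_id]
    rfl⟩

lemma IsConjugate.trans {x y z : ℂ ⊗[ℝ] N} (h₁ : IsConjugate P x y) (h₂ : IsConjugate P y z) :
    IsConjugate P x z := by
  obtain ⟨v, hv, rfl⟩ := h₁
  obtain ⟨w, hw, rfl⟩ := h₂
  refine ⟨v * w, mul_mem hv hw, ?_⟩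
  rw [← LinearMap.comp_apply, ← LinearMap.baseChange_comp]
  rfl

lemma IsConjugate.symm {x y : ℂ ⊗[ℝ] N} (h : IsConjugate P x y) : IsConjugate P y x := by
  obtain ⟨w, hw, rfl⟩ := h
  refine ⟨w⁻¹, inv_mem hw, ?_⟩
  rw [← LinearMap.comp_apply, ← LinearMap.baseChange_comp]
  have : ((w⁻¹ : N ≃ₗ[ℝ] N) : N →ₗ[ℝ] N) ∘ₗ (w : N →ₗ[ℝ] N) = LinearMap.id := by
    ext y
    exact w.symm_apply_apply y
  rw [this, LinearMap.baseChange_id]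
  rfl

lemma isConjugate_coreflection (j : ι) (x : ℂ ⊗[ℝ] N) :
    IsConjugate P (LinearMap.baseChange ℂ (P.coreflection j : N →ₗ[ℝ] N) x) x :=
  ⟨P.coreflection j, Subgroup.subset_closure ⟨j, rfl⟩, rfl⟩

/-- The action of an element of `W` permutes the values of the roots, in a way that respects every
invariant parameter function. -/
lemma IsConjugate.exists_perm {c : ι → ℝ} (hc : IsInvariant P c) {x y : ℂ ⊗[ℝ] N}
    (h : IsConjugate P x y) :
    ∃ σ : Equiv.Perm ι, (∀ i, c (σ i) = c i) ∧ ∀ i, eval P i x = eval P (σ i) y := by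
  obtain ⟨w, hw, rfl⟩ := h
  have key : ∃ σ : Equiv.Perm ι, (∀ i, c (σ i) = c i) ∧ ∀ i y,
      eval P i (LinearMap.baseChange ℂ (w : N →ₗ[ℝ] N) y) = eval P (σ i) y := by
    induction hw using Subgroup.closure_induction with
    | mem w hw =>
      obtain ⟨j, rfl⟩ := hw
      exact ⟨P.reflectionPerm j, fun i => hc j i, fun i y => eval_coreflection P i j y⟩
    | one =>
      refine ⟨1, fun _ => rfl, fun i y => ?_⟩
      rw [show ((1 : N ≃ₗ[ℝ] N) : N →ₗ[ℝ] N) = LinearMap.id from rfl, LinearMap.baseChange_id]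
      rfl
    | mul v w _ _ hv hw =>
      obtain ⟨σ, hσ, hσ'⟩ := hv
      obtain ⟨τ, hτ, hτ'⟩ := hw
      refine ⟨τ * σ, fun i => by simp [hτ, hσ], fun i y => ?_⟩
      rw [show ((v * w : N ≃ₗ[ℝ] N) : N →ₗ[ℝ] N) = (v : N →ₗ[ℝ] N) ∘ₗ (w : N →ₗ[ℝ] N) from rfl,
        LinearMap.baseChange_comp, LinearMap.comp_apply, hσ', hτ']
      rfl
    | inv w _ hw =>
      obtain ⟨σ, hσ, hσ'⟩ := hw
      refine ⟨σ⁻¹, fun i => ?_, fun i y => ?_⟩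
      · rw [← hσ (σ⁻¹ i)]; simp
      · obtain ⟨j, rfl⟩ := σ.surjective i
        rw [show σ⁻¹ (σ j) = j by simp, ← hσ', ← LinearMap.comp_apply,
          ← LinearMap.baseChange_comp]
        have : (w : N →ₗ[ℝ] N) ∘ₗ ((w⁻¹ : N ≃ₗ[ℝ] N) : N →ₗ[ℝ] N) = LinearMap.id := by
          ext y
          exact w.apply_symm_apply y
        rw [this, LinearMap.baseChange_id]
        rfl
  obtain ⟨σ, hσ, hσ'⟩ := key
  exact ⟨σ, hσ, fun i => hσ' i y⟩

/-- Counting equations can be transported along a permutation of the roots. -/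
lemma CountEq.of_perm {c : ι → ℝ} {S : Set ι} {d : ℕ} {x y : ℂ ⊗[ℝ] N} (σ : Equiv.Perm ι)
    (hc : ∀ i, c (σ i) = c i) (hS : ∀ i, σ i ∈ S ↔ i ∈ S)
    (he : ∀ i, eval P i x = eval P (σ i) y) (h : CountEq P c S d y) : CountEq P c S d x := by
  unfold CountEq at h ⊢
  have h₁ : {i ∈ S | eval P i y = (c i : ℂ)} = σ '' {i ∈ S | eval P i x = (c i : ℂ)} := by
    ext i
    obtain ⟨j, rfl⟩ := σ.surjective i
    simp [hc, hS, he]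
  have h₂ : {i ∈ S | eval P i y = 0} = σ '' {i ∈ S | eval P i x = 0} := by
    ext i
    obtain ⟨j, rfl⟩ := σ.surjective i
    simp [hS, he]
  rwa [h₁, h₂, Set.ncard_image_of_injective _ σ.injective,
    Set.ncard_image_of_injective _ σ.injective] at h

lemma CountEq.conj {c : ι → ℝ} (hc : IsInvariant P c) {d : ℕ} {x y : ℂ ⊗[ℝ] N}
    (hxy : IsConjugate P x y) (h : CountEq P c Set.univ d y) : CountEq P c Set.univ d x := by
  obtain ⟨σ, hσ, hσ'⟩ := hxy.exists_perm hc
  exact h.of_perm σ hσ (by simp) hσ'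

lemma IsSolvable.conj {c : ι → ℝ} (hc : IsInvariant P c) {Δ : Set ι} {x y : ℂ ⊗[ℝ] N}
    (hxy : IsConjugate P x y) (h : IsSolvable P Δ c y) : IsSolvable P Δ c x := by
  obtain ⟨J, hJ, ⟨γ, hγ, hyγ, hcount⟩, h'⟩ := h
  exact ⟨J, hJ, ⟨γ, hγ, hxy.trans hyγ, hcount⟩, h'.conj hc hxy⟩

/-- After scaling, the parameter is `1`. -/
lemma CountEq.scale {c : ι → ℝ} {S : Set ι} {d : ℕ} {x : ℂ ⊗[ℝ] N} {t : ℝ} (ht : t ≠ 0)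
    (hc : ∀ i, c i = t) (h : CountEq P c S d x) :
    CountEq P (fun _ => 1) S d ((t : ℂ)⁻¹ • x) := by
  have ht' : (t : ℂ) ≠ 0 := by exact_mod_cast ht
  have h₁ : ∀ i, eval P i ((t : ℂ)⁻¹ • x) = ((1 : ℝ) : ℂ) ↔ eval P i x = (c i : ℂ) := by
    intro i
    rw [eval_smul, hc, inv_mul_eq_iff_eq_mul₀ ht']
    simp
  have h₂ : ∀ i, eval P i ((t : ℂ)⁻¹ • x) = 0 ↔ eval P i x = 0 := by
    intro i
    simp [eval_smul, ht']
  unfold CountEq at h ⊢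
  simpa only [h₁, h₂] using h

lemma IsNilpotentFor.eq_zero_of_empty {c : ι → ℝ} {x : ℂ ⊗[ℝ] N}
    (h : IsNilpotentFor P c ∅ x) : x = 0 := by
  obtain ⟨γ, hγ, ⟨w, _, rfl⟩, _⟩ := h
  have : γ = 0 := by simpa [corootSpan] using hγ
  rw [this, map_zero]

lemma isNilpotentFor_empty_zero (c : ι → ℝ) : IsNilpotentFor P c ∅ (0 : ℂ ⊗[ℝ] N) := by
  refine ⟨0, Submodule.zero_mem _, .refl 0, ?_⟩
  have : subroots P ∅ = ∅ := by
    ext i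
    simp [subroots, P.ne_zero]
  simp [CountEq, this]

/-- If the parameters vanish, the origin is the only solvable point. -/
lemma isSolvable_iff_of_forall_eq_zero [Finite ι] {Δ : Set ι} {c : ι → ℝ} (hc : ∀ i, c i = 0)
    (x : ℂ ⊗[ℝ] N) : IsSolvable P Δ c x ↔ x = 0 := by
  constructor
  · rintro ⟨J, -, hJ, h⟩
    have hJ0 : J = ∅ := by
      rw [← Set.ncard_eq_zero J.toFinite]
      simpa [CountEq, hc] using h
    subst hJ0
    exact hJ.eq_zero_of_empty
  · rintro rfl
    exact ⟨∅, Set.empty_subset _, isNilpotentFor_empty_zero c, by simp [CountEq, hc]⟩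

/-- If some parameter does not vanish, a solvable point is not associated to the empty set. -/
lemma not_isNilpotentFor_empty [Finite ι] {c : ι → ℝ} (hc : ∃ i, c i ≠ 0) {x : ℂ ⊗[ℝ] N}
    (h : IsNilpotentFor P c ∅ x) : ¬ CountEq P c Set.univ (∅ : Set ι).ncard x := by
  have hx := h.eq_zero_of_empty
  subst hx
  intro h
  obtain ⟨i, hi⟩ := hc
  have hlt : {i | eval P i (0 : ℂ ⊗[ℝ] N) = (c i : ℂ)}.ncard < (Set.univ : Set ι).ncard := by
    refine Set.ncard_lt_ncard ⟨Set.subset_univ _, fun hs => hi ?_⟩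
    simpa using (hs (Set.mem_univ i)).symm
  simp only [CountEq, Set.mem_univ, true_and, eval_zero, Set.ncard_empty, add_zero] at h hlt
  rw [h] at hlt
  simp at hlt

variable (P) in
lemma mem_subroots_reflectionPerm {J : Set ι} {j : ι} (hj : j ∈ J) (i : ι) :
    P.reflectionPerm j i ∈ subroots P J ↔ i ∈ subroots P J := by
  have hj' : P.pairing i j • P.root j ∈ Submodule.span ℝ (P.root '' J) :=
    Submodule.smul_mem _ _ (Submodule.subset_span ⟨j, hj, rfl⟩)
  simp only [subroots, Set.mem_ofPred_eq, P.root_reflectionPerm, P.reflection_apply_root]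
  exact Submodule.sub_mem_iff_left _ hj'

/-! ### Simple systems -/

variable (P) in
lemma eq_zero_of_evalLin {x : ℂ ⊗[ℝ] N} (h : ∀ m, evalLin P m x = 0) : x = 0 := by
  let b := Module.Free.chooseBasis ℝ N
  have hb : ∀ k x, (b.baseChange ℂ).repr x k = Module.Dual.baseChange ℂ (b.coord k) x := by
    intro k x
    induction x with
    | zero => simp
    | tmul z y => simp [Module.Dual.baseChange_apply_tmul, Module.Basis.baseChange_repr_tmul]
    | add x y hx hy => simp only [map_add, Finsupp.add_apply, hx, hy]
  refine (b.baseChange ℂ).ext_elem fun k => ?_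
  obtain ⟨m, hm⟩ := P.toLinearMap.toPerfPair.surjective (b.coord k)
  have := h m
  rw [hb, map_zero, Finsupp.zero_apply, ← this, ← hm]
  rfl

variable [P.IsRootSystem]

variable (P) in
/-- A point is determined by the values of the roots at it. -/
lemma eq_of_eval_eq {x y : ℂ ⊗[ℝ] N} (h : ∀ i, eval P i x = eval P i y) : x = y := by
  rw [← sub_eq_zero]
  refine eq_zero_of_evalLin P fun m => ?_
  have hm : m ∈ Submodule.span ℝ (Set.range P.root) := by
    rw [RootPairing.IsRootSystem.span_root_eq_top]; trivial
  induction hm using Submodule.span_induction with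
  | mem m hm =>
    obtain ⟨i, rfl⟩ := hm
    rw [← eval_eq, eval_sub, h, sub_self]
  | zero => simp
  | add m m' _ _ hm hm' => rw [map_add, LinearMap.add_apply, hm, hm', add_zero]
  | smul t m _ hm => rw [map_smul, LinearMap.smul_apply, hm, smul_zero]

variable {Δ : Set ι}

lemma IsSimpleSystem.span_root (hΔ : IsSimpleSystem P Δ) :
    Submodule.span ℝ (P.root '' Δ) = ⊤ := by
  rw [eq_top_iff, ← RootPairing.IsRootSystem.span_root_eq_top (P := P), Submodule.span_le]
  rintro _ ⟨i, rfl⟩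
  have hle : ∀ m ∈ Submodule.span ℝ≥0 (P.root '' Δ), m ∈ Submodule.span ℝ (P.root '' Δ) :=
    fun m hm => Submodule.span_le_restrictScalars ℝ≥0 ℝ _ hm
  rcases hΔ.nonneg_or_nonpos i with h | h
  · exact hle _ h
  · simpa using Submodule.neg_mem _ (hle _ h)

/-- The basis of the root space formed by the simple roots. -/
noncomputable def IsSimpleSystem.rootBasis (hΔ : IsSimpleSystem P Δ) : Module.Basis Δ ℝ M :=
  Module.Basis.mk (v := fun j : Δ => P.root j) hΔ.linearIndepOn_root (by
    rw [← hΔ.span_root, Set.image_eq_range])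

@[simp] lemma IsSimpleSystem.rootBasis_apply (hΔ : IsSimpleSystem P Δ) (j : Δ) :
    hΔ.rootBasis j = P.root j := by
  exact Module.Basis.mk_apply _ _ j

lemma IsSimpleSystem.subroots_eq_univ (hΔ : IsSimpleSystem P Δ) : subroots P Δ = Set.univ := by
  ext i
  simp [subroots, hΔ.span_root]

variable [Finite ι]

lemma IsSimpleSystem.linearIndepOn_coroot (hΔ : IsSimpleSystem P Δ) :
    LinearIndepOn ℝ P.coroot Δ := by
  have := Fintype.ofFinite ι
  exact P.linearIndepOn_coroot_iff.2 hΔ.linearIndepOn_root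

lemma IsSimpleSystem.span_coroot (hΔ : IsSimpleSystem P Δ) :
    Submodule.span ℝ (P.coroot '' Δ) = ⊤ := by
  have := Fintype.ofFinite Δ
  have : FiniteDimensional ℝ M := hΔ.rootBasis.finiteDimensional_of_finite
  have : Module.IsReflexive ℝ M := .of_isPerfPair P.toLinearMap
  have : FiniteDimensional ℝ N := P.flip.toLinearMap.toPerfPair.symm.finiteDimensional
  rw [Set.image_eq_range]
  refine LinearIndependent.span_eq_top_of_card_eq_finrank' hΔ.linearIndepOn_coroot ?_
  rw [← Module.finrank_eq_card_basis hΔ.rootBasis, P.toLinearMap.toPerfPair.finrank_eq,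
    Subspace.dual_finrank_eq]

/-- The basis of the coroot space formed by the simple coroots. -/
noncomputable def IsSimpleSystem.corootBasis (hΔ : IsSimpleSystem P Δ) : Module.Basis Δ ℝ N :=
  Module.Basis.mk (v := fun j : Δ => P.coroot j) hΔ.linearIndepOn_coroot (by
    rw [← hΔ.span_coroot, Set.image_eq_range])

@[simp] lemma IsSimpleSystem.corootBasis_apply (hΔ : IsSimpleSystem P Δ) (j : Δ) :
    hΔ.corootBasis j = P.coroot j := by
  exact Module.Basis.mk_apply _ _ j

lemma IsSimpleSystem.corootSpan_eq_top (hΔ : IsSimpleSystem P Δ) : corootSpan P Δ = ⊤ := by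
  rw [corootSpan, ← (hΔ.corootBasis.baseChange ℂ).span_eq]
  congr 1
  ext x
  simp [Set.mem_range]

lemma IsDistinguished.isSolvable (hΔ : IsSimpleSystem P Δ) {c : ι → ℝ} {x : ℂ ⊗[ℝ] N}
    (h : IsDistinguished P Δ c x) : IsSolvable P Δ c x := by
  refine ⟨Δ, subset_rfl, ⟨x, ?_, .refl x, ?_⟩, h⟩
  · rw [hΔ.corootSpan_eq_top]; trivial
  · rw [hΔ.subroots_eq_univ]; exact h

/-! ### Induction on roots -/

/-- A positive root that is not simple can be moved by a simple reflection to a lower positive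
root; so a property of roots that holds for the simple roots and their negatives and is stable
under simple reflections holds for all roots. -/
lemma IsSimpleSystem.root_induction [P.IsReduced] (hΔ : IsSimpleSystem P Δ) {p : ι → Prop}
    (simple : ∀ j ∈ Δ, p j) (step : ∀ i, ∀ j ∈ Δ, p i → p (P.reflectionPerm j i)) (i : ι) :
    p i := by
  have := Fintype.ofFinite ι
  classical
  let ν : ι → ι := fun i => P.reflectionPerm i i
  have root_ν : ∀ i, P.root (ν i) = -P.root i := fun i => by
    simp only [ν, P.root_reflectionPerm, P.reflection_apply_self]
  have ν_ν : ∀ i, ν (ν i) = i := fun i => P.root.injective (by rw [root_ν, root_ν, neg_neg])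
  let q : ι → Prop := fun i => p i ∧ p (ν i)
  have q_neg : ∀ i, q i → q (ν i) := fun i h => ⟨h.2, by rw [ν_ν]; exact h.1⟩
  have q_simple : ∀ j ∈ Δ, q j := fun j hj => ⟨simple j hj, step j j hj (simple j hj)⟩
  have refl_neg : ∀ i j, P.reflectionPerm j (ν i) = ν (P.reflectionPerm j i) := by
    intro i j
    apply P.root.injective
    rw [P.root_reflectionPerm j (ν i), root_ν i, root_ν (P.reflectionPerm j i), map_neg,
      P.root_reflectionPerm]
  have q_step : ∀ i, ∀ j ∈ Δ, q i → q (P.reflectionPerm j i) := fun i j hj h =>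
    ⟨step i j hj h.1, by rw [← refl_neg]; exact step _ j hj h.2⟩
  -- it is enough to treat positive roots
  suffices hpos : ∀ i, IsPositive P Δ i → q i by
    rcases hΔ.nonneg_or_nonpos i with h | h
    · exact (hpos i h).1
    · have : q (ν i) := hpos (ν i) (by rwa [IsPositive, root_ν])
      rw [← ν_ν i]
      exact (q_neg _ this).1
  clear i
  by_contra! hbad
  obtain ⟨i₀, hi₀⟩ := hbad
  -- the sum of the coordinates with respect to the simple roots
  let ht : M →ₗ[ℝ] ℝ := hΔ.rootBasis.constr ℝ fun _ => (1 : ℝ)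
  have ht_simple : ∀ j ∈ Δ, ht (P.root j) = 1 := fun j hj => by
    have := hΔ.rootBasis.constr_basis ℝ (fun _ => (1 : ℝ)) ⟨j, hj⟩
    rwa [hΔ.rootBasis_apply] at this
  obtain ⟨i, ⟨hi, hqi⟩, hmin⟩ := Set.exists_min_image {i | IsPositive P Δ i ∧ ¬ q i}
    (fun i => ht (P.root i)) (Set.toFinite _) ⟨i₀, hi₀⟩
  -- some simple root makes an acute angle with a given positive root
  obtain ⟨j, hj, hij⟩ : ∃ j ∈ Δ, 0 < P.pairing i j := by
    by_contra! hle
    have hform : ∀ x ∈ Submodule.span ℝ≥0 (P.root '' Δ), P.RootForm (P.root i) x ≤ 0 := by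
      intro x hx
      induction hx using Submodule.span_induction with
      | mem x hx =>
        obtain ⟨j, hj, rfl⟩ := hx
        have h₁ := P.toInvariantForm.two_mul_apply_root_root i j
        have h₂ : 0 < P.RootForm (P.root j) (P.root j) :=
          P.rootForm_pos_of_ne_zero (Submodule.subset_span ⟨j, rfl⟩) (P.ne_zero j)
        have h₃ := hle j hj
        simp only [RootPairing.toInvariantForm_form] at h₁
        nlinarith
      | zero => simp
      | add x y _ _ hx hy => rw [map_add]; linarith
      | smul t x _ hx =>
        rw [NNReal.smul_def, map_smul, smul_eq_mul]
        exact mul_nonpos_of_nonneg_of_nonpos t.2 hx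
    have := P.rootForm_pos_of_ne_zero (x := P.root i) (Submodule.subset_span ⟨i, rfl⟩)
      (P.ne_zero i)
    exact absurd (hform _ hi) (not_le.2 this)
  have hroot : P.root (P.reflectionPerm j i) = P.root i - P.pairing i j • P.root j := by
    rw [P.root_reflectionPerm, P.reflection_apply_root]
  have hback : q (P.reflectionPerm j i) → q i := fun h => by
    simpa using q_step _ j hj h
  rcases hΔ.nonneg_or_nonpos (P.reflectionPerm j i) with h | h
  · have hlt := hmin (P.reflectionPerm j i) ⟨h, fun h' => hqi (hback h')⟩
    rw [hroot, map_sub, map_smul, ht_simple j hj, smul_eq_mul, mul_one] at hlt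
    linarith
  · -- otherwise the root is a multiple of the simple root
    have hcoord : ∀ k : Δ, ∀ x ∈ Submodule.span ℝ≥0 (P.root '' Δ), 0 ≤ hΔ.rootBasis.repr x k := by
      intro k x hx
      induction hx using Submodule.span_induction with
      | mem x hx =>
        obtain ⟨l, hl, rfl⟩ := hx
        rw [← hΔ.rootBasis_apply ⟨l, hl⟩, Module.Basis.repr_self, Finsupp.single_apply]
        split_ifs <;> norm_num
      | zero => simp
      | add x y _ _ hx hy => simpa using add_nonneg hx hy
      | smul t x _ hx =>
        rw [NNReal.smul_def, map_smul, Finsupp.smul_apply, smul_eq_mul]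
        exact mul_nonneg t.2 hx
    have hmul : P.root i = hΔ.rootBasis.repr (P.root i) ⟨j, hj⟩ • P.root j := by
      apply hΔ.rootBasis.repr.injective
      ext k
      rw [map_smul, ← hΔ.rootBasis_apply ⟨j, hj⟩, Module.Basis.repr_self, Finsupp.smul_apply,
        Finsupp.single_apply]
      by_cases hk : (⟨j, hj⟩ : Δ) = k
      · simp [hk]
      · have h₁ := hcoord k _ hi
        have h₂ := hcoord k _ h
        rw [hroot, ← hΔ.rootBasis_apply ⟨j, hj⟩] at h₂
        rw [neg_sub, map_sub, map_smul, Module.Basis.repr_self, Finsupp.sub_apply,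
          Finsupp.smul_apply, Finsupp.single_apply, if_neg hk, smul_zero, zero_sub] at h₂
        simp only [if_neg hk, smul_zero]
        linarith
    have hdep : ¬ LinearIndependent ℝ ![P.root i, P.root j] := by
      intro hli
      have := LinearIndependent.pair_iff.1 hli 1 (-hΔ.rootBasis.repr (P.root i) ⟨j, hj⟩)
        (by rw [one_smul, neg_smul, ← hmul, add_neg_cancel])
      exact one_ne_zero this.1
    rcases RootPairing.IsReduced.eq_or_eq_neg i j hdep with h' | h'
    · exact hqi (P.root.injective h' ▸ q_simple j hj)
    · have : i = ν j := P.root.injective (by rw [h', root_ν])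
      exact hqi (this ▸ q_neg j (q_simple j hj))

/-! ### Moving a point of a coroot span into the dominant chamber -/

/-- Every point in the span of the coroots in `J` can be moved by reflections in `J` to a point at
which the real parts of the roots in `J` are nonnegative. -/
lemma IsSimpleSystem.exists_dominant (hΔ : IsSimpleSystem P Δ) {J : Set ι} (hJ : J ⊆ Δ)
    {x : ℂ ⊗[ℝ] N} (hx : x ∈ corootSpan P J) :
    ∃ σ : Equiv.Perm ι, (∀ i, σ i ∈ subroots P J ↔ i ∈ subroots P J) ∧
      ∃ y ∈ corootSpan P J, (∀ i, eval P i y = eval P (σ i) x) ∧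
        ∀ j ∈ J, 0 ≤ (eval P j y).re := by
  have := Fintype.ofFinite ι
  -- an element of the root space that is dominant with respect to all simple coroots
  obtain ⟨ρ, hρ⟩ : ∃ ρ : M, ∀ j ∈ Δ, P.toLinearMap ρ (P.coroot j) = 1 := by
    obtain ⟨ρ, hρ⟩ := P.toLinearMap.toPerfPair.surjective
      (hΔ.corootBasis.constr ℝ fun _ => (1 : ℝ))
    refine ⟨ρ, fun j hj => ?_⟩
    have := hΔ.corootBasis.constr_basis ℝ (fun _ => (1 : ℝ)) ⟨j, hj⟩
    rw [hΔ.corootBasis_apply, ← hρ] at this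
    exact this
  obtain ⟨r, hr⟩ : ∃ r : ι → ℝ, ∑ i, r i • P.root i = ρ := by
    rw [← Submodule.mem_span_range_iff_exists_fun, RootPairing.IsRootSystem.span_root_eq_top]
    trivial
  let A : Set (Equiv.Perm ι) := {σ | (∀ i, σ i ∈ subroots P J ↔ i ∈ subroots P J) ∧
    ∃ y ∈ corootSpan P J, ∀ i, eval P i y = eval P (σ i) x}
  let F : Equiv.Perm ι → ℝ := fun σ => ∑ i, r i * (eval P (σ i) x).re
  have hF : ∀ (σ : Equiv.Perm ι) y, (∀ i, eval P i y = eval P (σ i) x) →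
      F σ = (evalLin P ρ y).re := by
    intro σ y hy
    simp only [F, ← hr, map_sum, LinearMap.sum_apply, map_smul, LinearMap.smul_apply,
      Complex.re_sum, Complex.real_smul, Complex.re_ofReal_mul, ← eval_eq, hy]
  obtain ⟨σ, ⟨hσ, y, hy, hyσ⟩, hmax⟩ := Set.exists_max_image A F (Set.toFinite _)
    ⟨1, fun _ => Iff.rfl, x, hx, fun _ => rfl⟩
  refine ⟨σ, hσ, y, hy, hyσ, fun j hj => ?_⟩
  -- reflecting in a root with negative real part would increase the value of `ρ`
  have hnew : ∀ i, eval P i (LinearMap.baseChange ℂ (P.coreflection j : N →ₗ[ℝ] N) y) =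
      eval P ((σ * P.reflectionPerm j) i) x := by
    intro i
    rw [eval_coreflection, hyσ]; rfl
  have := hmax (σ * P.reflectionPerm j) ⟨fun i => ?_, _, ?_, hnew⟩
  · rw [hF _ _ hnew, hF _ _ hyσ, evalLin_coreflection, hρ j (hJ hj)] at this
    simp at this
    linarith
  · simp [hσ, mem_subroots_reflectionPerm P hj]
  · rw [baseChange_coreflection]
    exact Submodule.sub_mem _ hy (Submodule.smul_mem _ _ (Submodule.subset_span ⟨j, hj, rfl⟩))

end General

section Dihedral

/-! ### The roots of a dihedral root system -/

/-- With `θ = π / n`, the vector that makes the angle `m θ` with `u` in the plane in which `u` and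
`v` have the same length and enclose the angle `π - θ`. -/
noncomputable def dihedralVec {V : Type*} [AddCommGroup V] [Module ℝ V] (n : ℕ) (u v : V)
    (m : ℤ) : V :=
  (Real.sin ((m + 1) * (Real.pi / n)) / Real.sin (Real.pi / n)) • u +
    (Real.sin (m * (Real.pi / n)) / Real.sin (Real.pi / n)) • v

section Vec

variable {V : Type*} [AddCommGroup V] [Module ℝ V] {n : ℕ} (u v : V)

lemma sin_pi_div_pos (hn : 3 ≤ n) : 0 < Real.sin (Real.pi / n) := by
  have hn' : (3 : ℝ) ≤ n := by exact_mod_cast hn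
  refine Real.sin_pos_of_pos_of_lt_pi (by positivity) ?_
  rw [div_lt_iff₀ (by linarith)]
  nlinarith [Real.pi_pos]

lemma natCast_mul_pi_div (hn : 3 ≤ n) : (n : ℝ) * (Real.pi / n) = Real.pi := by
  have hn' : (n : ℝ) ≠ 0 := by positivity
  field_simp

lemma dihedralVec_zero (hn : 3 ≤ n) : dihedralVec n u v 0 = u := by
  have := (sin_pi_div_pos hn).ne'
  simp [dihedralVec, this]

lemma dihedralVec_sub_one (hn : 3 ≤ n) : dihedralVec n u v (n - 1) = v := by
  have h₀ := (sin_pi_div_pos hn).ne'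
  have h₁ := natCast_mul_pi_div hn
  have h₂ : ((n : ℝ) - 1) * (Real.pi / n) = Real.pi - Real.pi / n := by linarith
  simp [dihedralVec, h₀, h₁, h₂, Real.sin_pi_sub]

lemma dihedralVec_add_natCast (hn : 3 ≤ n) (m : ℤ) :
    dihedralVec n u v (m + n) = -dihedralVec n u v m := by
  have h₁ := natCast_mul_pi_div hn
  have h₂ : (m + n : ℝ) * (Real.pi / n) = m * (Real.pi / n) + Real.pi := by linarith
  have h₃ : (m + n + 1 : ℝ) * (Real.pi / n) = (m + 1) * (Real.pi / n) + Real.pi := by linarith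
  simp only [dihedralVec, Int.cast_add, Int.cast_natCast, h₂, h₃, Real.sin_add_pi, neg_div,
    neg_smul, neg_add]

/-- The reflection in the vector at angle `j θ`. -/
lemma dihedralVec_reflection (hn : 3 ≤ n) (m j : ℤ) :
    dihedralVec n u v m - (2 * Real.cos ((m - j) * (Real.pi / n))) • dihedralVec n u v j =
      dihedralVec n u v (2 * j - m + n) := by
  rw [dihedralVec_add_natCast u v hn]
  simp only [dihedralVec, Int.cast_sub, Int.cast_mul, Int.cast_ofNat]
  have h : ∀ x y : ℝ, Real.sin x - 2 * Real.cos (x - y) * Real.sin y = -Real.sin (2 * y - x) := by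
    intro x y
    rw [Real.cos_sub, Real.sin_sub, Real.sin_two_mul, Real.cos_two_mul]
    linear_combination (-2 * Real.sin x) * Real.sin_sq_add_cos_sq y
  have h₁ := h ((m + 1) * (Real.pi / n)) ((j + 1) * (Real.pi / n))
  have h₂ := h (m * (Real.pi / n)) (j * (Real.pi / n))
  rw [show ((m : ℝ) + 1) * (Real.pi / n) - (j + 1) * (Real.pi / n) =
      (m - j) * (Real.pi / n) by ring,
    show 2 * (((j : ℝ) + 1) * (Real.pi / n)) - (m + 1) * (Real.pi / n) =
      (2 * j - m + 1) * (Real.pi / n) by ring] at h₁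
  rw [show (m : ℝ) * (Real.pi / n) - j * (Real.pi / n) = (m - j) * (Real.pi / n) by ring,
    show 2 * ((j : ℝ) * (Real.pi / n)) - m * (Real.pi / n) =
      (2 * j - m) * (Real.pi / n) by ring] at h₂
  rw [← neg_eq_iff_eq_neg] at h₁ h₂
  rw [← h₁, ← h₂]
  module

lemma linearMap_dihedralVec (hn : 3 ≤ n) (f : V →ₗ[ℝ] ℝ) (hu : f u = 2)
    (hv : f v = -2 * Real.cos (Real.pi / n)) (m : ℤ) :
    f (dihedralVec n u v m) = 2 * Real.cos (m * (Real.pi / n)) := by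
  have h₀ := (sin_pi_div_pos hn).ne'
  simp only [dihedralVec, map_add, map_smul, hu, hv, smul_eq_mul]
  rw [add_mul, one_mul, Real.sin_add]
  field_simp
  ring

lemma linearMap_dihedralVec' (hn : 3 ≤ n) (f : V →ₗ[ℝ] ℝ) (hv : f v = 2)
    (hu : f u = -2 * Real.cos (Real.pi / n)) (m : ℤ) :
    f (dihedralVec n u v m) = 2 * Real.cos ((m - (n - 1)) * (Real.pi / n)) := by
  have h₀ := (sin_pi_div_pos hn).ne'
  have h₁ := natCast_mul_pi_div hn
  rw [show ((m : ℝ) - (n - 1)) * (Real.pi / n) = (m * (Real.pi / n) + Real.pi / n) - Real.pi by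
    linarith, Real.cos_sub_pi, Real.cos_add]
  simp only [dihedralVec, map_add, map_smul, hu, hv, smul_eq_mul]
  rw [add_mul, one_mul, Real.sin_add]
  generalize (m : ℝ) * (Real.pi / n) = t
  generalize Real.pi / n = θ at h₀
  field_simp
  linear_combination (-Real.sin t) * Real.sin_sq_add_cos_sq θ

/-- The reflection in the first vector. -/
lemma dihedralVec_reflection_left (hn : 3 ≤ n) (f : V →ₗ[ℝ] ℝ) (hu : f u = 2)
    (hv : f v = -2 * Real.cos (Real.pi / n)) (m : ℤ) :
    dihedralVec n u v m - f (dihedralVec n u v m) • u = dihedralVec n u v (n - m) := by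
  have := dihedralVec_reflection u v hn m 0
  rw [dihedralVec_zero u v hn, Int.cast_zero, sub_zero, mul_zero, zero_sub, neg_add_eq_sub] at this
  rw [linearMap_dihedralVec u v hn f hu hv, this]

/-- The reflection in the second vector. -/
lemma dihedralVec_reflection_right (hn : 3 ≤ n) (f : V →ₗ[ℝ] ℝ) (hv : f v = 2)
    (hu : f u = -2 * Real.cos (Real.pi / n)) (m : ℤ) :
    dihedralVec n u v m - f (dihedralVec n u v m) • v = dihedralVec n u v (-2 - m + n) := by
  have := dihedralVec_reflection u v hn m (n - 1)
  rw [dihedralVec_sub_one u v hn] at this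
  rw [linearMap_dihedralVec' u v hn f hv hu,
    show (-2 - m + n : ℤ) = -2 - m - n + n + n by ring, dihedralVec_add_natCast u v hn,
    dihedralVec_add_natCast u v hn, neg_neg, ← neg_neg (dihedralVec n u v (-2 - m - n)),
    ← dihedralVec_add_natCast u v hn]
  have h : (2 * (n - 1) - m + n : ℤ) = -2 - m - n + n + n + n + n := by ring
  rw [h, dihedralVec_add_natCast u v hn, dihedralVec_add_natCast u v hn,
    dihedralVec_add_natCast u v hn, neg_neg] at this
  simpa using this

end Vec

variable {ι M N : Type*} [AddCommGroup M] [Module ℝ M] [AddCommGroup N] [Module ℝ N]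

/-- `b` lists the roots of a dihedral root system with `2 n` roots by their angles: `b m` is the
index of the root at angle `m π / n`, where the simple roots have the angles `0` and
`(n - 1) π / n`. -/
structure IsDihedralList (P : RootPairing ι ℝ M N) (n : ℕ) (b : ℤ → ι) : Prop where
  three_le : 3 ≤ n
  root_eq : ∀ m, P.root (b m) = dihedralVec n (P.root (b 0)) (P.root (b (n - 1))) m
  coroot_eq : ∀ m, P.coroot (b m) = dihedralVec n (P.coroot (b 0)) (P.coroot (b (n - 1))) m
  pairing_eq : ∀ i j, P.pairing (b i) (b j) = 2 * Real.cos ((i - j) * (Real.pi / n))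
  surjective : Function.Surjective b

/-- With respect to a normalized inner product, roots and coroots are identified. -/
lemma IsNormalizedInner.root'_eq {P : RootPairing ι ℝ M N} {B : N →ₗ[ℝ] N →ₗ[ℝ] ℝ}
    (hB : IsNormalizedInner P B) (i : ι) (x : N) : P.root' i x = B x (P.coroot i) := by
  have h := hB.invariant i x (P.coroot i)
  rw [P.coreflection_apply_self, P.coreflection_apply, map_sub, map_smul, LinearMap.sub_apply,
    LinearMap.smul_apply, map_neg, map_neg, hB.coroot_self, smul_eq_mul] at h
  linarith

lemma IsNormalizedInner.pairing_eq {P : RootPairing ι ℝ M N} {B : N →ₗ[ℝ] N →ₗ[ℝ] ℝ}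
    (hB : IsNormalizedInner P B) (i j : ι) : P.pairing i j = B (P.coroot j) (P.coroot i) :=
  hB.root'_eq i _

/-- Enumerating the angles exhausts the root system: the angles of the simple roots occur, the
simple reflections permute the angles, and every root is obtained from a simple root by simple
reflections. -/
lemma exists_isDihedralList [Finite ι] {P : RootPairing ι ℝ M N} [P.IsRootSystem] [P.IsReduced]
    {Δ : Set ι} (hΔ : IsSimpleSystem P Δ) {n : ℕ} (hn : 3 ≤ n) {a : Fin 2 → ι}
    (ha : HasDiagram P Δ !![1, n; n, 1] a) {B : N →ₗ[ℝ] N →ₗ[ℝ] ℝ}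
    (hB : IsNormalizedInner P B) :
    ∃ b : ℤ → ι, IsDihedralList P n b ∧ b 0 = a 0 ∧ b (n - 1) = a 1 := by
  have hsymm : P.pairing (a 1) (a 0) = P.pairing (a 0) (a 1) := by
    rw [hB.pairing_eq, hB.pairing_eq, hB.symm]
  have hcos : 0 ≤ Real.cos (Real.pi / n) := by
    have hn' : (3 : ℝ) ≤ n := by exact_mod_cast hn
    refine Real.cos_nonneg_of_mem_Icc
      ⟨by linarith [Real.pi_pos, show 0 < Real.pi / n by positivity], ?_⟩
    rw [div_le_div_iff₀ (by linarith) (by norm_num)]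
    nlinarith [Real.pi_pos]
  have hp : P.pairing (a 0) (a 1) = -2 * Real.cos (Real.pi / n) := by
    have h₁ := ha.pairing_nonpos 0 1 (by decide)
    have h₂ := ha.pairing_mul_pairing 0 1 (by decide)
    rw [hsymm] at h₂
    simp only [Matrix.of_apply, Matrix.cons_val', Matrix.cons_val_one, Matrix.cons_val_zero,
      Matrix.cons_val_fin_one] at h₂
    have h₃ : (-P.pairing (a 0) (a 1)) ^ 2 = (2 * Real.cos (Real.pi / n)) ^ 2 := by
      linear_combination h₂
    rw [sq_eq_sq₀ (by linarith) (by positivity)] at h₃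
    linarith
  have hp' : P.pairing (a 1) (a 0) = -2 * Real.cos (Real.pi / n) := hsymm.trans hp
  let r : ℤ → M := dihedralVec n (P.root (a 0)) (P.root (a 1))
  let r' : ℤ → N := dihedralVec n (P.coroot (a 0)) (P.coroot (a 1))
  have r_zero : r 0 = P.root (a 0) := dihedralVec_zero _ _ hn
  have r'_zero : r' 0 = P.coroot (a 0) := dihedralVec_zero _ _ hn
  have r_last : r (n - 1) = P.root (a 1) := dihedralVec_sub_one _ _ hn
  have r'_last : r' (n - 1) = P.coroot (a 1) := dihedralVec_sub_one _ _ hn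
  have r_add : ∀ m, r (m + n) = -r m := dihedralVec_add_natCast _ _ hn
  have r'_add : ∀ m, r' (m + n) = -r' m := dihedralVec_add_natCast _ _ hn
  -- the simple reflections act on the angles by `m ↦ n - m` and `m ↦ n - 2 - m`
  have refl₀ : ∀ m, P.reflection (a 0) (r m) = r (n - m) := fun m => by
    rw [P.reflection_apply]
    exact dihedralVec_reflection_left _ _ hn (P.coroot' (a 0)) (P.pairing_same _) hp' m
  have refl₁ : ∀ m, P.reflection (a 1) (r m) = r (-2 - m + n) := fun m => by
    rw [P.reflection_apply]
    exact dihedralVec_reflection_right _ _ hn (P.coroot' (a 1)) (P.pairing_same _) hp m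
  have refl₀' : ∀ m, P.coreflection (a 0) (r' m) = r' (n - m) := fun m => by
    rw [P.coreflection_apply]
    exact dihedralVec_reflection_left _ _ hn (P.root' (a 0)) (P.pairing_same _) hp m
  have refl₁' : ∀ m, P.coreflection (a 1) (r' m) = r' (-2 - m + n) := fun m => by
    rw [P.coreflection_apply]
    exact dihedralVec_reflection_right _ _ hn (P.root' (a 1)) (P.pairing_same _) hp' m
  -- every angle is the angle of a root
  let p : ℤ → Prop := fun m => ∃ i, P.root i = r m ∧ P.coroot i = r' m
  have p_zero : p 0 := ⟨a 0, r_zero.symm, r'_zero.symm⟩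
  have p_last : p (n - 1) := ⟨a 1, r_last.symm, r'_last.symm⟩
  have p_add : ∀ m, p m → p (m + n) := by
    rintro m ⟨i, hi, hi'⟩
    refine ⟨P.reflectionPerm i i, ?_, ?_⟩
    · rw [P.root_reflectionPerm, P.reflection_apply_self, r_add, hi]
    · rw [P.coroot_reflectionPerm, P.coreflection_apply_self, r'_add, hi']
  have p_refl₀ : ∀ m, p m → p (n - m) := by
    rintro m ⟨i, hi, hi'⟩
    refine ⟨P.reflectionPerm (a 0) i, ?_, ?_⟩
    · rw [P.root_reflectionPerm, hi, refl₀]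
    · rw [P.coroot_reflectionPerm, hi', refl₀']
  have p_refl₁ : ∀ m, p m → p (-2 - m + n) := by
    rintro m ⟨i, hi, hi'⟩
    refine ⟨P.reflectionPerm (a 1) i, ?_, ?_⟩
    · rw [P.root_reflectionPerm, hi, refl₁]
    · rw [P.coroot_reflectionPerm, hi', refl₁']
  have p_neg : ∀ m, p m → p (-m) := fun m hm => by
    convert p_refl₀ _ (p_add m hm) using 1
    ring
  have p_two : ∀ m, p m → p (m + 2) := fun m hm => by
    convert p_neg _ (p_refl₁ _ (p_add m hm)) using 1
    ring
  have p_one : p 1 := by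
    convert p_refl₀ _ p_last using 1
    ring
  have p_nat : ∀ m : ℕ, p m ∧ p (m + 1) := by
    intro m
    induction m with
    | zero => exact ⟨p_zero, by simpa using p_one⟩
    | succ m ih =>
      refine ⟨by exact_mod_cast ih.2, ?_⟩
      convert p_two _ ih.1 using 1
      push_cast
      ring
  have p_all : ∀ m, p m := by
    intro m
    obtain ⟨k, rfl | rfl⟩ := m.eq_nat_or_neg
    · exact (p_nat k).1
    · exact p_neg _ (p_nat k).1
  choose b hb hb' using p_all
  have b_zero : b 0 = a 0 := P.root.injective ((hb 0).trans r_zero)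
  have b_last : b (n - 1) = a 1 := P.root.injective ((hb _).trans r_last)
  refine ⟨b, ⟨hn, fun m => ?_, fun m => ?_, fun i j => ?_, fun i => ?_⟩, b_zero, b_last⟩
  · rw [b_zero, b_last, hb]
  · rw [b_zero, b_last, hb']
  · have h₀ := (sin_pi_div_pos hn).ne'
    have h₁ : P.pairing (b i) (b j) = P.toLinearMap (r i) (r' j) := by rw [← hb, ← hb']; rfl
    have hx : P.toLinearMap (P.root (a 0)) (r' j) = 2 * Real.cos (j * (Real.pi / n)) :=
      linearMap_dihedralVec _ _ hn (P.root' (a 0)) (P.pairing_same _) hp j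
    have hy : P.toLinearMap (P.root (a 1)) (r' j) = 2 * Real.cos ((j - (n - 1)) * (Real.pi / n)) :=
      linearMap_dihedralVec' _ _ hn (P.root' (a 1)) (P.pairing_same _) hp' j
    have hπ := natCast_mul_pi_div hn
    rw [show ((j : ℝ) - (n - 1)) * (Real.pi / n) = (j * (Real.pi / n) + Real.pi / n) - Real.pi by
      linarith, Real.cos_sub_pi, Real.cos_add] at hy
    rw [h₁]
    rw [show r i = dihedralVec n (P.root (a 0)) (P.root (a 1)) i from rfl, dihedralVec]
    simp only [map_add, map_smul, LinearMap.add_apply,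
      LinearMap.smul_apply, hx, hy, smul_eq_mul]
    rw [sub_mul, add_mul, one_mul, Real.sin_add, Real.cos_sub]
    generalize (i : ℝ) * (Real.pi / n) = s
    generalize (j : ℝ) * (Real.pi / n) = t
    generalize Real.pi / n = θ at h₀
    field_simp
    ring
  · suffices h : ∃ m, P.root i = r m by
      obtain ⟨m, hm⟩ := h
      exact ⟨m, P.root.injective ((hb m).trans hm.symm)⟩
    induction i using hΔ.root_induction with
    | simple j hj =>
      rw [← ha.range_eq] at hj
      obtain ⟨k, rfl⟩ := hj
      fin_cases k
      · exact ⟨0, r_zero.symm⟩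
      · exact ⟨n - 1, r_last.symm⟩
    | step i j hj h =>
      rw [← ha.range_eq] at hj
      obtain ⟨k, rfl⟩ := hj
      obtain ⟨m, hm⟩ := h
      fin_cases k
      · exact ⟨_, by rw [P.root_reflectionPerm, hm]; exact refl₀ m⟩
      · exact ⟨_, by rw [P.root_reflectionPerm, hm]; exact refl₁ m⟩

end Dihedral

section Dihedral

variable {ι M N : Type*} [AddCommGroup M] [Module ℝ M] [AddCommGroup N] [Module ℝ N]
variable {P : RootPairing ι ℝ M N} {n : ℕ} {b : ℤ → ι} {c : ι → ℝ}

/-! ### Multiples of the angle `π / n` -/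

lemma cos_mul_pi_div_eq_one_iff (hn : 3 ≤ n) (k : ℤ) :
    Real.cos (k * (Real.pi / n)) = 1 ↔ (2 * n : ℤ) ∣ k := by
  have h := natCast_mul_pi_div hn
  have hn' : (n : ℝ) ≠ 0 := by positivity
  rw [Real.cos_eq_one_iff]
  constructor
  · rintro ⟨q, hq⟩
    refine ⟨q, ?_⟩
    have : (k : ℝ) = 2 * n * q := by
      field_simp at hq
      nlinarith [Real.pi_pos, hq]
    exact_mod_cast this
  · rintro ⟨q, rfl⟩
    refine ⟨q, ?_⟩
    push_cast
    linear_combination (-2 * q : ℝ) * h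

lemma sin_mul_pi_div_eq_zero_iff (hn : 3 ≤ n) (k : ℤ) :
    Real.sin (k * (Real.pi / n)) = 0 ↔ (n : ℤ) ∣ k := by
  have h := natCast_mul_pi_div hn
  have hn' : (n : ℝ) ≠ 0 := by positivity
  rw [Real.sin_eq_zero_iff]
  constructor
  · rintro ⟨q, hq⟩
    refine ⟨q, ?_⟩
    have : (k : ℝ) = n * q := by
      field_simp at hq
      linarith
    exact_mod_cast this
  · rintro ⟨q, rfl⟩
    refine ⟨q, ?_⟩
    push_cast
    linear_combination (-q : ℝ) * h

lemma cos_mul_pi_div_eq_cos_iff (hn : 3 ≤ n) (k l : ℤ) :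
    Real.cos (k * (Real.pi / n)) = Real.cos (l * (Real.pi / n)) ↔
      (2 * n : ℤ) ∣ k - l ∨ (2 * n : ℤ) ∣ k + l := by
  have h := natCast_mul_pi_div hn
  have hn' : (n : ℝ) ≠ 0 := by positivity
  rw [Real.cos_eq_cos_iff]
  constructor
  · rintro ⟨q, hq | hq⟩
    · refine .inl ⟨-q, ?_⟩
      have : (k - l : ℝ) = 2 * n * -q := by
        field_simp at hq
        linarith
      exact_mod_cast this
    · refine .inr ⟨q, ?_⟩
      have : (k + l : ℝ) = 2 * n * q := by
        field_simp at hq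
        linarith
      exact_mod_cast this
  · rintro (⟨q, hq⟩ | ⟨q, hq⟩)
    · refine ⟨-q, .inl ?_⟩
      have : (k - l : ℝ) = 2 * n * q := by exact_mod_cast hq
      push_cast
      linear_combination (-(Real.pi / n)) * this - (2 * q) * h
    · refine ⟨q, .inr ?_⟩
      have : (k + l : ℝ) = 2 * n * q := by exact_mod_cast hq
      linear_combination (Real.pi / n) * this + (2 * q) * h

/-! ### Points of a dihedral root system -/

namespace IsDihedralList

lemma eq_iff (hb : IsDihedralList P n b) {i j : ℤ} : b i = b j ↔ (2 * n : ℤ) ∣ i - j := by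
  rw [← cos_mul_pi_div_eq_one_iff hb.three_le]
  push_cast
  constructor
  · intro h
    have := hb.pairing_eq i j
    rw [h, P.pairing_same] at this
    linarith
  · intro h
    apply P.root.injective
    obtain ⟨k, hk⟩ := (Real.cos_eq_one_iff _).1 h
    rw [hb.root_eq i, hb.root_eq j, dihedralVec, dihedralVec,
      show (i : ℝ) * (Real.pi / n) = j * (Real.pi / n) + k * (2 * Real.pi) by linarith,
      show ((i : ℝ) + 1) * (Real.pi / n) = (j + 1) * (Real.pi / n) + k * (2 * Real.pi) by linarith,
      Real.sin_add_int_mul_two_pi, Real.sin_add_int_mul_two_pi]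

lemma apply_add_two_mul (hb : IsDihedralList P n b) (m q : ℤ) : b (m + 2 * n * q) = b m :=
  hb.eq_iff.2 ⟨q, by ring⟩

lemma reflectionPerm_eq (hb : IsDihedralList P n b) (j m : ℤ) :
    P.reflectionPerm (b j) (b m) = b (2 * j - m + n) := by
  apply P.root.injective
  rw [P.root_reflectionPerm, P.reflection_apply_root, hb.pairing_eq, hb.root_eq m, hb.root_eq j,
    hb.root_eq (2 * j - m + n), dihedralVec_reflection _ _ hb.three_le]

lemma param_reflection (hb : IsDihedralList P n b) (hc : IsInvariant P c) (j m : ℤ) :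
    c (b (2 * j - m + n)) = c (b m) := by
  rw [← hb.reflectionPerm_eq, hc]

lemma param_add (hb : IsDihedralList P n b) (hc : IsInvariant P c) (m : ℤ) :
    c (b (m + n)) = c (b m) := by
  rw [← hb.param_reflection hc m m]
  congr 2
  ring

lemma param_add_two (hb : IsDihedralList P n b) (hc : IsInvariant P c) (m : ℤ) :
    c (b (m + 2)) = c (b m) := by
  rw [← hb.param_reflection hc 0 m, ← hb.param_reflection hc 1 (2 * 0 - m + n)]
  congr 2
  ring

/-- The parameter depends only on the parity of the angle. -/
lemma param_eq (hb : IsDihedralList P n b) (hc : IsInvariant P c) {i j : ℤ} (h : (2 : ℤ) ∣ i - j) :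
    c (b i) = c (b j) := by
  obtain ⟨k, hk⟩ := h
  have key : ∀ (m : ℤ) (k : ℕ), c (b (m + 2 * k)) = c (b m) := by
    intro m k
    induction k with
    | zero => simp
    | succ k ih =>
      rw [← ih, ← hb.param_add_two hc (m + 2 * k)]
      congr 2
      push_cast
      ring
  obtain ⟨l, rfl | rfl⟩ := k.eq_nat_or_neg
  · rw [← key j l]; congr 2; omega
  · rw [← key i l]; congr 2; omega

/-- The value of a root at a given point is a trigonometric function of its angle. -/
lemma exists_eval_eq (hb : IsDihedralList P n b) (x : ℂ ⊗[ℝ] N) :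
    ∃ X Y : ℂ, ∀ m : ℤ, eval P (b m) x =
      X * Real.cos (m * (Real.pi / n)) + Y * Real.sin (m * (Real.pi / n)) := by
  have h₀ : (Real.sin (Real.pi / n) : ℂ) ≠ 0 := by
    exact_mod_cast (sin_pi_div_pos hb.three_le).ne'
  refine ⟨eval P (b 0) x, (Real.cos (Real.pi / n) * eval P (b 0) x + eval P (b (n - 1)) x) /
    Real.sin (Real.pi / n), fun m => ?_⟩
  rw [eval_eq P (b m), hb.root_eq m, dihedralVec, map_add, map_smul, map_smul,
    LinearMap.add_apply, LinearMap.smul_apply, LinearMap.smul_apply, ← eval_eq, ← eval_eq,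
    Complex.real_smul, Complex.real_smul, add_mul (m : ℝ), one_mul, Real.sin_add]
  push_cast at h₀ ⊢
  generalize (m : ℂ) * ((Real.pi : ℂ) / n) = t
  generalize (Real.pi : ℂ) / n = s at *
  field_simp
  ring

/-- If two roots take the same value at `x`, then `x` lies in direction of their bisector. -/
lemma exists_polar (hb : IsDihedralList P n b) {i j : ℤ} (hij : b i ≠ b j) {x : ℂ ⊗[ℝ] N}
    (h : eval P (b i) x = eval P (b j) x) :
    ∃ A : ℂ, ∀ m : ℤ, eval P (b m) x =
      A * Real.cos ((m - (i + j) / 2) * (Real.pi / n)) := by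
  obtain ⟨X, Y, hXY⟩ := hb.exists_eval_eq x
  set μ : ℝ := (i + j) / 2 * (Real.pi / n) with hμ
  set δ : ℝ := (i - j) / 2 * (Real.pi / n) with hδ
  have hi : (i : ℝ) * (Real.pi / n) = μ + δ := by rw [hμ, hδ]; ring
  have hj : (j : ℝ) * (Real.pi / n) = μ - δ := by rw [hμ, hδ]; ring
  have hs : Real.sin δ ≠ 0 := by
    intro h0
    refine hij (hb.eq_iff.2 ?_)
    rw [← cos_mul_pi_div_eq_one_iff hb.three_le,
      show ((i - j : ℤ) : ℝ) * (Real.pi / n) = 2 * δ by push_cast; rw [hδ]; ring,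
      Real.cos_two_mul, Real.cos_sq', h0]
    norm_num
  have hs' : (Real.sin δ : ℂ) ≠ 0 := by exact_mod_cast hs
  rw [hXY, hXY, hi, hj, Real.cos_add, Real.cos_sub, Real.sin_add, Real.sin_sub] at h
  have h0 : Y * Real.cos μ - X * Real.sin μ = 0 := by
    refine (mul_eq_zero.1 ?_).resolve_right hs'
    push_cast at h ⊢
    linear_combination h / 2
  refine ⟨X * Real.cos μ + Y * Real.sin μ, fun m => ?_⟩
  have h1 : (Real.sin μ : ℂ) ^ 2 + (Real.cos μ : ℂ) ^ 2 = 1 := by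
    exact_mod_cast Real.sin_sq_add_cos_sq μ
  rw [hXY, show ((m : ℝ) - (i + j) / 2) * (Real.pi / n) = m * (Real.pi / n) - μ by rw [hμ]; ring,
    Real.cos_sub]
  push_cast at h0 h1 ⊢
  generalize (m : ℂ) * (Real.pi / n) = t
  linear_combination (-X * Complex.cos t - Y * Complex.sin t) * h1 +
    (Complex.sin t * Complex.cos μ - Complex.cos t * Complex.sin μ) * h0

variable [P.IsRootSystem]

/-- A point is determined by its values at two roots that are not proportional. -/
lemma eq_of_eval_eq (hb : IsDihedralList P n b) {i j : ℤ} (hij : ¬ (n : ℤ) ∣ i - j)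
    {x y : ℂ ⊗[ℝ] N} (hi : eval P (b i) x = eval P (b i) y)
    (hj : eval P (b j) x = eval P (b j) y) : x = y := by
  rw [← sub_eq_zero]
  rw [← sub_eq_zero, ← eval_sub] at hi hj
  obtain ⟨X, Y, h⟩ := hb.exists_eval_eq (x - y)
  rw [h] at hi hj
  have hs : (Real.sin ((i - j : ℤ) * (Real.pi / n)) : ℂ) ≠ 0 := by
    rwa [Ne, Complex.ofReal_eq_zero, sin_mul_pi_div_eq_zero_iff hb.three_le]
  have hs' : Real.sin ((i - j : ℤ) * (Real.pi / n)) =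
      Real.sin (i * (Real.pi / n)) * Real.cos (j * (Real.pi / n)) -
        Real.cos (i * (Real.pi / n)) * Real.sin (j * (Real.pi / n)) := by
    rw [← Real.sin_sub]
    push_cast
    ring_nf
  rw [hs'] at hs
  push_cast at hs hi hj
  have hX : X = 0 := by
    refine (mul_eq_zero.1 ?_).resolve_right hs
    linear_combination Complex.sin (i * (Real.pi / n)) * hj - Complex.sin (j * (Real.pi / n)) * hi
  have hY : Y = 0 := by
    refine (mul_eq_zero.1 ?_).resolve_right hs
    linear_combination Complex.cos (j * (Real.pi / n)) * hi - Complex.cos (i * (Real.pi / n)) * hj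
  refine SolvablePoints.eq_of_eval_eq P fun k => ?_
  obtain ⟨m, rfl⟩ := hb.surjective k
  rw [h, hX, hY]
  simp

end IsDihedralList

end Dihedral

section Dihedral

variable {ι M N : Type*} [AddCommGroup M] [Module ℝ M] [AddCommGroup N] [Module ℝ N]
variable {P : RootPairing ι ℝ M N} {n : ℕ} {b : ℤ → ι} {c : ι → ℝ}

/-! ### Nilpotent points associated to a single simple root -/

lemma countEq_univ {d : ℕ} {x : ℂ ⊗[ℝ] N} : CountEq P c Set.univ d x ↔
    {i | eval P i x = (c i : ℂ)}.ncard = {i | eval P i x = 0}.ncard + d := by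
  simp [CountEq]

lemma isConjugate_coroot (s : ℝ) (j i : ι) :
    IsConjugate P ((1 : ℂ) ⊗ₜ[ℝ] (s • P.coroot (P.reflectionPerm j i)))
      ((1 : ℂ) ⊗ₜ[ℝ] (s • P.coroot i)) := by
  have h := isConjugate_coreflection (P := P) j ((1 : ℂ) ⊗ₜ[ℝ] (s • P.coroot i))
  rwa [LinearMap.baseChange_tmul, map_smul, LinearEquiv.coe_coe, ← P.coroot_reflectionPerm] at h

lemma eval_reflectionPerm_self (i : ι) (x : ℂ ⊗[ℝ] N) :
    eval P (P.reflectionPerm i i) x = -eval P i x := by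
  rw [eval_eq, P.root_reflectionPerm, P.reflection_apply_self, map_neg, LinearMap.neg_apply,
    ← eval_eq]

lemma subroots_singleton [P.IsReduced] (j : ι) :
    subroots P {j} = {j, P.reflectionPerm j j} := by
  ext i
  simp only [subroots, Set.image_singleton, Set.mem_ofPred_eq, Set.mem_insert_iff,
    Set.mem_singleton_iff, Submodule.mem_span_singleton]
  constructor
  · rintro ⟨t, ht⟩
    have hdep : ¬ LinearIndependent ℝ ![P.root i, P.root j] := by
      intro hli
      have := LinearIndependent.pair_iff.1 hli 1 (-t) (by rw [← ht]; module)
      exact one_ne_zero this.1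
    rcases RootPairing.IsReduced.eq_or_eq_neg i j hdep with h | h
    · exact .inl (P.root.injective h)
    · exact .inr (P.root.injective
        (by rw [h, P.root_reflectionPerm, P.reflection_apply_self]))
  · rintro (rfl | rfl)
    · exact ⟨1, one_smul _ _⟩
    · exact ⟨-1, by rw [P.root_reflectionPerm, P.reflection_apply_self, neg_one_smul]⟩

/-- The nilpotent points associated to a single root are the conjugates of half its coroot, scaled
by the parameter, unless the parameter vanishes. -/
lemma isNilpotentFor_singleton_iff [P.IsReduced] (hc : IsInvariant P c) {j : ι}
    {x : ℂ ⊗[ℝ] N} : IsNilpotentFor P c {j} x ↔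
      c j ≠ 0 ∧ IsConjugate P x ((1 : ℂ) ⊗ₜ[ℝ] ((c j / 2) • P.coroot j)) := by
  have hne : j ≠ P.reflectionPerm j j := by
    intro h
    have h' := congrArg P.root h
    rw [P.root_reflectionPerm, P.reflection_apply_self, ← add_eq_zero_iff_eq_neg, ← two_smul ℝ,
      smul_eq_zero] at h'
    exact P.ne_zero j (h'.resolve_left two_ne_zero)
  have htmul : ∀ (s : ℝ) (i : ι), (1 : ℂ) ⊗ₜ[ℝ] (s • P.coroot i) =
      (s : ℂ) • ((1 : ℂ) ⊗ₜ[ℝ] P.coroot i) := by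
    intro s i
    rw [TensorProduct.tmul_smul, TensorProduct.smul_tmul', TensorProduct.smul_tmul']
    simp
  constructor
  · rintro ⟨γ, hγ, hx, hcount⟩
    rw [corootSpan, Set.image_singleton, Submodule.mem_span_singleton] at hγ
    obtain ⟨z, rfl⟩ := hγ
    have hj : eval P j (z • ((1 : ℂ) ⊗ₜ[ℝ] P.coroot j)) = 2 * z := by
      rw [eval_smul, eval_coroot, P.pairing_same]
      push_cast
      ring
    have hz : z ≠ 0 := by
      rintro rfl
      simp only [CountEq, zero_smul, eval_zero, and_true, subroots_singleton,
        Set.ncard_singleton] at hcount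
      have h₁ : {i ∈ ({j, P.reflectionPerm j j} : Set ι) | (0 : ℂ) = c i}.ncard ≤ 2 :=
        (Set.ncard_le_ncard (Set.sep_subset _ _) (by simp)).trans_eq (Set.ncard_pair hne)
      have h₂ : {i | i ∈ ({j, P.reflectionPerm j j} : Set ι)}.ncard = 2 := Set.ncard_pair hne
      rw [h₂] at hcount
      omega
    have hpos :
        {i ∈ subroots P {j} | eval P i (z • ((1 : ℂ) ⊗ₜ[ℝ] P.coroot j)) = c i}.Nonempty := by
      apply Set.nonempty_of_ncard_ne_zero
      rw [CountEq, Set.ncard_singleton] at hcount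
      omega
    obtain ⟨i, hi, hic⟩ := hpos
    rw [subroots_singleton] at hi
    rcases hi with rfl | hi
    · rw [hj] at hic
      have hz' : z = ((c i / 2 : ℝ) : ℂ) := by
        push_cast
        linear_combination hic / 2
      refine ⟨fun h0 => hz (by rw [hz', h0]; simp), ?_⟩
      rwa [htmul, ← hz']
    · rw [Set.mem_singleton_iff] at hi
      rw [hi, eval_reflectionPerm_self, hj, hc] at hic
      have hz' : -z = ((c j / 2 : ℝ) : ℂ) := by
        push_cast
        linear_combination hic / 2
      refine ⟨fun h0 => hz (by rw [← neg_eq_zero, hz', h0]; simp), ?_⟩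
      refine hx.trans ?_
      convert isConjugate_coroot (P := P) (c j / 2) j j using 1
      rw [htmul, ← hz', P.coroot_reflectionPerm, P.coreflection_apply_self, TensorProduct.tmul_neg,
        smul_neg, neg_smul, neg_neg]
  · rintro ⟨h0, hx⟩
    refine ⟨_, ?_, hx, ?_⟩
    · rw [htmul]
      exact Submodule.smul_mem _ _ (Submodule.subset_span ⟨j, rfl, rfl⟩)
    · have hj : eval P j ((1 : ℂ) ⊗ₜ[ℝ] ((c j / 2) • P.coroot j)) = c j := by
        rw [htmul, eval_smul, eval_coroot, P.pairing_same]
        push_cast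
        ring
      have h0' : (c j : ℂ) ≠ 0 := by exact_mod_cast h0
      have h₁ : {i ∈ subroots P {j} | eval P i ((1 : ℂ) ⊗ₜ[ℝ] ((c j / 2) • P.coroot j)) = c i} =
          {j} := by
        ext i
        simp only [subroots_singleton, Set.mem_ofPred_eq, Set.mem_insert_iff,
          Set.mem_singleton_iff]
        constructor
        · rintro ⟨rfl | rfl, hi⟩
          · rfl
          · rw [eval_reflectionPerm_self, hj, hc, neg_eq_self] at hi
            exact absurd hi h0'
        · rintro rfl
          exact ⟨.inl rfl, hj⟩
      have h₂ :
          {i ∈ subroots P {j} | eval P i ((1 : ℂ) ⊗ₜ[ℝ] ((c j / 2) • P.coroot j)) = 0} = ∅ := by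
        ext i
        simp only [subroots_singleton, Set.mem_ofPred_eq, Set.mem_insert_iff,
          Set.mem_singleton_iff, Set.mem_empty_iff_false, iff_false]
        rintro ⟨rfl | rfl, hi⟩
        · exact h0' (hj ▸ hi)
        · rw [eval_reflectionPerm_self, hj, neg_eq_zero] at hi
          exact h0' hi
      rw [CountEq, h₁, h₂]
      simp

/-! ### Conjugacy in dihedral root systems -/

namespace IsDihedralList

lemma eval_add (hb : IsDihedralList P n b) (m : ℤ) (x : ℂ ⊗[ℝ] N) :
    eval P (b (m + n)) x = -eval P (b m) x := by
  rw [← eval_reflectionPerm_self, hb.reflectionPerm_eq]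
  congr 2
  ring

lemma exists_reflection (hb : IsDihedralList P n b) (t : ℤ) (x : ℂ ⊗[ℝ] N) :
    ∃ y, IsConjugate P x y ∧ ∀ m, eval P (b (2 * t - m + n)) y = eval P (b m) x := by
  refine ⟨_, (isConjugate_coreflection (b t) x).symm, fun m => ?_⟩
  rw [eval_coreflection, hb.reflectionPerm_eq]
  congr 2
  ring

/-- Two roots with indices `i`, `j` can be moved to the positions `k - 1` and `n - k` if they
enclose the same angle: depending on parities this is done by a reflection or by a rotation. -/
lemma exists_conj_of_sub_eq (hb : IsDihedralList P n b) (hc : IsInvariant P c) {i j k : ℤ}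
    (hk : i - j = n + 1 - 2 * k) {x : ℂ ⊗[ℝ] N} (hi : eval P (b i) x = c (b i))
    (hj : eval P (b j) x = c (b j)) :
    ∃ y, IsConjugate P x y ∧ eval P (b (k - 1)) y = c (b (k - 1)) ∧
      eval P (b (n - k)) y = c (b (n - k)) := by
  rcases Int.even_or_odd' (j - k) with ⟨t, ht | ht⟩
  · obtain ⟨y, hxy, hy⟩ := hb.exists_reflection t x
    refine ⟨y, hxy, ?_, ?_⟩
    · rw [show k - 1 = 2 * t - i + n by omega, hy, hi, hb.param_reflection hc]
    · rw [show n - k = 2 * t - j + n by omega, hy, hj, hb.param_reflection hc]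
  · obtain ⟨y, hxy, hy⟩ := hb.exists_reflection 0 x
    obtain ⟨z, hyz, hz⟩ := hb.exists_reflection (-t - 1) y
    refine ⟨z, hxy.trans hyz, ?_, ?_⟩
    · rw [show k - 1 = 2 * (-t - 1) - (2 * 0 - j + n) + n by omega, hz, hy, hj,
        hb.param_reflection hc, hb.param_reflection hc]
    · rw [show n - k = 2 * (-t - 1) - (2 * 0 - i + n) + n by omega, hz, hy, hi,
        hb.param_reflection hc, hb.param_reflection hc]

/-- Up to conjugacy, a point at which two roots with suitable parities take their parameters as
values is the point at which the roots `β_(k-1)` and `β_(n-k)` do so. -/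
lemma exists_conj_standard (hb : IsDihedralList P n b) (hc : IsInvariant P c) {i j : ℤ}
    (hij : ¬ (n : ℤ) ∣ i - j) (hpar : (2 : ℤ) ∣ i - j + n + 1) {x : ℂ ⊗[ℝ] N}
    (hi : eval P (b i) x = c (b i)) (hj : eval P (b j) x = c (b j)) :
    ∃ k : ℕ, 1 ≤ k ∧ k ≤ n / 2 ∧ ∃ y, IsConjugate P x y ∧
      eval P (b (k - 1)) y = c (b (k - 1)) ∧ eval P (b (n - k)) y = c (b (n - k)) := by
  have hn := hb.three_le
  -- the angle between the two roots, in `[0, 2 n)`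
  obtain ⟨q, δ, hδ, hδ₀, hδ₁⟩ : ∃ q δ : ℤ, i - j = 2 * n * q + δ ∧ 0 ≤ δ ∧ δ < 2 * n :=
    ⟨(i - j) / (2 * n), (i - j) % (2 * n), (Int.mul_ediv_add_emod _ _).symm,
      Int.emod_nonneg _ (by omega), Int.emod_lt_of_pos _ (by omega)⟩
  have h0 : δ ≠ 0 := by
    rintro rfl
    exact hij ⟨2 * q, by rw [hδ]; ring⟩
  have h1 : δ ≠ n := by
    rintro rfl
    exact hij ⟨2 * q + 1, by rw [hδ]; ring⟩
  have hpar' : (2 : ℤ) ∣ δ + n + 1 := by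
    have h2 : δ + n + 1 = (i - j + n + 1) - 2 * (n * q) := by rw [hδ]; ring
    rw [h2]
    exact Dvd.dvd.sub hpar ⟨_, rfl⟩
  rcases lt_or_gt_of_ne h1 with hlt | hgt
  · obtain ⟨k, hk⟩ : ∃ k : ℕ, δ = n + 1 - 2 * k := ⟨((n + 1 - δ) / 2).toNat, by omega⟩
    have hi' : b (j + δ) = b i := by
      rw [show i = j + δ + 2 * n * q by linarith, hb.apply_add_two_mul]
    refine ⟨k, by omega, by omega,
      hb.exists_conj_of_sub_eq hc (i := j + δ) (j := j) (by omega) ?_ hj⟩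
    rw [hi', hi]
  · obtain ⟨k, hk⟩ : ∃ k : ℕ, 2 * n - δ = n + 1 - 2 * k :=
      ⟨((n + 1 - (2 * n - δ)) / 2).toNat, by omega⟩
    have hj' : b (i - δ + 2 * n) = b j := by
      rw [show i - δ + 2 * n = j + 2 * n * (q + 1) by linarith, hb.apply_add_two_mul]
    refine ⟨k, by omega, by omega,
      hb.exists_conj_of_sub_eq hc (i := i - δ + 2 * n) (j := i) (by omega) ?_ hi⟩
    rw [hj', hj]

lemma isConjugate_coroot (hb : IsDihedralList P n b) (s : ℝ) {i l : ℤ}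
    (h : (2 : ℤ) ∣ i - l ∨ (2 : ℤ) ∣ i + l + n) :
    IsConjugate P ((1 : ℂ) ⊗ₜ[ℝ] (s • P.coroot (b i))) ((1 : ℂ) ⊗ₜ[ℝ] (s • P.coroot (b l))) := by
  have key := fun t m => SolvablePoints.isConjugate_coroot (P := P) s (b t) (b m)
  simp only [hb.reflectionPerm_eq] at key
  rcases h with ⟨t, ht⟩ | ⟨t, ht⟩
  · have := (key t (2 * 0 - l + n)).trans (key 0 l)
    rwa [show 2 * t - (2 * 0 - l + n) + n = i by omega] at this
  · have := key (t - n) l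
    rwa [show 2 * (t - n) - l + n = i by omega] at this

/-! ### Counting roots with given values in dihedral root systems -/

lemma eval_smul_coroot (hb : IsDihedralList P n b) (s : ℝ) (i m : ℤ) :
    eval P (b m) ((1 : ℂ) ⊗ₜ[ℝ] ((s / 2) • P.coroot (b i))) =
      (s : ℂ) * Real.cos ((m - i) * (Real.pi / n)) := by
  rw [eval_tmul, map_smul, show P.root' (b m) (P.coroot (b i)) = P.pairing (b m) (b i) from rfl,
    hb.pairing_eq, smul_eq_mul]
  push_cast
  ring

/-- A nonzero value is taken by at most two roots. -/
lemma eq_or_eq_of_eval_eq (hb : IsDihedralList P n b) {i j m : ℤ} (hij : b i ≠ b j)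
    {x : ℂ ⊗[ℝ] N} (h : eval P (b i) x = eval P (b j) x) (h0 : eval P (b i) x ≠ 0)
    (hm : eval P (b m) x = eval P (b i) x) : b m = b i ∨ b m = b j := by
  obtain ⟨A, hA⟩ := hb.exists_polar hij h
  have hA0 : A ≠ 0 := by
    rintro rfl
    exact h0 (by rw [hA, zero_mul])
  rw [hA, hA, mul_right_inj' hA0, Complex.ofReal_inj] at hm
  have hn := hb.three_le
  -- double the angles in order to have integral multiples of `π / (2 n)`
  have key := cos_mul_pi_div_eq_cos_iff (n := 2 * n) (by omega) (2 * m - (i + j)) (2 * i - (i + j))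
  have e : ∀ k : ℤ, ((2 * k - (i + j) : ℤ) : ℝ) * (Real.pi / (2 * n : ℕ)) =
      (k - (i + j) / 2) * (Real.pi / n) := by
    intro k
    push_cast
    field_simp
  rw [e, e] at key
  rcases key.1 hm with h | h
  · left
    rw [hb.eq_iff]
    obtain ⟨q, hq⟩ := h
    refine ⟨q, ?_⟩
    push_cast at hq
    linarith
  · right
    rw [hb.eq_iff]
    obtain ⟨q, hq⟩ := h
    refine ⟨q, ?_⟩
    push_cast at hq
    linarith

/-- If two roots take the same value, then another root vanishes provided that the bisector has
the right parity. -/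
lemma exists_eval_eq_zero (hb : IsDihedralList P n b) {i j : ℤ} (hij : b i ≠ b j)
    {x : ℂ ⊗[ℝ] N} (h : eval P (b i) x = eval P (b j) x) (hpar : (2 : ℤ) ∣ i + j + n) :
    ∃ z, eval P (b z) x = 0 := by
  obtain ⟨A, hA⟩ := hb.exists_polar hij h
  obtain ⟨z, hz⟩ := hpar
  refine ⟨z, ?_⟩
  have hz' : (i + j + n : ℝ) = 2 * z := by exact_mod_cast hz
  have := natCast_mul_pi_div hb.three_le
  rw [hA, show ((z : ℝ) - (i + j) / 2) * (Real.pi / n) = Real.pi / 2 by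
    linear_combination (-(Real.pi / n) / 2) * hz' + this / 2, Real.cos_pi_div_two]
  simp

/-- The position of a point at which some root vanishes. -/
lemma exists_polar_of_eval_eq_zero (hb : IsDihedralList P n b) {z : ℤ} {x : ℂ ⊗[ℝ] N}
    (h : eval P (b z) x = 0) :
    ∃ A : ℂ, ∀ m : ℤ, eval P (b m) x = A * Real.cos ((m - (z + n / 2)) * (Real.pi / n)) := by
  have hn := hb.three_le
  have hne : b z ≠ b (z + n) := by
    rw [Ne, hb.eq_iff]
    rintro ⟨q, hq⟩
    have : (n : ℤ) * (2 * q + 1) = 0 := by linarith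
    rcases mul_eq_zero.1 this with h | h <;> omega
  obtain ⟨A, hA⟩ := hb.exists_polar hne (by rw [hb.eval_add, h, neg_zero])
  refine ⟨A, fun m => ?_⟩
  rw [hA]
  congr 4
  push_cast
  ring

/-- Conversely, a vanishing root determines the parity of the bisector. -/
lemma two_dvd_of_eval_eq_zero (hb : IsDihedralList P n b) {i j z : ℤ} (hij : b i ≠ b j)
    {x : ℂ ⊗[ℝ] N} (h : eval P (b i) x = eval P (b j) x) (h0 : eval P (b i) x ≠ 0)
    (hz : eval P (b z) x = 0) : (2 : ℤ) ∣ i + j + n := by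
  obtain ⟨A, hA⟩ := hb.exists_polar_of_eval_eq_zero hz
  have hA0 : A ≠ 0 := by
    rintro rfl
    exact h0 (by rw [hA, zero_mul])
  rw [hA, hA, mul_right_inj' hA0, Complex.ofReal_inj] at h
  have hn := hb.three_le
  have key := cos_mul_pi_div_eq_cos_iff (n := 2 * n) (by omega) (2 * i - (2 * z + n))
    (2 * j - (2 * z + n))
  have e : ∀ k : ℤ, ((2 * k - (2 * z + n) : ℤ) : ℝ) * (Real.pi / (2 * n : ℕ)) =
      (k - (z + n / 2)) * (Real.pi / n) := by
    intro k
    push_cast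
    field_simp
  rw [e, e] at key
  rcases key.1 h with ⟨q, hq⟩ | ⟨q, hq⟩
  · refine absurd (hb.eq_iff.2 ⟨q, ?_⟩) hij
    push_cast at hq
    linarith
  · refine ⟨n * q + z + n, ?_⟩
    push_cast at hq
    linarith

variable [P.IsRootSystem]

lemma setOf_eval_eq_zero (hb : IsDihedralList P n b) {z : ℤ} {x : ℂ ⊗[ℝ] N} (hx : x ≠ 0)
    (hz : eval P (b z) x = 0) : {i | eval P i x = 0} = {b z, b (z + n)} := by
  ext i
  obtain ⟨m, rfl⟩ := hb.surjective i
  simp only [Set.mem_ofPred_eq, Set.mem_insert_iff, Set.mem_singleton_iff]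
  constructor
  · intro hm
    have hdvd : (n : ℤ) ∣ m - z := by
      by_contra h
      exact hx (hb.eq_of_eval_eq h (by rw [hm, eval_zero]) (by rw [hz, eval_zero]))
    obtain ⟨q, hq⟩ := hdvd
    rcases Int.even_or_odd' q with ⟨r, rfl | rfl⟩
    · exact .inl (hb.eq_iff.2 ⟨r, by rw [hq]; ring⟩)
    · exact .inr (hb.eq_iff.2 ⟨r, by linear_combination hq⟩)
  · rintro (h | h)
    · rw [h, hz]
    · rw [h, hb.eval_add, hz, neg_zero]

lemma ncard_eval_eq_zero (hb : IsDihedralList P n b) {z : ℤ} {x : ℂ ⊗[ℝ] N} (hx : x ≠ 0)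
    (hz : eval P (b z) x = 0) : {i | eval P i x = 0}.ncard = 2 := by
  have hn := hb.three_le
  rw [hb.setOf_eval_eq_zero hx hz, Set.ncard_pair]
  rw [Ne, hb.eq_iff]
  rintro ⟨q, hq⟩
  have : (n : ℤ) * (2 * q + 1) = 0 := by linarith
  rcases mul_eq_zero.1 this with h | h <;> omega

end IsDihedralList

end Dihedral

section Dihedral

variable {ι M N : Type*} [AddCommGroup M] [Module ℝ M] [AddCommGroup N] [Module ℝ N]
variable {P : RootPairing ι ℝ M N} {n : ℕ} {b : ℤ → ι} {c : ι → ℝ}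

namespace IsDihedralList

lemma ne_zero_of_eval_eq (hb : IsDihedralList P n b) (hc : IsInvariant P c) (hc0 : ∃ i, c i ≠ 0)
    {i j : ℤ} {x : ℂ ⊗[ℝ] N} (hi : eval P (b i) x = c (b i)) (hj : eval P (b j) x = c (b j))
    (hij : ¬ (2 : ℤ) ∣ i - j) : x ≠ 0 := by
  rintro rfl
  rw [eval_zero, eq_comm, Complex.ofReal_eq_zero] at hi hj
  obtain ⟨k, hk⟩ := hc0
  obtain ⟨m, rfl⟩ := hb.surjective k
  rcases (by omega : (2 : ℤ) ∣ m - i ∨ (2 : ℤ) ∣ m - j) with h | h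
  · exact hk (by rw [hb.param_eq hc h, hi])
  · exact hk (by rw [hb.param_eq hc h, hj])

lemma apply_ne_of_not_two_dvd (hb : IsDihedralList P n b) {i j : ℤ} (hij : ¬ (2 : ℤ) ∣ i - j) :
    b i ≠ b j := by
  intro h
  obtain ⟨q, hq⟩ := hb.eq_iff.1 h
  exact hij ⟨n * q, by rw [hq]; ring⟩

lemma apply_eq_reflection_iff (hb : IsDihedralList P n b) {i μ : ℤ} :
    b i = b (2 * μ - i) ↔ (n : ℤ) ∣ i - μ := by
  rw [hb.eq_iff, show i - (2 * μ - i) = 2 * (i - μ) by ring]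
  exact mul_dvd_mul_iff_left two_ne_zero

lemma param_const (hodd : Odd n) (hb : IsDihedralList P n b) (hc : IsInvariant P c) (i j : ι) :
    c i = c j := by
  obtain ⟨i, rfl⟩ := hb.surjective i
  obtain ⟨j, rfl⟩ := hb.surjective j
  obtain ⟨r, hr⟩ := hodd
  rcases (by omega : (2 : ℤ) ∣ i - j ∨ (2 : ℤ) ∣ (i + n) - j) with h | h
  · exact hb.param_eq hc h
  · rw [← hb.param_add hc i, hb.param_eq hc h]

/-! ### Dihedral root systems with an odd number of positive roots -/

section Odd

variable (hodd : Odd n)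
include hodd

/-- The roots `β_(k-1)` and `β_(n-k)` take the same value, so no other root takes this value, and a
vanishing root is excluded by the parity of their bisector. -/
lemma isDistinguished_of_odd [Finite ι] {Δ : Set ι} (hΔ : Δ.ncard = 2)
    (hb : IsDihedralList P n b) (hc : IsInvariant P c) (hc0 : ∃ i, c i ≠ 0) {k : ℕ}
    (hk : 1 ≤ k) (hk' : k ≤ n / 2) {x : ℂ ⊗[ℝ] N}
    (hi : eval P (b (k - 1)) x = c (b (k - 1))) (hj : eval P (b (n - k)) x = c (b (n - k))) :
    IsDistinguished P Δ c x := by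
  have hn := hb.three_le
  have hconst := hb.param_const hodd hc
  have h0 : ∀ i, (c i : ℂ) ≠ 0 := by
    obtain ⟨i, hi⟩ := hc0
    intro j
    rw [hconst j i]
    exact_mod_cast hi
  have hne : b (k - 1) ≠ b (n - k) := by
    rw [Ne, hb.eq_iff]
    intro h
    have := Int.le_of_dvd (by omega) ((dvd_neg).2 h)
    omega
  have heq : eval P (b (k - 1)) x = eval P (b (n - k)) x := by
    rw [hi, hj, hconst]
  have h₁ : {i | eval P i x = c i} = {b (k - 1), b (n - k)} := by
    ext i
    simp only [Set.mem_ofPred_eq, Set.mem_insert_iff, Set.mem_singleton_iff]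
    constructor
    · intro h
      obtain ⟨m, rfl⟩ := hb.surjective i
      refine hb.eq_or_eq_of_eval_eq hne heq (by rw [hi]; exact h0 _) ?_
      rw [h, hi, hconst]
    · rintro (rfl | rfl)
      exacts [hi, hj]
  have h₂ : {i | eval P i x = 0} = ∅ := by
    ext i
    simp only [Set.mem_ofPred_eq, Set.mem_empty_iff_false, iff_false]
    intro h
    obtain ⟨m, rfl⟩ := hb.surjective i
    have := hb.two_dvd_of_eval_eq_zero hne heq (by rw [hi]; exact h0 _) h
    obtain ⟨r, hr⟩ := hodd
    omega
  rw [IsDistinguished, countEq_univ, h₁, h₂, Set.ncard_pair hne, hΔ, Set.ncard_empty]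

/-- For odd `n` no root vanishes at a nonzero multiple of a coroot. -/
lemma countEq_coroot_of_odd [Finite ι] (hb : IsDihedralList P n b) (hc : IsInvariant P c)
    (hc0 : ∃ i, c i ≠ 0) (i : ℤ) :
    CountEq P c Set.univ 1 ((1 : ℂ) ⊗ₜ[ℝ] ((c (b i) / 2) • P.coroot (b i))) := by
  have hn := hb.three_le
  have hconst := hb.param_const hodd hc
  have h0 : (c (b i) : ℂ) ≠ 0 := by
    obtain ⟨j, hj⟩ := hc0
    rw [hconst _ j]
    exact_mod_cast hj
  have h₁ : {l | eval P l ((1 : ℂ) ⊗ₜ[ℝ] ((c (b i) / 2) • P.coroot (b i))) = c l} = {b i} := by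
    ext l
    obtain ⟨m, rfl⟩ := hb.surjective l
    rw [Set.mem_ofPred_eq, hb.eval_smul_coroot, Set.mem_singleton_iff, hconst (b m) (b i),
      mul_eq_left₀ h0, hb.eq_iff, ← cos_mul_pi_div_eq_one_iff hn]
    push_cast
    exact_mod_cast Iff.rfl
  have h₂ : {l | eval P l ((1 : ℂ) ⊗ₜ[ℝ] ((c (b i) / 2) • P.coroot (b i))) = 0} = ∅ := by
    ext l
    obtain ⟨m, rfl⟩ := hb.surjective l
    simp only [Set.mem_ofPred_eq, Set.mem_empty_iff_false, iff_false, hb.eval_smul_coroot,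
      mul_eq_zero, h0, false_or, Complex.ofReal_eq_zero]
    intro h
    have h' := Real.cos_two_mul ((m - i) * (Real.pi / n))
    rw [h, show 2 * (((m : ℝ) - i) * (Real.pi / n)) = ((2 * (m - i) + n : ℤ) : ℝ) * (Real.pi / n)
      - Real.pi by push_cast; linear_combination -natCast_mul_pi_div hn, Real.cos_sub_pi] at h'
    obtain ⟨q, hq⟩ := (cos_mul_pi_div_eq_one_iff hn (2 * (m - i) + n)).1 (by linarith)
    obtain ⟨r, hr⟩ := hodd
    have : 2 * ((m - i) + r - n * q) = -1 := by
      have : (n : ℤ) = 2 * r + 1 := by exact_mod_cast hr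
      linarith
    omega
  rw [countEq_univ, h₁, h₂]
  simp

lemma isSolvable_coroot_of_odd [Finite ι] [P.IsReduced] {Δ : Set ι} (hΔ : b 0 ∈ Δ)
    (hb : IsDihedralList P n b)
    (hc : IsInvariant P c) (hc0 : ∃ i, c i ≠ 0) (i : ℤ) :
    IsSolvable P Δ c ((1 : ℂ) ⊗ₜ[ℝ] ((c (b i) / 2) • P.coroot (b i))) := by
  have hconst := hb.param_const hodd hc
  refine ⟨{b 0}, by simpa using hΔ, ?_, ?_⟩
  · rw [isNilpotentFor_singleton_iff hc]
    refine ⟨?_, ?_⟩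
    · obtain ⟨j, hj⟩ := hc0
      rwa [hconst _ j]
    · rw [hconst (b i) (b 0)]
      refine hb.isConjugate_coroot _ ?_
      obtain ⟨r, hr⟩ := hodd
      omega
  · rw [Set.ncard_singleton]
    exact hb.countEq_coroot_of_odd hodd hc hc0 i

/-- A solvable point is associated to a single simple root, hence conjugate to half a coroot times
the parameter, or to both simple roots. In the latter case two roots take the parameter as value,
and no root vanishes, which determines the parity of the angle between the two roots. -/
lemma exists_conj_of_isSolvable_of_odd [P.IsRootSystem] [Finite ι] [P.IsReduced] {Δ : Set ι}
    (hΔ : Δ = {b 0, b (n - 1)}) (hΔ2 : Δ.ncard = 2)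
    (hb : IsDihedralList P n b) (hc : IsInvariant P c) (hc0 : ∃ i, c i ≠ 0) {x : ℂ ⊗[ℝ] N}
    (hx : IsSolvable P Δ c x) (l : ℤ) :
    (∃ k : ℕ, 1 ≤ k ∧ k ≤ n / 2 ∧ ∃ y, IsConjugate P x y ∧
      eval P (b (k - 1)) y = c (b (k - 1)) ∧ eval P (b (n - k)) y = c (b (n - k))) ∨
    IsConjugate P x ((1 : ℂ) ⊗ₜ[ℝ] ((c (b l) / 2) • P.coroot (b l))) := by
  have hn := hb.three_le
  have hconst := hb.param_const hodd hc
  have h0 : ∀ i, (c i : ℂ) ≠ 0 := by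
    obtain ⟨i, hi⟩ := hc0
    intro j
    rw [hconst j i]
    exact_mod_cast hi
  have hsingle : ∀ i, IsNilpotentFor P c {b i} x →
      IsConjugate P x ((1 : ℂ) ⊗ₜ[ℝ] ((c (b l) / 2) • P.coroot (b l))) := by
    intro i hi
    rw [isNilpotentFor_singleton_iff hc, hconst (b i) (b l)] at hi
    refine hi.2.trans (hb.isConjugate_coroot _ ?_)
    obtain ⟨r, hr⟩ := hodd
    omega
  obtain ⟨J, hJ, hnil, hcount⟩ := hx
  rw [hΔ, Set.subset_pair_iff_eq] at hJ
  rcases hJ with rfl | rfl | rfl | rfl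
  · exact absurd hcount (not_isNilpotentFor_empty hc0 hnil)
  · exact .inr (hsingle 0 hnil)
  · exact .inr (hsingle _ hnil)
  left
  rw [← hΔ, hΔ2, countEq_univ] at hcount
  obtain ⟨i, hi, j, hj, hij⟩ := (Set.one_lt_ncard (Set.toFinite _)).1
    (by omega : 1 < {i | eval P i x = c i}.ncard)
  obtain ⟨i, rfl⟩ := hb.surjective i
  obtain ⟨j, rfl⟩ := hb.surjective j
  rw [Set.mem_ofPred_eq] at hi hj
  have heq : eval P (b i) x = eval P (b j) x := by rw [hi, hj, hconst]
  have hi0 : eval P (b i) x ≠ 0 := by rw [hi]; exact h0 _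
  have hx0 : x ≠ 0 := by
    rintro rfl
    exact hi0 (eval_zero _ _)
  have hle : {i | eval P i x = c i}.ncard ≤ 2 := by
    rw [← Set.ncard_pair hij]
    refine Set.ncard_le_ncard (fun m hm => ?_) (Set.toFinite _)
    obtain ⟨m, rfl⟩ := hb.surjective m
    exact hb.eq_or_eq_of_eval_eq hij heq hi0 (by rw [hi, hm, hconst])
  refine hb.exists_conj_standard hc (i := i) (j := j) ?_ ?_ hi hj
  · rintro ⟨q, hq⟩
    rcases Int.even_or_odd' q with ⟨r, rfl | rfl⟩
    · exact hij (hb.eq_iff.2 ⟨r, by rw [hq]; ring⟩)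
    · have : b i = b (j + n) := hb.eq_iff.2 ⟨r, by linear_combination hq⟩
      rw [this, hb.eval_add, ← sub_eq_zero] at heq
      refine hi0 ?_
      rw [this, hb.eval_add]
      linear_combination heq / 2
  · by_contra hpar
    obtain ⟨z, hz⟩ := hb.exists_eval_eq_zero hij heq (by obtain ⟨r, hr⟩ := hodd; omega)
    have := hb.ncard_eval_eq_zero hx0 hz
    omega

end Odd

/-! ### Dihedral root systems with an even number of positive roots -/

section Even

variable [P.IsRootSystem]

variable (heven : Even n)
include heven

lemma not_dvd_sub_of_even {i j : ℤ} (hij : ¬ (2 : ℤ) ∣ i - j) : ¬ (n : ℤ) ∣ i - j := by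
  intro h
  refine hij (Dvd.dvd.trans ?_ h)
  obtain ⟨r, rfl⟩ := heven
  exact ⟨r, by push_cast; ring⟩

/-- If a point lies in the direction `μ π / n` with an integer `μ`, then two roots vanish at it, and
the roots that take their parameters as values come in pairs that are symmetric with respect to
`μ`. -/
lemma ncard_of_polar [Finite ι] (hb : IsDihedralList P n b) (hc : IsInvariant P c) {i j μ : ℤ}
    (hij : ¬ (2 : ℤ) ∣ i - j) {x : ℂ ⊗[ℝ] N} (hx : x ≠ 0) {A : ℂ}
    (hA : ∀ m : ℤ, eval P (b m) x = A * Real.cos ((m - μ) * (Real.pi / n)))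
    (hi : eval P (b i) x = c (b i)) (hj : eval P (b j) x = c (b j)) :
    {m | eval P m x = 0}.ncard = 2 ∧
      {m | eval P m x = c m} = {b i, b (2 * μ - i), b j, b (2 * μ - j)} := by
  have hn := hb.three_le
  have hA0 : A ≠ 0 := by
    rintro rfl
    refine hx (SolvablePoints.eq_of_eval_eq P fun k => ?_)
    obtain ⟨m, rfl⟩ := hb.surjective k
    rw [hA, zero_mul, eval_zero]
  refine ⟨?_, ?_⟩
  · obtain ⟨r, hr⟩ := heven
    refine hb.ncard_eval_eq_zero (z := μ + r) hx ?_
    have h := natCast_mul_pi_div hn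
    have hr' : (n : ℝ) = 2 * r := by rw [hr]; push_cast; ring
    rw [hA, show (((μ + r : ℤ) : ℝ) - μ) * (Real.pi / n) = Real.pi / 2 by
      push_cast; linear_combination h / 2 - (Real.pi / n) / 2 * hr', Real.cos_pi_div_two]
    simp
  · have key : ∀ m l : ℤ, eval P (b m) x = eval P (b l) x ↔ b m = b l ∨ b m = b (2 * μ - l) := by
      intro m l
      have := cos_mul_pi_div_eq_cos_iff hn (m - μ) (l - μ)
      push_cast at this
      rw [hA, hA, mul_right_inj' hA0, Complex.ofReal_inj, this, hb.eq_iff, hb.eq_iff,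
        show m - μ - (l - μ) = m - l by ring, show m - μ + (l - μ) = m - (2 * μ - l) by ring]
    ext k
    obtain ⟨m, rfl⟩ := hb.surjective k
    simp only [Set.mem_ofPred_eq, Set.mem_insert_iff, Set.mem_singleton_iff]
    have hmem : ∀ l : ℤ, eval P (b l) x = c (b l) → b m = b l ∨ b m = b (2 * μ - l) →
        eval P (b m) x = c (b m) := by
      intro l hl h
      rw [(key m l).2 h, hl]
      rcases h with h | h
      · rw [h]
      · rw [h, hb.param_eq hc (by omega : (2 : ℤ) ∣ 2 * μ - l - l)]
    constructor
    · intro hm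
      rcases (by omega : (2 : ℤ) ∣ m - i ∨ (2 : ℤ) ∣ m - j) with h | h
      · have := (key m i).1 (by rw [hm, hi, hb.param_eq hc h])
        tauto
      · have := (key m j).1 (by rw [hm, hj, hb.param_eq hc h])
        tauto
    · intro h
      rcases (by tauto : (b m = b i ∨ b m = b (2 * μ - i)) ∨ (b m = b j ∨ b m = b (2 * μ - j)))
        with h | h
      · exact hmem i hi h
      · exact hmem j hj h

/-- The case in which the point is a multiple of a coroot. -/
lemma countEq_coroot_of_even [Finite ι] (hb : IsDihedralList P n b) (hc : IsInvariant P c)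
    {i j : ℤ} (hij : ¬ (2 : ℤ) ∣ i - j) (h0 : c (b i) ≠ 0)
    (hcos : c (b j) = c (b i) * Real.cos ((j - i) * (Real.pi / n))) :
    CountEq P c Set.univ 1 ((1 : ℂ) ⊗ₜ[ℝ] ((c (b i) / 2) • P.coroot (b i))) := by
  have hi : eval P (b i) ((1 : ℂ) ⊗ₜ[ℝ] ((c (b i) / 2) • P.coroot (b i))) = c (b i) := by
    rw [hb.eval_smul_coroot]
    simp
  have hj : eval P (b j) ((1 : ℂ) ⊗ₜ[ℝ] ((c (b i) / 2) • P.coroot (b i))) = c (b j) := by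
    rw [hb.eval_smul_coroot, hcos]
    push_cast
    ring
  have hx : (1 : ℂ) ⊗ₜ[ℝ] ((c (b i) / 2) • P.coroot (b i)) ≠ 0 := by
    intro hx
    rw [hx, eval_zero, eq_comm, Complex.ofReal_eq_zero] at hi
    exact h0 hi
  obtain ⟨h₁, h₂⟩ := hb.ncard_of_polar heven hc hij hx (hb.eval_smul_coroot _ _) hi hj
  have hij' : ¬ (2 : ℤ) ∣ i - (2 * i - j) := by omega
  have hne : b j ≠ b (2 * i - j) := by
    rw [Ne, hb.apply_eq_reflection_iff]
    exact not_dvd_sub_of_even heven (by omega)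
  rw [countEq_univ, h₁, h₂, show 2 * i - i = i by ring, Set.insert_eq_of_mem (by simp),
    Set.ncard_insert_of_notMem, Set.ncard_pair hne]
  simp only [Set.mem_insert_iff, Set.mem_singleton_iff, not_or]
  exact ⟨hb.apply_ne_of_not_two_dvd hij, hb.apply_ne_of_not_two_dvd hij'⟩

/-- The case in which the two equations are solved by a multiple of a coroot. -/
lemma eq_coroot_of_even (hb : IsDihedralList P n b) {i j : ℤ} (hij : ¬ (2 : ℤ) ∣ i - j)
    (hcos : c (b j) = c (b i) * Real.cos ((j - i) * (Real.pi / n))) {x : ℂ ⊗[ℝ] N}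
    (hi : eval P (b i) x = c (b i)) (hj : eval P (b j) x = c (b j)) :
    x = (1 : ℂ) ⊗ₜ[ℝ] ((c (b i) / 2) • P.coroot (b i)) := by
  refine hb.eq_of_eval_eq (not_dvd_sub_of_even heven hij) ?_ ?_
  · rw [hi, hb.eval_smul_coroot]
    simp
  · rw [hj, hb.eval_smul_coroot, hcos]
    push_cast
    ring

/-- The case in which the point is a multiple of a coroot: it is solvable, but not distinguished. -/
lemma solvable_and_not_distinguished [Finite ι] [P.IsReduced] {Δ : Set ι}
    (hΔ : Δ = {b 0, b (n - 1)}) (hΔ2 : Δ.ncard = 2) (hb : IsDihedralList P n b)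
    (hc : IsInvariant P c) (hc0 : ∃ i, c i ≠ 0) {i j : ℤ} (hij : ¬ (2 : ℤ) ∣ i - j)
    (hcos : c (b j) = c (b i) * Real.cos ((j - i) * (Real.pi / n))) {x : ℂ ⊗[ℝ] N}
    (hi : eval P (b i) x = c (b i)) (hj : eval P (b j) x = c (b j)) :
    IsSolvable P Δ c x ∧ ¬ IsDistinguished P Δ c x := by
  have hx0 := hb.ne_zero_of_eval_eq hc hc0 hi hj hij
  have hx := hb.eq_coroot_of_even heven hij hcos hi hj
  have h0 : c (b i) ≠ 0 := by
    intro h0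
    refine hx0 ?_
    rw [hx, h0]
    simp
  have hcount := hb.countEq_coroot_of_even heven hc hij h0 hcos
  rw [← hx] at hcount
  refine ⟨?_, fun h => ?_⟩
  · obtain ⟨l, hl, hil⟩ : ∃ l, b l ∈ Δ ∧ (2 : ℤ) ∣ i - l := by
      obtain ⟨r, hr⟩ := heven
      rcases Int.even_or_odd' i with ⟨s, hs | hs⟩
      · exact ⟨0, by simp [hΔ], by omega⟩
      · exact ⟨n - 1, by simp [hΔ], by omega⟩
    have hil' := hb.param_eq hc hil
    refine ⟨{b l}, by simpa using hl, ?_, by rwa [Set.ncard_singleton]⟩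
    rw [isNilpotentFor_singleton_iff hc, ← hil', hx]
    exact ⟨h0, hb.isConjugate_coroot _ (.inl hil)⟩
  · rw [IsDistinguished, hΔ2, countEq_univ] at h
    rw [countEq_univ] at hcount
    omega

/-- If a root vanishes, there are two such roots, and the two given roots together with their mirror
images give four roots that take their parameters as values. Otherwise these are just the two given
roots. The point is not a multiple of a coroot by the two assumptions on the cosine. -/
lemma isDistinguished_of_even [Finite ι] {Δ : Set ι} (hΔ2 : Δ.ncard = 2)
    (hb : IsDihedralList P n b) (hc : IsInvariant P c) (hc0 : ∃ i, c i ≠ 0) {i j : ℤ}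
    (hij : ¬ (2 : ℤ) ∣ i - j) {x : ℂ ⊗[ℝ] N}
    (hi : eval P (b i) x = c (b i)) (hj : eval P (b j) x = c (b j))
    (hij₁ : c (b j) ≠ c (b i) * Real.cos ((j - i) * (Real.pi / n)))
    (hij₂ : c (b i) ≠ c (b j) * Real.cos ((i - j) * (Real.pi / n))) :
    IsDistinguished P Δ c x := by
  have hx0 := hb.ne_zero_of_eval_eq hc hc0 hi hj hij
  have hn := hb.three_le
  have hne := hb.apply_ne_of_not_two_dvd hij
  rw [IsDistinguished, hΔ2, countEq_univ]
  by_cases hz : ∃ z, eval P (b z) x = 0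
  · obtain ⟨z, hz⟩ := hz
    obtain ⟨A, hA⟩ := hb.exists_polar_of_eval_eq_zero hz
    obtain ⟨r, hr⟩ := id heven
    have hr' : (n : ℝ) / 2 = r := by rw [hr]; push_cast; ring
    have hA' : ∀ m : ℤ, eval P (b m) x = A * Real.cos ((m - (z + r : ℤ)) * (Real.pi / n)) := by
      intro m
      rw [hA, hr']
      push_cast
      rfl
    obtain ⟨h₁, h₂⟩ := hb.ncard_of_polar heven hc hij hx0 hA' hi hj
    generalize z + r = μ at hA' h₂
    -- neither of the two roots lies in the direction of the point
    have hdir : ∀ k l : ℤ, eval P (b k) x = c (b k) → eval P (b l) x = c (b l) →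
        c (b l) ≠ c (b k) * Real.cos ((l - k) * (Real.pi / n)) → b k ≠ b (2 * μ - k) := by
      intro k l hk hl hkl h
      rw [hb.apply_eq_reflection_iff] at h
      have hs : Real.sin ((k - μ) * (Real.pi / n)) = 0 := by
        have := (sin_mul_pi_div_eq_zero_iff hn (k - μ)).2 h
        push_cast at this
        exact this
      have hc2 := Real.sin_sq_add_cos_sq ((k - μ) * (Real.pi / n))
      refine hkl ?_
      rw [← Complex.ofReal_inj, Complex.ofReal_mul, ← hk, ← hl, hA', hA',
        show ((l : ℝ) - μ) * (Real.pi / n) = (l - k) * (Real.pi / n) + (k - μ) * (Real.pi / n) by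
          ring, Real.cos_add, hs]
      push_cast
      ring
    have hi' := hdir i j hi hj hij₁
    have hj' := hdir j i hj hi hij₂
    rw [h₁, h₂, Set.ncard_insert_of_notMem, Set.ncard_insert_of_notMem, Set.ncard_pair hj']
    · simp only [Set.mem_insert_iff, Set.mem_singleton_iff, not_or]
      exact ⟨hb.apply_ne_of_not_two_dvd (by omega), hb.apply_ne_of_not_two_dvd (by omega)⟩
    · simp only [Set.mem_insert_iff, Set.mem_singleton_iff, not_or]
      exact ⟨hi', hne, hb.apply_ne_of_not_two_dvd (by omega)⟩
  · push Not at hz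
    have h₁ : {m | eval P m x = 0} = ∅ := by
      ext k
      obtain ⟨m, rfl⟩ := hb.surjective k
      simp [hz m]
    -- two different roots of the same parity with the same value would force a zero
    have huniq : ∀ k m : ℤ, (2 : ℤ) ∣ m - k → eval P (b k) x = c (b k) →
        eval P (b m) x = c (b m) → b m = b k := by
      intro k m hkm hk hm
      by_contra hmk
      obtain ⟨r, hr⟩ := id heven
      obtain ⟨z, hz'⟩ := hb.exists_eval_eq_zero hmk
        (by rw [hk, hm, hb.param_eq hc hkm]) (by omega)
      exact hz z hz'
    have h₂ : {m | eval P m x = c m} = {b i, b j} := by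
      ext k
      obtain ⟨m, rfl⟩ := hb.surjective k
      simp only [Set.mem_ofPred_eq, Set.mem_insert_iff, Set.mem_singleton_iff]
      constructor
      · intro hm
        rcases (by omega : (2 : ℤ) ∣ m - i ∨ (2 : ℤ) ∣ m - j) with h | h
        · exact .inl (huniq i m h hi hm)
        · exact .inr (huniq j m h hj hm)
      · rintro (h | h)
        · rw [h, hi]
        · rw [h, hj]
    rw [h₁, h₂, Set.ncard_pair hne, Set.ncard_empty]

/-- At a solvable point, up to conjugacy, two roots of different parity take their parameters as
values: otherwise all roots that do so have the same parity, so there are at most two of them, and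
they force other roots to vanish, against the counting equation. -/
lemma exists_conj_of_isSolvable_of_even [Finite ι] [P.IsReduced] {Δ : Set ι}
    (hΔ : Δ = {b 0, b (n - 1)}) (hΔ2 : Δ.ncard = 2)
    (hb : IsDihedralList P n b) (hc : IsInvariant P c) (hc0 : ∃ i, c i ≠ 0) {x : ℂ ⊗[ℝ] N}
    (hx : IsSolvable P Δ c x) :
    ∃ k : ℕ, 1 ≤ k ∧ k ≤ n / 2 ∧ ∃ y, IsConjugate P x y ∧
      eval P (b (k - 1)) y = c (b (k - 1)) ∧ eval P (b (n - k)) y = c (b (n - k)) := by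
  have hn := hb.three_le
  -- it is enough to find two roots of different parity
  suffices h : ∃ i j : ℤ, ¬ (2 : ℤ) ∣ i - j ∧ ∃ y, IsConjugate P x y ∧
      eval P (b i) y = c (b i) ∧ eval P (b j) y = c (b j) by
    obtain ⟨i, j, hij, y, hxy, hi, hj⟩ := h
    obtain ⟨r, hr⟩ := id heven
    obtain ⟨k, hk, hk', z, hyz, hz⟩ := hb.exists_conj_standard hc
      (not_dvd_sub_of_even heven hij) (by omega) hi hj
    exact ⟨k, hk, hk', z, hxy.trans hyz, hz⟩
  obtain ⟨J, hJ, hnil, hcount⟩ := hx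
  have hsingle : ∀ i, IsNilpotentFor P c {b i} x → CountEq P c Set.univ 1 x →
      ∃ i j : ℤ, ¬ (2 : ℤ) ∣ i - j ∧ ∃ y, IsConjugate P x y ∧
        eval P (b i) y = c (b i) ∧ eval P (b j) y = c (b j) := by
    intro i hi hx
    rw [isNilpotentFor_singleton_iff hc] at hi
    obtain ⟨h0, hxy⟩ := hi
    have hy := hx.conj hc hxy.symm
    have h0' : (c (b i) : ℂ) ≠ 0 := by exact_mod_cast h0
    have hvi : eval P (b i) ((1 : ℂ) ⊗ₜ[ℝ] ((c (b i) / 2) • P.coroot (b i))) = c (b i) := by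
      rw [hb.eval_smul_coroot]
      simp
    have hy0 : (1 : ℂ) ⊗ₜ[ℝ] ((c (b i) / 2) • P.coroot (b i)) ≠ 0 := by
      intro h
      rw [h, eval_zero] at hvi
      exact h0' hvi.symm
    obtain ⟨r, hr⟩ := id heven
    have hr' : (n : ℝ) = 2 * r := by rw [hr]; push_cast; ring
    have hz : eval P (b (i + r)) ((1 : ℂ) ⊗ₜ[ℝ] ((c (b i) / 2) • P.coroot (b i))) = 0 := by
      have h := natCast_mul_pi_div hn
      rw [hb.eval_smul_coroot, show (((i + r : ℤ) : ℝ) - i) * (Real.pi / n) = Real.pi / 2 by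
        push_cast; linear_combination h / 2 - (Real.pi / n) / 2 * hr', Real.cos_pi_div_two]
      simp
    rw [countEq_univ, hb.ncard_eval_eq_zero hy0 hz] at hy
    have hgt : 1 < {l | eval P l ((1 : ℂ) ⊗ₜ[ℝ] ((c (b i) / 2) • P.coroot (b i))) = c l}.ncard := by
      omega
    obtain ⟨k, hk, hki⟩ := Set.exists_ne_of_one_lt_ncard hgt (b i)
    obtain ⟨m, rfl⟩ := hb.surjective k
    refine ⟨i, m, fun him => hki ?_, _, hxy, hvi, hk⟩
    rw [Set.mem_ofPred_eq, hb.eval_smul_coroot, ← hb.param_eq hc him, mul_eq_left₀ h0',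
      Complex.ofReal_eq_one] at hk
    rw [hb.eq_iff, ← cos_mul_pi_div_eq_one_iff hn]
    push_cast
    exact hk
  rw [hΔ, Set.subset_pair_iff_eq] at hJ
  rcases hJ with rfl | rfl | rfl | rfl
  · exact absurd hcount (not_isNilpotentFor_empty hc0 hnil)
  · exact hsingle 0 hnil (by simpa using hcount)
  · exact hsingle _ hnil (by simpa using hcount)
  rw [← hΔ, hΔ2, countEq_univ] at hcount
  obtain ⟨i, hi, j, hj, hij⟩ := (Set.one_lt_ncard (Set.toFinite _)).1
    (by omega : 1 < {i | eval P i x = c i}.ncard)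
  obtain ⟨i, rfl⟩ := hb.surjective i
  obtain ⟨j, rfl⟩ := hb.surjective j
  rw [Set.mem_ofPred_eq] at hi hj
  by_contra! hall
  have hpar : ∀ m : ℤ, eval P (b m) x = c (b m) → (2 : ℤ) ∣ m - i := by
    intro m hm
    by_contra h
    exact hall m i h x (.refl x) hm hi
  -- now all roots in question have the same parity, hence the same value
  have hval : ∀ m : ℤ, eval P (b m) x = c (b m) → eval P (b m) x = eval P (b i) x := by
    intro m hm
    rw [hm, hi, hb.param_eq hc (hpar m hm)]
  have hi0 : eval P (b i) x ≠ 0 := by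
    intro h
    have : {i | eval P i x = c i}.ncard ≤ {i | eval P i x = 0}.ncard := by
      refine Set.ncard_le_ncard (fun k hk => ?_) (Set.toFinite _)
      obtain ⟨m, rfl⟩ := hb.surjective k
      rw [Set.mem_ofPred_eq, hval m hk, h]
    omega
  have hx0 : x ≠ 0 := by
    rintro rfl
    exact hi0 (eval_zero _ _)
  have hle : {i | eval P i x = c i}.ncard ≤ 2 := by
    rw [← Set.ncard_pair hij]
    refine Set.ncard_le_ncard (fun k hk => ?_) (Set.toFinite _)
    obtain ⟨m, rfl⟩ := hb.surjective k
    exact hb.eq_or_eq_of_eval_eq hij (hval j hj).symm hi0 (hval m hk)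
  obtain ⟨r, hr⟩ := id heven
  obtain ⟨z, hz⟩ := hb.exists_eval_eq_zero hij (hval j hj).symm
    (by have := hpar j hj; omega)
  have := hb.ncard_eval_eq_zero hx0 hz
  omega

end Even

end IsDihedralList

end Dihedral

section Dihedral

variable {ι M N : Type*} [AddCommGroup M] [Module ℝ M] [AddCommGroup N] [Module ℝ N]
variable {P : RootPairing ι ℝ M N} {n : ℕ} {b : ℤ → ι} {c : ι → ℝ}
  {B : N →ₗ[ℝ] N →ₗ[ℝ] ℝ}

/-! ### The points `γ_k` of a dihedral root system -/

/-- Coordinates with respect to a dual pair. -/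
lemma IsDualPair.eq_smul_add_smul {i j : ι} {e : Module.Basis (Fin 2) ℝ N}
    (h : IsDualPair P B i j e) (y : N) :
    y = B y (P.coroot i) • e 0 + B y (P.coroot j) • e 1 := by
  obtain ⟨h₀₀, h₀₁, h₁₀, h₁₁⟩ := h
  have hy := e.sum_repr y
  rw [Fin.sum_univ_two] at hy
  have hi : B y (P.coroot i) = e.repr y 0 := by
    conv_lhs => rw [← hy]
    simp [h₀₀, h₁₀]
  have hj : B y (P.coroot j) = e.repr y 1 := by
    conv_lhs => rw [← hy]
    simp [h₀₁, h₁₁]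
  rw [hi, hj, hy]

lemma IsDihedralList.exists_isDualPair (hb : IsDihedralList P n b)
    (hB : IsNormalizedInner P B) (hN : Module.finrank ℝ N = 2) {i j : ℤ}
    (hij : ¬ (n : ℤ) ∣ i - j) : ∃ e, IsDualPair P B (b i) (b j) e := by
  set C := Real.cos ((i - j) * (Real.pi / n)) with hC
  have hij' : B (P.coroot (b i)) (P.coroot (b j)) = 2 * C := by
    rw [hB.symm, ← hB.pairing_eq, hb.pairing_eq]
  have hji' : B (P.coroot (b j)) (P.coroot (b i)) = 2 * C := by rw [hB.symm, hij']
  have hC1 : 1 - C ^ 2 ≠ 0 := by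
    rw [hC, ← Real.sin_sq]
    have := (sin_mul_pi_div_eq_zero_iff hb.three_le (i - j)).not.2 hij
    push_cast at this
    exact pow_ne_zero 2 this
  let v : Fin 2 → N := ![(2 * (1 - C ^ 2))⁻¹ • (P.coroot (b i) - C • P.coroot (b j)),
    (2 * (1 - C ^ 2))⁻¹ • (P.coroot (b j) - C • P.coroot (b i))]
  have h₀₀ : B (v 0) (P.coroot (b i)) = 1 := by
    simp only [v, Matrix.cons_val_zero, map_smul, map_sub, LinearMap.smul_apply,
      LinearMap.sub_apply, hB.coroot_self, hji', smul_eq_mul]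
    field_simp
  have h₀₁ : B (v 0) (P.coroot (b j)) = 0 := by
    simp only [v, Matrix.cons_val_zero, map_smul, map_sub, LinearMap.smul_apply,
      LinearMap.sub_apply, hB.coroot_self, hij', smul_eq_mul]
    ring
  have h₁₀ : B (v 1) (P.coroot (b i)) = 0 := by
    simp only [v, Matrix.cons_val_one, Matrix.cons_val_fin_one, map_smul, map_sub,
      LinearMap.smul_apply, LinearMap.sub_apply, hB.coroot_self, hji', smul_eq_mul]
    ring
  have h₁₁ : B (v 1) (P.coroot (b j)) = 1 := by
    simp only [v, Matrix.cons_val_one, Matrix.cons_val_fin_one, map_smul, map_sub,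
      LinearMap.smul_apply, LinearMap.sub_apply, hB.coroot_self, hij', smul_eq_mul]
    field_simp
  have hv : LinearIndependent ℝ v := by
    rw [Fintype.linearIndependent_iff]
    intro g hg
    rw [Fin.sum_univ_two] at hg
    have hi : B (g 0 • v 0 + g 1 • v 1) (P.coroot (b i)) = 0 := by simp [hg]
    have hj : B (g 0 • v 0 + g 1 • v 1) (P.coroot (b j)) = 0 := by simp [hg]
    simp only [map_add, map_smul, LinearMap.add_apply, LinearMap.smul_apply, h₀₀, h₀₁, h₁₀, h₁₁,
      smul_eq_mul, mul_one, mul_zero, add_zero, zero_add] at hi hj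
    intro k
    fin_cases k
    exacts [hi, hj]
  refine ⟨basisOfLinearIndependentOfCardEqFinrank hv (by simp [hN]), ?_⟩
  simp only [IsDualPair, coe_basisOfLinearIndependentOfCardEqFinrank]
  exact ⟨h₀₀, h₀₁, h₁₀, h₁₁⟩

lemma IsDihedralList.isDihedralRoots (hb : IsDihedralList P n b) {Δ : Set ι} {a : Fin 2 → ι}
    (hΔ : Set.range a = Δ) (h₀ : b 0 = a 0) (h₁ : b (n - 1) = a 1) :
    IsDihedralRoots P Δ n a (fun m => b m) := by
  have hn := hb.three_le
  have hs := sin_pi_div_pos hn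
  have hsin : ∀ m : ℕ, m ≤ n → 0 ≤ Real.sin (m * (Real.pi / n)) := by
    intro m hm
    refine Real.sin_nonneg_of_nonneg_of_le_pi (by positivity) ?_
    have : (m : ℝ) ≤ n := by exact_mod_cast hm
    calc (m : ℝ) * (Real.pi / n) ≤ n * (Real.pi / n) := by gcongr
      _ = Real.pi := natCast_mul_pi_div hn
  intro i hi
  refine ⟨?_, ?_, ?_⟩
  · have hmem : ∀ k, P.root (a k) ∈ Submodule.span ℝ≥0 (P.root '' Δ) := fun k =>
      Submodule.subset_span ⟨a k, hΔ ▸ ⟨k, rfl⟩, rfl⟩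
    have hsmul : ∀ (t : ℝ) (k : Fin 2), 0 ≤ t →
        t • P.root (a k) ∈ Submodule.span ℝ≥0 (P.root '' Δ) := fun t k ht =>
      Submodule.smul_mem _ (⟨t, ht⟩ : ℝ≥0) (hmem k)
    rw [IsPositive, hb.root_eq, dihedralVec, h₀, h₁]
    refine Submodule.add_mem _ (hsmul _ _ ?_) (hsmul _ _ ?_)
    · have := hsin (i + 1) hi
      push_cast at this ⊢
      positivity
    · have := hsin i hi.le
      push_cast at this ⊢
      positivity
  · rw [hb.root_eq, dihedralVec, h₀, h₁, smul_add, smul_smul, smul_smul, mul_div_cancel₀ _ hs.ne',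
      mul_div_cancel₀ _ hs.ne', mul_div_assoc, mul_div_assoc]
    push_cast
    rfl
  · rw [hb.coroot_eq, dihedralVec, h₀, h₁, smul_add, smul_smul, smul_smul, mul_div_cancel₀ _ hs.ne',
      mul_div_cancel₀ _ hs.ne', mul_div_assoc, mul_div_assoc]
    push_cast
    rfl

/-- The values of two roots with the same bisector as the simple roots at the sum of the simple
coroots. -/
lemma two_mul_cos_add_two_mul_cos (hn : 3 ≤ n) (k : ℝ) :
    2 * Real.cos ((k - 1) * (Real.pi / n)) + 2 * Real.cos ((n - k) * (Real.pi / n)) =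
      4 * Real.sin ((2 * k - 1) / (2 * n) * Real.pi) * Real.sin (Real.pi / (2 * n)) := by
  have h := natCast_mul_pi_div hn
  have hn' : (n : ℝ) ≠ 0 := by positivity
  rw [show (n - k) * (Real.pi / n) = Real.pi - ((2 * k - 1) / (2 * n) * Real.pi +
      Real.pi / (2 * n)) by field_simp; ring,
    show (k - 1) * (Real.pi / n) = (2 * k - 1) / (2 * n) * Real.pi - Real.pi / (2 * n) by
      field_simp; ring, Real.cos_pi_sub, Real.cos_sub, Real.cos_add]
  ring

lemma sin_pi_div_two_mul_pos (hn : 3 ≤ n) : 0 < Real.sin (Real.pi / (2 * n)) := by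
  have := sin_pi_div_pos (n := 2 * n) (by omega)
  push_cast at this
  exact this

/-- The classification of solvable and of distinguished points for dihedral root systems. The point
`γ_k` is characterized by the values of the roots `β_(k-1)` and `β_(n-k)` at it, which are the
corresponding parameters. -/
theorem isSolvable_dihedral [Finite ι] [P.IsRootSystem] [P.IsReduced] {Δ : Set ι}
    (hΔ : IsSimpleSystem P Δ) (hc : IsInvariant P c) (hc0 : ∃ i, c i ≠ 0) (hn : 3 ≤ n)
    {a : Fin 2 → ι} (ha : HasDiagram P Δ !![1, n; n, 1] a) (hB : IsNormalizedInner P B) :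
    ∃ (β : ℕ → ι) (e : ℕ → Module.Basis (Fin 2) ℝ N) (γ : ℕ → N),
      IsDihedralRoots P Δ n a β ∧
      (∀ k, 1 ≤ k → k ≤ n / 2 →
        IsDualPair P B (β (k - 1)) (β (n - k)) (e k) ∧
        γ k = c (β (k - 1)) • e k 0 + c (β (n - k)) • e k 1) ∧
      (Odd n →
        γ ((n + 1) / 2) =
          (c (β ((n - 1) / 2)) / 2) • P.coroot (β ((n - 1) / 2)) ∧
        (∀ x : ℂ ⊗[ℝ] N, IsSolvable P Δ c x ↔
          ∃ k, 1 ≤ k ∧ k ≤ (n + 1) / 2 ∧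
            IsConjugate P x ((1 : ℂ) ⊗ₜ[ℝ] γ k)) ∧
        (∀ k, 1 ≤ k → k ≤ (n + 1) / 2 →
          (∀ i, γ k =
            (c i / (4 * Real.sin ((2 * k - 1) / (2 * n) * Real.pi) *
              Real.sin (Real.pi / (2 * n)))) • (P.coroot (a 0) + P.coroot (a 1))) ∧
          (IsDistinguished P Δ c ((1 : ℂ) ⊗ₜ[ℝ] γ k) ↔
            k ≠ (n + 1) / 2))) ∧
      (Even n →
        (∀ x : ℂ ⊗[ℝ] N, IsSolvable P Δ c x ↔
          ∃ k, 1 ≤ k ∧ k ≤ n / 2 ∧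
            IsConjugate P x ((1 : ℂ) ⊗ₜ[ℝ] γ k)) ∧
        (∀ k, 1 ≤ k → k ≤ n / 2 →
          (IsDistinguished P Δ c ((1 : ℂ) ⊗ₜ[ℝ] γ k) ↔
            (c (β (k - 1)) + c (β (n - k)) * Real.cos ((2 * k - 1) * Real.pi / n)) *
              (c (β (k - 1)) * Real.cos ((2 * k - 1) * Real.pi / n) + c (β (n - k)))
                ≠ 0))) := by
  obtain ⟨b, hb, h₀, h₁⟩ := exists_isDihedralList hΔ hn ha hB
  have hΔb : Δ = {b 0, b (n - 1)} := by
    rw [← ha.range_eq, h₀, h₁]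
    ext i
    simp [Fin.exists_fin_two, eq_comm]
  have hΔ2 : Δ.ncard = 2 := by
    rw [hΔb, h₀, h₁, Set.ncard_pair]
    exact ha.injective.ne (by decide)
  have hN : Module.finrank ℝ N = 2 := by
    rw [Module.finrank_eq_nat_card_basis hΔ.corootBasis, Nat.card_coe_set_eq, hΔ2]
  have hndvd : ∀ k : ℕ, 1 ≤ k → k ≤ n / 2 → ¬ (n : ℤ) ∣ (k - 1 : ℕ) - (n - k : ℕ) := by
    intro k hk hk' h
    have := Int.le_of_dvd (by omega) ((dvd_neg).2 h)
    omega
  have hdual : ∀ k : ℕ, ∃ e : Module.Basis (Fin 2) ℝ N, 1 ≤ k → k ≤ n / 2 →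
      IsDualPair P B (b (k - 1 : ℕ)) (b (n - k : ℕ)) e := by
    intro k
    by_cases hk : 1 ≤ k ∧ k ≤ n / 2
    · obtain ⟨e, he⟩ := hb.exists_isDualPair hB hN (hndvd k hk.1 hk.2)
      exact ⟨e, fun _ _ => he⟩
    · obtain ⟨e, -⟩ := hb.exists_isDualPair hB hN (hndvd 1 le_rfl (by omega))
      exact ⟨e, fun h h' => absurd ⟨h, h'⟩ hk⟩
  choose e he using hdual
  let γ : ℕ → N := fun k => if k ≤ n / 2 then
    c (b (k - 1 : ℕ)) • e k 0 + c (b (n - k : ℕ)) • e k 1 else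
    (c (b ((n - 1) / 2 : ℕ)) / 2) • P.coroot (b ((n - 1) / 2 : ℕ))
  have hγ : ∀ k, k ≤ n / 2 →
      γ k = c (b (k - 1 : ℕ)) • e k 0 + c (b (n - k : ℕ)) • e k 1 := fun k hk => if_pos hk
  have hBγ : ∀ k, 1 ≤ k → k ≤ n / 2 → B (γ k) (P.coroot (b (k - 1 : ℕ))) = c (b (k - 1 : ℕ)) ∧
      B (γ k) (P.coroot (b (n - k : ℕ))) = c (b (n - k : ℕ)) := by
    intro k hk hk'
    obtain ⟨h₀₀, h₀₁, h₁₀, h₁₁⟩ := he k hk hk'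
    rw [hγ k hk']
    constructor <;> simp [h₀₀, h₀₁, h₁₀, h₁₁]
  have hcast₀ : ∀ k : ℕ, 1 ≤ k → ((k - 1 : ℕ) : ℤ) = k - 1 := fun k hk => by omega
  have hcast₁ : ∀ k : ℕ, k ≤ n / 2 → ((n - k : ℕ) : ℤ) = n - k := fun k hk => by omega
  have heval : ∀ k : ℕ, 1 ≤ k → k ≤ n / 2 →
      eval P (b (k - 1)) ((1 : ℂ) ⊗ₜ[ℝ] γ k) = c (b (k - 1)) ∧
      eval P (b (n - k)) ((1 : ℂ) ⊗ₜ[ℝ] γ k) = c (b (n - k)) := by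
    intro k hk hk'
    obtain ⟨h, h'⟩ := hBγ k hk hk'
    rw [hcast₀ k hk] at h
    rw [hcast₁ k hk'] at h'
    rw [eval_tmul, eval_tmul, hB.root'_eq, hB.root'_eq, h, h', mul_one, mul_one]
    exact ⟨rfl, rfl⟩
  have huniq : ∀ (k : ℕ) (y : ℂ ⊗[ℝ] N), 1 ≤ k → k ≤ n / 2 →
      eval P (b (k - 1)) y = c (b (k - 1)) → eval P (b (n - k)) y = c (b (n - k)) →
      y = (1 : ℂ) ⊗ₜ[ℝ] γ k := by
    intro k y hk hk' h h'
    have hd := hndvd k hk hk'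
    rw [hcast₀ k hk, hcast₁ k hk'] at hd
    exact hb.eq_of_eval_eq hd (by rw [h, (heval k hk hk').1]) (by rw [h', (heval k hk hk').2])
  refine ⟨fun m => b m, e, γ, hb.isDihedralRoots ha.range_eq h₀ h₁,
    fun k hk hk' => ⟨he k hk hk', hγ k hk'⟩, fun hodd => ?_, fun heven => ?_⟩
  · have hconst := hb.param_const hodd hc
    obtain ⟨r, hr⟩ := id hodd
    have hlast : γ ((n + 1) / 2) =
        (c (b ((n - 1) / 2 : ℕ)) / 2) • P.coroot (b ((n - 1) / 2 : ℕ)) := if_neg (by omega)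
    refine ⟨hlast, fun x => ⟨fun hx => ?_, ?_⟩, fun k hk hk' => ⟨fun i => ?_, ?_⟩⟩
    · rcases hb.exists_conj_of_isSolvable_of_odd hodd hΔb hΔ2 hc hc0 hx ((n - 1) / 2 : ℕ) with
        ⟨k, hk, hk', y, hxy, hy, hy'⟩ | h
      · refine ⟨k, hk, by omega, ?_⟩
        rwa [← huniq k y hk hk' hy hy']
      · exact ⟨(n + 1) / 2, by omega, le_rfl, by rwa [hlast]⟩
    · rintro ⟨k, hk, hk', hx⟩
      refine IsSolvable.conj hc hx ?_
      by_cases hkn : k ≤ n / 2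
      · obtain ⟨h, h'⟩ := heval k hk hkn
        exact (hb.isDistinguished_of_odd hodd hΔ2 hc hc0 hk hkn h h').isSolvable hΔ
      · rw [show k = (n + 1) / 2 by omega, hlast]
        exact hb.isSolvable_coroot_of_odd hodd (by simp [hΔb]) hc hc0 _
    · have hs := sin_pi_div_two_mul_pos hn
      have hs' : 0 < Real.sin ((2 * k - 1) / (2 * n) * Real.pi) := by
        have hk1 : (1 : ℝ) ≤ k := by exact_mod_cast hk
        have hk2 : (2 * k - 1 : ℝ) ≤ n := by
          have : 2 * k ≤ n + 1 := by omega
          have : (2 * k : ℝ) ≤ n + 1 := by exact_mod_cast this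
          linarith
        have hn0 : (0 : ℝ) < n := by positivity
        refine Real.sin_pos_of_pos_of_lt_pi
          (mul_pos (div_pos (by linarith) (by linarith)) Real.pi_pos) ?_
        have : (2 * k - 1 : ℝ) / (2 * n) < 1 := by
          rw [div_lt_one (by linarith)]
          linarith
        nlinarith [Real.pi_pos]
      rw [← h₀, ← h₁]
      by_cases hkn : k ≤ n / 2
      · -- both sides take the same values at the two roots
        have hval := two_mul_cos_add_two_mul_cos hn k
        have hsum : ∀ m : ℤ, B (P.coroot (b 0) + P.coroot (b (n - 1))) (P.coroot (b m)) =
            2 * Real.cos (m * (Real.pi / n)) + 2 * Real.cos ((m - (n - 1)) * (Real.pi / n)) := by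
          intro m
          rw [map_add, LinearMap.add_apply, ← hB.pairing_eq, ← hB.pairing_eq, hb.pairing_eq,
            hb.pairing_eq]
          push_cast
          rw [sub_zero]
        rw [(he k hk hkn).eq_smul_add_smul ((c i / _) • _), hγ k hkn, map_smul,
          LinearMap.smul_apply, LinearMap.smul_apply, hsum, hsum, hcast₀ k hk, hcast₁ k hkn,
          hconst _ i, hconst (b (n - k)) i]
        have e₁ : 2 * Real.cos (((k - 1 : ℤ) : ℝ) * (Real.pi / n)) +
            2 * Real.cos ((((k - 1 : ℤ) : ℝ) - (n - 1)) * (Real.pi / n)) =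
            4 * Real.sin ((2 * k - 1) / (2 * n) * Real.pi) * Real.sin (Real.pi / (2 * n)) := by
          rw [← hval, ← Real.cos_neg ((((k - 1 : ℤ) : ℝ) - (n - 1)) * (Real.pi / n))]
          push_cast
          ring_nf
        have e₂ : 2 * Real.cos (((n - k : ℤ) : ℝ) * (Real.pi / n)) +
            2 * Real.cos ((((n - k : ℤ) : ℝ) - (n - 1)) * (Real.pi / n)) =
            4 * Real.sin ((2 * k - 1) / (2 * n) * Real.pi) * Real.sin (Real.pi / (2 * n)) := by
          rw [← hval, ← Real.cos_neg ((((n - k : ℤ) : ℝ) - (n - 1)) * (Real.pi / n))]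
          push_cast
          ring_nf
        rw [e₁, e₂, smul_eq_mul, div_mul_cancel₀ _ (by positivity)]
      · have hk2 : k = (n + 1) / 2 := by omega
        have hkr : (k : ℝ) = r + 1 := by
          have : k = r + 1 := by omega
          exact_mod_cast this
        have hnr : (n : ℝ) = 2 * r + 1 := by exact_mod_cast hr
        have hn0 : (n : ℝ) ≠ 0 := by positivity
        have hone : Real.sin ((2 * k - 1) / (2 * n) * Real.pi) = 1 := by
          rw [show (2 * k - 1 : ℝ) = n by rw [hkr, hnr]; ring,
            show (n : ℝ) / (2 * n) * Real.pi = Real.pi / 2 by field_simp, Real.sin_pi_div_two]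
        have hmid : ((n - 1) / 2 : ℕ) = r := by omega
        have hsin : Real.sin (Real.pi / n) =
            2 * Real.sin (Real.pi / (2 * n)) * Real.cos (Real.pi / (2 * n)) := by
          rw [← Real.sin_two_mul]
          congr 1
          field_simp
        have hs0 := sin_pi_div_pos hn
        have hcos : Real.cos (Real.pi / (2 * n)) ≠ 0 := by
          intro h
          rw [hsin, h, mul_zero] at hs0
          exact lt_irrefl _ hs0
        have e₁ : Real.sin (((r : ℤ) + 1 : ℝ) * (Real.pi / n)) = Real.cos (Real.pi / (2 * n)) := by
          rw [← Real.sin_pi_div_two_sub, ← Real.sin_pi_sub]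
          congr 1
          push_cast
          field_simp
          rw [hnr]
          ring
        have e₂ : Real.sin (((r : ℤ) : ℝ) * (Real.pi / n)) = Real.cos (Real.pi / (2 * n)) := by
          rw [← Real.sin_pi_div_two_sub]
          congr 1
          push_cast
          field_simp
          rw [hnr]
          ring
        rw [hk2, hlast, ← hk2, hone, hmid, hconst _ i, hb.coroot_eq r, dihedralVec, e₁, e₂, hsin,
          ← smul_add, smul_smul]
        congr 1
        field_simp
        norm_num
    · by_cases hkn : k ≤ n / 2
      · obtain ⟨h, h'⟩ := heval k hk hkn
        have := hb.isDistinguished_of_odd hodd hΔ2 hc hc0 hk hkn h h'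
        exact ⟨fun _ => by omega, fun _ => this⟩
      · have hk2 : k = (n + 1) / 2 := by omega
        have hcount := hb.countEq_coroot_of_odd hodd hc hc0 ((n - 1) / 2 : ℕ)
        refine ⟨fun h => ?_, fun h => absurd hk2 h⟩
        rw [hk2, hlast, IsDistinguished, hΔ2, countEq_univ] at h
        rw [countEq_univ] at hcount
        omega
  · have hpar : ∀ k : ℕ, ¬ (2 : ℤ) ∣ (k - 1) - (n - k) := by
      intro k
      obtain ⟨r, hr⟩ := heven
      omega
    have hcos₁ : ∀ k : ℕ, Real.cos ((((n - k : ℤ) : ℝ) - (k - 1 : ℤ)) * (Real.pi / n)) =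
        -Real.cos ((2 * k - 1) * Real.pi / n) := by
      intro k
      rw [← Real.cos_pi_sub]
      congr 1
      push_cast
      linear_combination natCast_mul_pi_div hn
    have hcos₂ : ∀ k : ℕ, Real.cos ((((k - 1 : ℤ) : ℝ) - (n - k : ℤ)) * (Real.pi / n)) =
        -Real.cos ((2 * k - 1) * Real.pi / n) := by
      intro k
      rw [← hcos₁, ← Real.cos_neg]
      congr 1
      ring
    have hdist : ∀ k : ℕ, 1 ≤ k → k ≤ n / 2 → IsSolvable P Δ c ((1 : ℂ) ⊗ₜ[ℝ] γ k) ∧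
        (IsDistinguished P Δ c ((1 : ℂ) ⊗ₜ[ℝ] γ k) ↔
          c (b (n - k)) ≠ c (b (k - 1)) * -Real.cos ((2 * k - 1) * Real.pi / n) ∧
          c (b (k - 1)) ≠ c (b (n - k)) * -Real.cos ((2 * k - 1) * Real.pi / n)) := by
      intro k hk hk'
      obtain ⟨h, h'⟩ := heval k hk hk'
      rw [← hcos₁]
      by_cases hj : c (b (n - k)) =
          c (b (k - 1)) * Real.cos ((((n - k : ℤ) : ℝ) - (k - 1 : ℤ)) * (Real.pi / n))
      · obtain ⟨hs, hd⟩ := hb.solvable_and_not_distinguished heven hΔb hΔ2 hc hc0 (hpar k) hj h h'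
        exact ⟨hs, fun hd' => absurd hd' hd, fun hne => absurd hj hne.1⟩
      by_cases hi : c (b (k - 1)) =
          c (b (n - k)) * Real.cos ((((n - k : ℤ) : ℝ) - (k - 1 : ℤ)) * (Real.pi / n))
      · have hi' := hi
        rw [hcos₁, ← hcos₂] at hi
        obtain ⟨hs, hd⟩ := hb.solvable_and_not_distinguished heven hΔb hΔ2 hc hc0
          (by have := hpar k; omega) hi h' h
        exact ⟨hs, fun hd' => absurd hd' hd, fun hne => absurd hi' hne.2⟩
      have hd := hb.isDistinguished_of_even heven hΔ2 hc hc0 (hpar k) h h' hj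
        (by rwa [hcos₂, ← hcos₁])
      exact ⟨hd.isSolvable hΔ, fun _ => ⟨hj, hi⟩, fun _ => hd⟩
    refine ⟨fun x => ⟨fun hx => ?_, ?_⟩, fun k hk hk' => ?_⟩
    · obtain ⟨k, hk, hk', y, hxy, hy, hy'⟩ :=
        hb.exists_conj_of_isSolvable_of_even heven hΔb hΔ2 hc hc0 hx
      refine ⟨k, hk, hk', ?_⟩
      rwa [← huniq k y hk hk' hy hy']
    · rintro ⟨k, hk, hk', hx⟩
      exact IsSolvable.conj hc hx (hdist k hk hk').1
    · rw [(hdist k hk hk').2, mul_ne_zero_iff, ← hcast₀ k hk, ← hcast₁ k hk']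
      constructor
      · rintro ⟨h, h'⟩
        exact ⟨fun h0 => h' (by linear_combination h0), fun h0 => h (by linear_combination h0)⟩
      · rintro ⟨h, h'⟩
        exact ⟨fun h0 => h' (by linear_combination h0), fun h0 => h (by linear_combination h0)⟩

end Dihedral

/-! ### The positive roots of the icosahedral root systems -/

/-- The ring `ℤ[φ]` of golden integers; the generator `ω` stands for the golden ratio `φ`, so that
`ω² = ω + 1`. Equality in it is decided by integer arithmetic. -/
abbrev GoldenInt := QuadraticAlgebra ℤ 1 1

/-- The simple reflection `s_j`, acting on coordinate vectors with respect to the simple roots, for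
the Cartan matrix `C`. -/
def simpleReflection {r : ℕ} (C : Matrix (Fin r) (Fin r) GoldenInt) (j : Fin r)
    (v : Fin r → GoldenInt) : Fin r → GoldenInt :=
  Function.update v j (v j - ∑ k, v k * C k j)

/-- Every vector of the list is a unit vector or is obtained by a simple reflection from a vector
that comes later in the list. -/
def IsGenerated {r : ℕ} (C : Matrix (Fin r) (Fin r) GoldenInt) :
    List (Fin r → GoldenInt) → Prop
  | [] => True
  | v :: l => ((∃ k, v = Pi.single k 1) ∨ ∃ w ∈ l, ∃ j, simpleReflection C j w = v) ∧
      IsGenerated C l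

instance {r : ℕ} (C : Matrix (Fin r) (Fin r) GoldenInt) :
    (l : List (Fin r → GoldenInt)) → Decidable (IsGenerated C l)
  | [] => .isTrue trivial
  | _ :: l =>
    have : Decidable (IsGenerated C l) := instDecidableIsGenerated C l
    inferInstanceAs (Decidable (_ ∧ _))

/-- `R` lists, in coordinates with respect to the simple roots, the positive roots of the root
system with Cartan matrix `C`. -/
structure IsPositiveRootList {r : ℕ} (C : Matrix (Fin r) (Fin r) GoldenInt)
    (R : List (Fin r → GoldenInt)) : Prop where
  nodup : R.Nodup
  nonneg : ∀ v ∈ R, ∀ k, 0 ≤ (v k).re ∧ 0 ≤ (v k).im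
  single_mem : ∀ k, Pi.single k 1 ∈ R
  reflection_mem : ∀ v ∈ R, ∀ j, simpleReflection C j v ∈ R ∨ -simpleReflection C j v ∈ R
  isGenerated : IsGenerated C R

/-- The Cartan matrix of type `H₃`. -/
def cartanH₃ : Matrix (Fin 3) (Fin 3) GoldenInt :=
  !![2, -1, 0; -1, 2, ⟨0, -1⟩; 0, ⟨0, -1⟩, 2]

/-- The Cartan matrix of type `H₄`. -/
def cartanH₄ : Matrix (Fin 4) (Fin 4) GoldenInt :=
  !![2, -1, 0, 0; -1, 2, -1, 0; 0, -1, 2, ⟨0, -1⟩; 0, 0, ⟨0, -1⟩, 2]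

/-- The positive roots of type `H₃`, by decreasing height. -/
def positiveRootsH₃ : List (Fin 3 → GoldenInt) :=
    [![⟨0, 1⟩, ⟨0, 2⟩, ⟨1, 1⟩], ![⟨0, 1⟩, ⟨1, 1⟩, ⟨1, 1⟩], ![⟨1, 0⟩, ⟨1, 1⟩, ⟨1, 1⟩],
    ![⟨0, 1⟩, ⟨1, 1⟩, ⟨0, 1⟩], ![⟨1, 0⟩, ⟨1, 1⟩, ⟨0, 1⟩], ![⟨0, 1⟩, ⟨0, 1⟩, ⟨0, 1⟩],
    ![⟨0, 1⟩, ⟨0, 1⟩, ⟨1, 0⟩], ![⟨1, 0⟩, ⟨1, 0⟩, ⟨0, 1⟩], ![⟨0, 0⟩, ⟨0, 1⟩, ⟨0, 1⟩],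
    ![⟨0, 0⟩, ⟨1, 0⟩, ⟨0, 1⟩], ![⟨0, 0⟩, ⟨0, 1⟩, ⟨1, 0⟩], ![⟨1, 0⟩, ⟨1, 0⟩, ⟨0, 0⟩],
    ![⟨1, 0⟩, ⟨0, 0⟩, ⟨0, 0⟩], ![⟨0, 0⟩, ⟨1, 0⟩, ⟨0, 0⟩], ![⟨0, 0⟩, ⟨0, 0⟩, ⟨1, 0⟩]]

/-- The positive roots of type `H₄`, by decreasing height. -/
def positiveRootsH₄ : List (Fin 4 → GoldenInt) :=
    [![⟨0, 2⟩, ⟨1, 3⟩, ⟨2, 4⟩, ⟨2, 3⟩], ![⟨1, 1⟩, ⟨1, 3⟩, ⟨2, 4⟩, ⟨2, 3⟩],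
    ![⟨1, 1⟩, ⟨2, 2⟩, ⟨2, 4⟩, ⟨2, 3⟩], ![⟨1, 1⟩, ⟨2, 2⟩, ⟨3, 3⟩, ⟨2, 3⟩],
    ![⟨1, 1⟩, ⟨2, 2⟩, ⟨3, 3⟩, ⟨1, 3⟩], ![⟨1, 1⟩, ⟨2, 2⟩, ⟨2, 3⟩, ⟨1, 3⟩],
    ![⟨1, 1⟩, ⟨2, 2⟩, ⟨2, 3⟩, ⟨2, 2⟩], ![⟨1, 1⟩, ⟨1, 2⟩, ⟨2, 3⟩, ⟨1, 3⟩],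
    ![⟨1, 1⟩, ⟨1, 2⟩, ⟨2, 3⟩, ⟨2, 2⟩], ![⟨0, 1⟩, ⟨1, 2⟩, ⟨2, 3⟩, ⟨1, 3⟩],
    ![⟨1, 1⟩, ⟨1, 2⟩, ⟨1, 3⟩, ⟨2, 2⟩], ![⟨0, 1⟩, ⟨1, 2⟩, ⟨2, 3⟩, ⟨2, 2⟩],
    ![⟨1, 1⟩, ⟨1, 2⟩, ⟨1, 3⟩, ⟨1, 2⟩], ![⟨0, 1⟩, ⟨1, 2⟩, ⟨1, 3⟩, ⟨2, 2⟩],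
    ![⟨1, 1⟩, ⟨1, 2⟩, ⟨2, 2⟩, ⟨1, 2⟩], ![⟨0, 1⟩, ⟨0, 2⟩, ⟨1, 3⟩, ⟨2, 2⟩],
    ![⟨0, 1⟩, ⟨1, 2⟩, ⟨1, 3⟩, ⟨1, 2⟩], ![⟨1, 1⟩, ⟨2, 1⟩, ⟨2, 2⟩, ⟨1, 2⟩],
    ![⟨0, 1⟩, ⟨1, 2⟩, ⟨2, 2⟩, ⟨1, 2⟩], ![⟨0, 1⟩, ⟨0, 2⟩, ⟨1, 3⟩, ⟨1, 2⟩],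
    ![⟨1, 0⟩, ⟨2, 1⟩, ⟨2, 2⟩, ⟨1, 2⟩], ![⟨0, 1⟩, ⟨1, 1⟩, ⟨2, 2⟩, ⟨1, 2⟩],
    ![⟨0, 1⟩, ⟨0, 2⟩, ⟨1, 2⟩, ⟨1, 2⟩], ![⟨1, 0⟩, ⟨1, 1⟩, ⟨2, 2⟩, ⟨1, 2⟩],
    ![⟨0, 1⟩, ⟨1, 1⟩, ⟨1, 2⟩, ⟨1, 2⟩], ![⟨1, 0⟩, ⟨1, 1⟩, ⟨1, 2⟩, ⟨1, 2⟩],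
    ![⟨0, 1⟩, ⟨0, 2⟩, ⟨1, 2⟩, ⟨1, 1⟩], ![⟨0, 1⟩, ⟨1, 1⟩, ⟨1, 2⟩, ⟨1, 1⟩],
    ![⟨0, 1⟩, ⟨0, 2⟩, ⟨0, 2⟩, ⟨1, 1⟩], ![⟨1, 0⟩, ⟨1, 1⟩, ⟨1, 2⟩, ⟨1, 1⟩],
    ![⟨0, 1⟩, ⟨1, 1⟩, ⟨1, 1⟩, ⟨1, 1⟩], ![⟨0, 1⟩, ⟨0, 1⟩, ⟨0, 2⟩, ⟨1, 1⟩],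
    ![⟨1, 0⟩, ⟨1, 1⟩, ⟨1, 1⟩, ⟨1, 1⟩], ![⟨0, 1⟩, ⟨1, 1⟩, ⟨1, 1⟩, ⟨0, 1⟩],
    ![⟨0, 1⟩, ⟨0, 1⟩, ⟨1, 1⟩, ⟨1, 1⟩], ![⟨1, 0⟩, ⟨1, 1⟩, ⟨1, 1⟩, ⟨0, 1⟩],
    ![⟨0, 0⟩, ⟨0, 1⟩, ⟨0, 2⟩, ⟨1, 1⟩], ![⟨0, 1⟩, ⟨0, 1⟩, ⟨1, 1⟩, ⟨0, 1⟩],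
    ![⟨1, 0⟩, ⟨1, 0⟩, ⟨1, 1⟩, ⟨1, 1⟩], ![⟨0, 0⟩, ⟨0, 1⟩, ⟨1, 1⟩, ⟨1, 1⟩],
    ![⟨0, 1⟩, ⟨0, 1⟩, ⟨0, 1⟩, ⟨0, 1⟩], ![⟨1, 0⟩, ⟨1, 0⟩, ⟨1, 1⟩, ⟨0, 1⟩],
    ![⟨0, 0⟩, ⟨1, 0⟩, ⟨1, 1⟩, ⟨1, 1⟩], ![⟨0, 1⟩, ⟨0, 1⟩, ⟨0, 1⟩, ⟨1, 0⟩],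
    ![⟨0, 0⟩, ⟨0, 1⟩, ⟨1, 1⟩, ⟨0, 1⟩], ![⟨0, 0⟩, ⟨1, 0⟩, ⟨1, 1⟩, ⟨0, 1⟩],
    ![⟨0, 0⟩, ⟨0, 1⟩, ⟨0, 1⟩, ⟨0, 1⟩], ![⟨1, 0⟩, ⟨1, 0⟩, ⟨1, 0⟩, ⟨0, 1⟩],
    ![⟨0, 0⟩, ⟨0, 1⟩, ⟨0, 1⟩, ⟨1, 0⟩], ![⟨0, 0⟩, ⟨1, 0⟩, ⟨1, 0⟩, ⟨0, 1⟩],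
    ![⟨0, 0⟩, ⟨0, 0⟩, ⟨0, 1⟩, ⟨0, 1⟩], ![⟨1, 0⟩, ⟨1, 0⟩, ⟨1, 0⟩, ⟨0, 0⟩],
    ![⟨0, 0⟩, ⟨0, 0⟩, ⟨1, 0⟩, ⟨0, 1⟩], ![⟨0, 0⟩, ⟨0, 0⟩, ⟨0, 1⟩, ⟨1, 0⟩],
    ![⟨1, 0⟩, ⟨1, 0⟩, ⟨0, 0⟩, ⟨0, 0⟩], ![⟨0, 0⟩, ⟨1, 0⟩, ⟨1, 0⟩, ⟨0, 0⟩],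
    ![⟨1, 0⟩, ⟨0, 0⟩, ⟨0, 0⟩, ⟨0, 0⟩], ![⟨0, 0⟩, ⟨1, 0⟩, ⟨0, 0⟩, ⟨0, 0⟩],
    ![⟨0, 0⟩, ⟨0, 0⟩, ⟨1, 0⟩, ⟨0, 0⟩], ![⟨0, 0⟩, ⟨0, 0⟩, ⟨0, 0⟩, ⟨1, 0⟩]]

set_option maxRecDepth 100000 in
lemma isPositiveRootList_H₃ : IsPositiveRootList cartanH₃ positiveRootsH₃ where
  nodup := by decide +kernel
  nonneg := by decide +kernel
  single_mem := by decide +kernel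
  reflection_mem := by decide +kernel
  isGenerated := by decide +kernel

set_option maxRecDepth 100000 in
lemma isPositiveRootList_H₄ : IsPositiveRootList cartanH₄ positiveRootsH₄ where
  nodup := by decide +kernel
  nonneg := by decide +kernel
  single_mem := by decide +kernel
  reflection_mem := by decide +kernel
  isGenerated := by decide +kernel

/-! ### The finite check for proper sets of simple roots -/

/-- A triple of golden integers, used both for the vector of values of a root on three simple
coroots and for the unknown coordinates of a point with respect to these coroots. -/
abbrev GoldenTriple := GoldenInt × GoldenInt × GoldenInt

/-- The standard bilinear form on triples, `u.1 * v.1 + u.2.1 * v.2.1 + u.2.2 * v.2.2`, written out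
in terms of integers because the kernel evaluates this formula faster. -/
def tripleDot (u v : GoldenTriple) : GoldenInt :=
  ⟨u.1.re * v.1.re + u.1.im * v.1.im + (u.2.1.re * v.2.1.re + u.2.1.im * v.2.1.im) +
      (u.2.2.re * v.2.2.re + u.2.2.im * v.2.2.im),
    u.1.re * v.1.im + u.1.im * (v.1.re + v.1.im) +
      (u.2.1.re * v.2.1.im + u.2.1.im * (v.2.1.re + v.2.1.im)) +
      (u.2.2.re * v.2.2.im + u.2.2.im * (v.2.2.re + v.2.2.im))⟩

lemma tripleDot_eq (u v : GoldenTriple) :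
    tripleDot u v = u.1 * v.1 + u.2.1 * v.2.1 + u.2.2 * v.2.2 := by
  ext
  · simp [tripleDot]
  · simp [tripleDot]
    ring

/-- The cross product of triples. -/
def tripleCross (u v : GoldenTriple) : GoldenTriple :=
  (u.2.1 * v.2.2 - u.2.2 * v.2.1, u.2.2 * v.1 - u.1 * v.2.2, u.1 * v.2.1 - u.2.1 * v.1)

/-- The values on the simple coroots with indices `t 0`, `t 1`, `t 2` of the root with coordinate
vector `v`. -/
def corootValues {r : ℕ} (C : Matrix (Fin r) (Fin r) GoldenInt) (t : Fin 3 → Fin r)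
    (v : Fin r → GoldenInt) : GoldenTriple :=
  (∑ k, v k * C k (t 0), ∑ k, v k * C k (t 1), ∑ k, v k * C k (t 2))

/-- The numerators in Cramer's rule for the equations `p z = q z = s z = 1` (if `d = 3`); for
smaller `d` the right-hand sides of the last `3 - d` equations are `0`. -/
def cramerTriple (d : ℕ) (p q s : GoldenTriple) : GoldenTriple :=
  if d = 1 then tripleCross q s
  else if d = 2 then tripleCross q s + tripleCross s p
  else tripleCross q s + tripleCross s p + tripleCross p q

/-- The counting equation over the positive roots `R` and their negatives, for the point with
coordinates `v / D`. -/
def TripleCountEq (R : List GoldenTriple) (d : ℕ) (D : GoldenInt) (v : GoldenTriple) : Prop :=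
  R.countP (fun u => tripleDot u v = D) + R.countP (fun u => tripleDot u v = -D) =
    2 * R.countP (fun u => tripleDot u v = 0) + d

instance (R : List GoldenTriple) (d : ℕ) (D : GoldenInt) (v : GoldenTriple) :
    Decidable (TripleCountEq R d D v) := inferInstanceAs (Decidable (_ = _))

/-- The solution of the linear equations with coefficients `p`, `q`, `s` does not satisfy the
counting equations both for the subsystem `R'` and for the whole system `R`. If the determinant
vanishes, the equations are inconsistent. -/
def Excluded (R R' : List GoldenTriple) (d : ℕ) (p q s : GoldenTriple) : Prop :=
  if tripleDot p (tripleCross q s) = 0 then cramerTriple d p q s ≠ 0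
  else ¬ (TripleCountEq R' d (tripleDot p (tripleCross q s)) (cramerTriple d p q s) ∧
    TripleCountEq R d (tripleDot p (tripleCross q s)) (cramerTriple d p q s))

instance (R R' : List GoldenTriple) (d : ℕ) (p q s : GoldenTriple) :
    Decidable (Excluded R R' d p q s) := inferInstanceAs (Decidable (ite _ _ _))

/-- Unit vectors, completing `d` equations in the first `d` of three unknowns. -/
def paddingTriples (d : ℕ) : List GoldenTriple :=
  if d = 1 then [(0, 1, 0), (0, 0, 1)] else if d = 2 then [(0, 0, 1)] else []

/-- No choice of `d` of the positive roots of the subsystem `R'` yields a point that satisfies both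
counting equations. -/
def AllExcluded (R R' : List GoldenTriple) (d : ℕ) : Prop :=
  ∀ E ∈ R'.sublistsLen d, match E ++ paddingTriples d with
    | [p, q, s] => Excluded R R' d p q s
    | _ => False

instance (R R' : List GoldenTriple) (d : ℕ) : Decidable (AllExcluded R R' d) :=
  have : ∀ E : List GoldenTriple, Decidable (match E ++ paddingTriples d with
    | [p, q, s] => Excluded R R' d p q s
    | _ => False) := fun E => by split <;> infer_instance
  inferInstanceAs (Decidable (∀ E ∈ R'.sublistsLen d, _))

/-- The roots in `R` whose coordinates vanish outside `t 0, …, t (d - 1)`. -/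
def parabolicList {r : ℕ} (R : List (Fin r → GoldenInt)) (t : Fin 3 → Fin r) (d : ℕ) :
    List (Fin r → GoldenInt) :=
  R.filter fun v => ∀ k, (∃ i : Fin 3, (i : ℕ) < d ∧ t i = k) ∨ v k = 0

/-- The check for the set `{t 0, …, t (d - 1)}` of simple roots. -/
def ParabolicExcluded {r : ℕ} (C : Matrix (Fin r) (Fin r) GoldenInt)
    (R : List (Fin r → GoldenInt)) (t : Fin 3 → Fin r) (d : ℕ) : Prop :=
  AllExcluded (R.map (corootValues C t)) ((parabolicList R t d).map (corootValues C t)) d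

instance {r : ℕ} (C : Matrix (Fin r) (Fin r) GoldenInt) (R : List (Fin r → GoldenInt))
    (t : Fin 3 → Fin r) (d : ℕ) : Decidable (ParabolicExcluded C R t d) :=
  inferInstanceAs (Decidable (AllExcluded _ _ _))

/-- The nonempty proper subsets of the simple roots of `H₃`; the pair `(t, d)` stands for the set
`{t 0, …, t (d - 1)}`. -/
def properSubsetsH₃ : List ((Fin 3 → Fin 3) × ℕ) :=
  [(![0, 1, 2], 1), (![1, 0, 2], 1), (![2, 0, 1], 1),
    (![0, 1, 2], 2), (![0, 2, 1], 2), (![1, 2, 0], 2)]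

/-- The nonempty proper subsets of the simple roots of `H₄`; the pair `(t, d)` stands for the set
`{t 0, …, t (d - 1)}`. -/
def properSubsetsH₄ : List ((Fin 3 → Fin 4) × ℕ) :=
  [(![0, 1, 2], 1), (![1, 0, 2], 1), (![2, 0, 1], 1), (![3, 0, 1], 1),
    (![0, 1, 2], 2), (![0, 2, 1], 2), (![0, 3, 1], 2), (![1, 2, 0], 2), (![1, 3, 0], 2),
    (![2, 3, 0], 2), (![0, 1, 2], 3), (![0, 1, 3], 3), (![0, 2, 3], 3), (![1, 2, 3], 3)]

set_option maxRecDepth 100000 in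
lemma parabolicExcluded_H₃ :
    ∀ S ∈ properSubsetsH₃, ParabolicExcluded cartanH₃ positiveRootsH₃ S.1 S.2 := by
  decide +kernel

set_option maxRecDepth 100000 in
lemma parabolicExcluded_H₄ :
    ∀ S ∈ properSubsetsH₄, ParabolicExcluded cartanH₄ positiveRootsH₄ S.1 S.2 := by
  decide +kernel

lemma mem_properSubsetsH₃ : ∀ S : Finset (Fin 3), S.Nonempty → S ≠ Finset.univ →
    ∃ p ∈ properSubsetsH₃, (1 ≤ p.2 ∧ p.2 ≤ 3) ∧ S.card = p.2 ∧
      ∀ k, k ∈ S ↔ ∃ i : Fin 3, (i : ℕ) < p.2 ∧ p.1 i = k := by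
  decide +kernel

lemma mem_properSubsetsH₄ : ∀ S : Finset (Fin 4), S.Nonempty → S ≠ Finset.univ →
    ∃ p ∈ properSubsetsH₄, (1 ≤ p.2 ∧ p.2 ≤ 3) ∧ S.card = p.2 ∧
      ∀ k, k ∈ S ↔ ∃ i : Fin 3, (i : ℕ) < p.2 ∧ p.1 i = k := by
  decide +kernel

/-! ### Golden integers as real numbers -/

/-- The embedding of the golden integers into the real numbers. -/
noncomputable def goldenHom : GoldenInt →+* ℝ :=
  (QuadraticAlgebra.lift (R := ℤ) (a := 1) (b := 1)
    ⟨Real.goldenRatio, by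
      have := Real.goldenRatio_sq
      simp only [one_smul]
      linarith⟩ : GoldenInt →ₐ[ℤ] ℝ)

lemma goldenHom_apply (x : GoldenInt) : goldenHom x = x.re + x.im * Real.goldenRatio := by
  simp [goldenHom, QuadraticAlgebra.lift]

lemma goldenHom_injective : Function.Injective goldenHom := by
  rw [injective_iff_map_eq_zero]
  intro x hx
  rw [goldenHom_apply] at hx
  have him : x.im = 0 := by
    by_contra h
    exact ((Real.goldenRatio_irrational.intCast_mul h).intCast_add x.re).ne_zero hx
  ext
  · simpa [him] using hx
  · exact him

lemma goldenHom_nonneg {x : GoldenInt} (h : 0 ≤ x.re ∧ 0 ≤ x.im) : 0 ≤ goldenHom x := by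
  rw [goldenHom_apply]
  have h₁ : (0 : ℝ) ≤ x.re := by exact_mod_cast h.1
  have h₂ : (0 : ℝ) ≤ x.im := by exact_mod_cast h.2
  have := Real.goldenRatio_pos
  positivity

/-! ### Soundness of the finite check -/

/-- The linear form with golden coefficients `u` at the point `z`. -/
noncomputable def tripleValue (z : Fin 3 → ℂ) (u : GoldenTriple) : ℂ :=
  goldenHom u.1 * z 0 + goldenHom u.2.1 * z 1 + goldenHom u.2.2 * z 2

/-- The golden integers inside the complex numbers. -/
noncomputable def goldenComplex : GoldenInt →+* ℂ := Complex.ofRealHom.comp goldenHom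

lemma goldenComplex_apply (x : GoldenInt) : goldenComplex x = goldenHom x := rfl

lemma goldenComplex_injective : Function.Injective goldenComplex :=
  Complex.ofReal_injective.comp goldenHom_injective

/-- Cramer's rule. -/
lemma goldenComplex_mul_coord {z : Fin 3 → ℂ} {d : ℕ} (hd : 1 ≤ d ∧ d ≤ 3) {p q s : GoldenTriple}
    (hp : tripleValue z p = 1) (hq : tripleValue z q = if 2 ≤ d then 1 else 0)
    (hs : tripleValue z s = if 3 ≤ d then 1 else 0) :
    goldenComplex (tripleDot p (tripleCross q s)) * z 0 =
        goldenComplex (cramerTriple d p q s).1 ∧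
      goldenComplex (tripleDot p (tripleCross q s)) * z 1 =
        goldenComplex (cramerTriple d p q s).2.1 ∧
      goldenComplex (tripleDot p (tripleCross q s)) * z 2 =
        goldenComplex (cramerTriple d p q s).2.2 := by
  simp only [tripleValue, ← goldenComplex_apply] at hp hq hs
  obtain ⟨h₁, h₂⟩ := hd
  interval_cases d <;> norm_num at hq hs <;>
    simp only [cramerTriple, tripleDot_eq, tripleCross, map_add, map_mul, map_sub, Prod.fst_add,
      Prod.snd_add, if_true, if_false, OfNat.ofNat_ne_one, Nat.reduceEqDiff] <;>
    generalize goldenComplex p.1 = p0 at * <;> generalize goldenComplex p.2.1 = p1 at * <;>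
    generalize goldenComplex p.2.2 = p2 at * <;> generalize goldenComplex q.1 = q0 at * <;>
    generalize goldenComplex q.2.1 = q1 at * <;> generalize goldenComplex q.2.2 = q2 at * <;>
    generalize goldenComplex s.1 = s0 at * <;> generalize goldenComplex s.2.1 = s1 at * <;>
    generalize goldenComplex s.2.2 = s2 at * <;>
    refine ⟨?_, ?_, ?_⟩
  all_goals first
    | linear_combination (q1 * s2 - q2 * s1) * hp + (s1 * p2 - s2 * p1) * hq +
        (p1 * q2 - p2 * q1) * hs
    | linear_combination (q2 * s0 - q0 * s2) * hp + (s2 * p0 - s0 * p2) * hq +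
        (p2 * q0 - p0 * q2) * hs
    | linear_combination (q0 * s1 - q1 * s0) * hp + (s0 * p1 - s1 * p0) * hq +
        (p0 * q1 - p1 * q0) * hs

/-- The counting equation over the positive roots `R` and their negatives, for the point `z`. -/
def ValueCountEq (R : List GoldenTriple) (d : ℕ) (z : Fin 3 → ℂ) : Prop :=
  open Classical in
  R.countP (fun u => tripleValue z u = 1) + R.countP (fun u => tripleValue z u = -1) =
    2 * R.countP (fun u => tripleValue z u = 0) + d

lemma Excluded.not_valueCountEq {R R' : List GoldenTriple} {d : ℕ} {p q s : GoldenTriple}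
    (h : Excluded R R' d p q s) (hd : 1 ≤ d ∧ d ≤ 3) {z : Fin 3 → ℂ}
    (hp : tripleValue z p = 1) (hq : tripleValue z q = if 2 ≤ d then 1 else 0)
    (hs : tripleValue z s = if 3 ≤ d then 1 else 0) :
    ¬ (ValueCountEq R' d z ∧ ValueCountEq R d z) := by
  obtain ⟨h₀, h₁, h₂⟩ := goldenComplex_mul_coord hd hp hq hs
  unfold Excluded at h
  generalize tripleDot p (tripleCross q s) = D at *
  generalize cramerTriple d p q s = v at *
  split_ifs at h with hD
  · subst hD
    rw [map_zero, zero_mul, eq_comm, map_eq_zero_iff _ goldenComplex_injective] at h₀ h₁ h₂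
    exact absurd (Prod.ext h₀ (Prod.ext h₁ h₂)) h
  · have hD' : goldenComplex D ≠ 0 := by
      rwa [Ne, map_eq_zero_iff _ goldenComplex_injective]
    have key : ∀ u, goldenComplex D * tripleValue z u = goldenComplex (tripleDot u v) := by
      intro u
      rw [tripleDot_eq]
      simp only [tripleValue, ← goldenComplex_apply, map_add, map_mul]
      rw [← h₀, ← h₁, ← h₂]
      ring
    have k₁ : ∀ u, tripleValue z u = 1 ↔ tripleDot u v = D := fun u => by
      rw [← goldenComplex_injective.eq_iff, ← key, mul_eq_left₀ hD']
    have k₂ : ∀ u, tripleValue z u = -1 ↔ tripleDot u v = -D := fun u => by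
      rw [← goldenComplex_injective.eq_iff, ← key, map_neg, ← mul_neg_one (goldenComplex D),
        mul_right_inj' hD']
    have k₃ : ∀ u, tripleValue z u = 0 ↔ tripleDot u v = 0 := fun u => by
      rw [← goldenComplex_injective.eq_iff, ← key, map_zero, mul_eq_zero_iff_left hD']
    simpa only [ValueCountEq, TripleCountEq, k₁, k₂, k₃] using h

/-- If both counting equations hold at a point at which no listed root takes the value `-1`, then
`d` of the roots in `R'` take the value `1`, which gives a system of equations for the point. -/
lemma AllExcluded.not_valueCountEq {R R' : List GoldenTriple} {d : ℕ} (h : AllExcluded R R' d)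
    (hd : 1 ≤ d ∧ d ≤ 3) {z : Fin 3 → ℂ} (hz : ∀ i : Fin 3, d ≤ i → z i = 0)
    (hneg : ∀ u ∈ R', tripleValue z u ≠ -1) (h' : ValueCountEq R' d z) :
    ¬ ValueCountEq R d z := by
  classical
  intro hR
  have hlen : d ≤ (R'.filter fun u => tripleValue z u = 1).length := by
    have h0 : R'.countP (fun u => tripleValue z u = -1) = 0 := by
      rw [List.countP_eq_zero]
      simpa using hneg
    unfold ValueCountEq at h'
    rw [h0, List.countP_eq_length_filter] at h'
    omega
  set E := (R'.filter fun u => tripleValue z u = 1).take d with hEdef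
  have hElen : E.length = d := by simp [hEdef, hlen]
  have hE : E ∈ R'.sublistsLen d :=
    List.mem_sublistsLen.2 ⟨(List.take_sublist _ _).trans List.filter_sublist, hElen⟩
  have hval : ∀ u ∈ E, tripleValue z u = 1 := fun u hu => by
    simpa using (List.mem_filter.1 (List.mem_of_mem_take hu)).2
  have hmain := h E hE
  clear_value E
  obtain ⟨h₁, h₂⟩ := hd
  interval_cases d
  · obtain ⟨p, rfl⟩ := List.length_eq_one_iff.1 hElen
    refine Excluded.not_valueCountEq hmain (by norm_num) (hval p (by simp)) ?_ ?_ ⟨h', hR⟩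
    · simpa [tripleValue] using hz 1 (by simp)
    · simpa [tripleValue] using hz 2 (by simp)
  · obtain ⟨p, q, rfl⟩ := List.length_eq_two.1 hElen
    refine Excluded.not_valueCountEq hmain (by norm_num) (hval p (by simp)) ?_ ?_ ⟨h', hR⟩
    · simpa using hval q (by simp)
    · simpa [tripleValue] using hz 2 (by simp)
  · obtain ⟨p, q, s, rfl⟩ := List.length_eq_three.1 hElen
    refine Excluded.not_valueCountEq hmain (by norm_num) (hval p (by simp)) ?_ ?_ ⟨h', hR⟩
    · simpa using hval q (by simp)
    · simpa using hval s (by simp)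

section Golden

variable {ι M N : Type*} [AddCommGroup M] [Module ℝ M] [AddCommGroup N] [Module ℝ N]
  {P : RootPairing ι ℝ M N} {Δ : Set ι} {r : ℕ} {a : Fin r → ι}
  {C : Matrix (Fin r) (Fin r) GoldenInt} {R : List (Fin r → GoldenInt)}

/-! ### Root systems with golden Cartan matrix -/

variable (P a) in
/-- The element of the root space with golden coordinates `v` with respect to the simple roots. -/
noncomputable def rootVec (v : Fin r → GoldenInt) : M := ∑ k, goldenHom (v k) • P.root (a k)

lemma rootVec_single (k : Fin r) : rootVec P a (Pi.single k 1) = P.root (a k) := by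
  rw [rootVec, Finset.sum_eq_single k]
  · simp
  · intro l _ hl
    simp [Pi.single_eq_of_ne hl]
  · simp

lemma rootVec_neg (v : Fin r → GoldenInt) : rootVec P a (-v) = -rootVec P a v := by
  simp [rootVec]

lemma rootVec_simpleReflection (hC : ∀ i j, P.pairing (a i) (a j) = goldenHom (C i j))
    (j : Fin r) (v : Fin r → GoldenInt) :
    rootVec P a (simpleReflection C j v) = P.reflection (a j) (rootVec P a v) := by
  have h : ∀ k, goldenHom (simpleReflection C j v k) • P.root (a k) =
      goldenHom (v k) • P.root (a k) -
        if k = j then goldenHom (∑ k, v k * C k j) • P.root (a j) else 0 := by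
    intro k
    unfold simpleReflection
    split_ifs with hk
    · subst hk
      rw [Function.update_self, map_sub, sub_smul]
    · rw [Function.update_of_ne hk, sub_zero]
  rw [P.reflection_apply]
  simp only [rootVec, h, Finset.sum_sub_distrib, Finset.sum_ite_eq', Finset.mem_univ, if_true,
    map_sum, map_smul, map_mul, smul_eq_mul]
  congr 2
  refine Finset.sum_congr rfl fun k _ => ?_
  rw [← hC]
  rfl

/-- The coordinate vectors in a generated list are roots. -/
lemma IsGenerated.exists_root (hC : ∀ i j, P.pairing (a i) (a j) = goldenHom (C i j)) :
    ∀ l : List (Fin r → GoldenInt), IsGenerated C l → ∀ v ∈ l, ∃ i, P.root i = rootVec P a v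
  | [], _, v, hv => by simp at hv
  | w :: l, hl, v, hv => by
    rcases List.mem_cons.1 hv with rfl | hv
    · rcases hl.1 with ⟨k, rfl⟩ | ⟨w, hw, j, rfl⟩
      · exact ⟨a k, (rootVec_single k).symm⟩
      · obtain ⟨i, hi⟩ := IsGenerated.exists_root hC l hl.2 w hw
        exact ⟨P.reflectionPerm (a j) i, by
          rw [P.root_reflectionPerm, hi, rootVec_simpleReflection hC]⟩
    · exact IsGenerated.exists_root hC l hl.2 v hv

lemma IsPositiveRootList.exists_root (hR : IsPositiveRootList C R)
    (hC : ∀ i j, P.pairing (a i) (a j) = goldenHom (C i j)) {v : Fin r → GoldenInt}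
    (hv : v ∈ R) : ∃ i, P.root i = rootVec P a v :=
  IsGenerated.exists_root hC R hR.isGenerated v hv

lemma exists_coords_of_mem_corootSpan {t : Fin 3 → Fin r} {d : ℕ} {J : Set ι}
    (hJ : J ⊆ {i | ∃ k : Fin 3, (k : ℕ) < d ∧ a (t k) = i}) {y : ℂ ⊗[ℝ] N}
    (hy : y ∈ corootSpan P J) :
    ∃ z : Fin 3 → ℂ, (∀ k : Fin 3, d ≤ k → z k = 0) ∧
      y = ∑ k, z k • ((1 : ℂ) ⊗ₜ[ℝ] P.coroot (a (t k))) := by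
  induction hy using Submodule.span_induction with
  | mem y hy =>
    obtain ⟨i, hi, rfl⟩ := hy
    obtain ⟨k, hk, rfl⟩ := hJ hi
    refine ⟨Pi.single k 1, fun l hl => Pi.single_eq_of_ne (by rintro rfl; omega) _, ?_⟩
    rw [Finset.sum_eq_single k]
    · simp
    · intro l _ hl
      simp [Pi.single_eq_of_ne hl]
    · simp
  | zero => exact ⟨0, fun _ _ => rfl, by simp⟩
  | add x y _ _ hx hy =>
    obtain ⟨z, hz, rfl⟩ := hx
    obtain ⟨w, hw, rfl⟩ := hy
    refine ⟨z + w, fun k hk => by simp [hz k hk, hw k hk], ?_⟩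
    simp [add_smul, Finset.sum_add_distrib]
  | smul s x _ hx =>
    obtain ⟨z, hz, rfl⟩ := hx
    exact ⟨s • z, fun k hk => by simp [hz k hk], by simp [Finset.smul_sum, mul_smul]⟩

lemma evalLin_rootVec (hC : ∀ i j, P.pairing (a i) (a j) = goldenHom (C i j))
    (t : Fin 3 → Fin r) (z : Fin 3 → ℂ) (v : Fin r → GoldenInt) :
    evalLin P (rootVec P a v) (∑ k, z k • ((1 : ℂ) ⊗ₜ[ℝ] P.coroot (a (t k)))) =
      tripleValue z (corootValues C t v) := by
  have h : ∀ j, (P.toLinearMap (rootVec P a v) (P.coroot (a j)) : ℂ) =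
      (goldenHom (∑ k, v k * C k j) : ℝ) := by
    intro j
    congr 1
    simp only [rootVec, map_sum, LinearMap.sum_apply, map_smul, LinearMap.smul_apply, map_mul,
      smul_eq_mul]
    refine Finset.sum_congr rfl fun k _ => ?_
    rw [← hC, P.root_coroot_eq_pairing]
  simp only [Fin.sum_univ_three, map_add, map_smul, evalLin_tmul, mul_one, h, smul_eq_mul,
    tripleValue, corootValues]
  ring

variable [P.IsRootSystem]

/-- The simple roots as a basis indexed by `Fin r`. -/
noncomputable def IsSimpleSystem.finBasis (hΔ : IsSimpleSystem P Δ) (ha : Function.Injective a)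
    (haΔ : Set.range a = Δ) : Module.Basis (Fin r) ℝ M :=
  hΔ.rootBasis.reindex ((Equiv.ofInjective a ha).trans (Equiv.setCongr haΔ)).symm

lemma IsSimpleSystem.finBasis_apply (hΔ : IsSimpleSystem P Δ) (ha : Function.Injective a)
    (haΔ : Set.range a = Δ) (k : Fin r) : hΔ.finBasis ha haΔ k = P.root (a k) := by
  simp [IsSimpleSystem.finBasis]

lemma IsSimpleSystem.finBasis_repr (hΔ : IsSimpleSystem P Δ) (ha : Function.Injective a)
    (haΔ : Set.range a = Δ) (v : Fin r → GoldenInt) (k : Fin r) :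
    (hΔ.finBasis ha haΔ).repr (rootVec P a v) k = goldenHom (v k) := by
  have : rootVec P a v = ∑ k, goldenHom (v k) • hΔ.finBasis ha haΔ k := by
    simp only [rootVec, IsSimpleSystem.finBasis_apply]
  rw [this, Module.Basis.repr_sum_self]

lemma rootVec_injective (hΔ : IsSimpleSystem P Δ) (ha : Function.Injective a)
    (haΔ : Set.range a = Δ) : Function.Injective (rootVec P a) := by
  intro v w h
  funext k
  apply goldenHom_injective
  rw [← hΔ.finBasis_repr ha haΔ, h, hΔ.finBasis_repr ha haΔ]

lemma rootVec_mem_span_iff (hΔ : IsSimpleSystem P Δ) (ha : Function.Injective a)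
    (haΔ : Set.range a = Δ) (v : Fin r → GoldenInt) (S : Set (Fin r)) :
    rootVec P a v ∈ Submodule.span ℝ (P.root '' (a '' S)) ↔ ∀ k, k ∈ S ∨ v k = 0 := by
  have : P.root '' (a '' S) = hΔ.finBasis ha haΔ '' S := by
    rw [Set.image_image]
    exact Set.image_congr fun k _ => (hΔ.finBasis_apply ha haΔ k).symm
  rw [this, Module.Basis.mem_span_image]
  refine forall_congr' fun k => ?_
  rw [Finset.mem_coe, Finsupp.mem_support_iff, hΔ.finBasis_repr,
    Ne, map_eq_zero_iff _ goldenHom_injective]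
  tauto

variable [Finite ι] [P.IsReduced]

lemma IsPositiveRootList.root_eq (hR : IsPositiveRootList C R) (hΔ : IsSimpleSystem P Δ)
    (haΔ : Set.range a = Δ) (hC : ∀ i j, P.pairing (a i) (a j) = goldenHom (C i j)) (i : ι) :
    ∃ v ∈ R, P.root i = rootVec P a v ∨ P.root i = -rootVec P a v := by
  induction i using hΔ.root_induction with
  | simple j hj =>
    rw [← haΔ] at hj
    obtain ⟨k, rfl⟩ := hj
    exact ⟨_, hR.single_mem k, Or.inl (rootVec_single k).symm⟩
  | step i j hj h =>
    rw [← haΔ] at hj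
    obtain ⟨k, rfl⟩ := hj
    obtain ⟨v, hv, h⟩ := h
    rw [P.root_reflectionPerm]
    rcases hR.reflection_mem v hv k with hw | hw
    · refine ⟨_, hw, ?_⟩
      rw [rootVec_simpleReflection hC]
      rcases h with h | h
      · exact Or.inl (by rw [h])
      · exact Or.inr (by rw [h, map_neg])
    · refine ⟨_, hw, ?_⟩
      rw [rootVec_neg, rootVec_simpleReflection hC, neg_neg]
      rcases h with h | h
      · exact Or.inr (by rw [h])
      · exact Or.inl (by rw [h, map_neg])

open Classical in
/-- Counting roots by counting in the list of positive roots. -/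
lemma IsPositiveRootList.ncard_eq (hR : IsPositiveRootList C R) (hΔ : IsSimpleSystem P Δ)
    (ha : Function.Injective a) (haΔ : Set.range a = Δ)
    (hC : ∀ i j, P.pairing (a i) (a j) = goldenHom (C i j)) (q : M → Prop) :
    {i | q (P.root i)}.ncard = R.countP (fun v => q (rootVec P a v)) +
      R.countP (fun v => q (-rootVec P a v)) := by
  have hinj := rootVec_injective hΔ ha haΔ
  have hcount : ∀ p : (Fin r → GoldenInt) → Prop, {v | v ∈ R ∧ p v}.ncard = R.countP p := by
    intro p
    rw [List.countP_eq_length_filter, ← List.toFinset_card_of_nodup (hR.nodup.filter _),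
      ← Set.ncard_coe_finset]
    congr 1
    ext v
    simp
  have hset : P.root '' {i | q (P.root i)} =
      rootVec P a '' {v | v ∈ R ∧ q (rootVec P a v)} ∪
        (fun v => -rootVec P a v) '' {v | v ∈ R ∧ q (-rootVec P a v)} := by
    ext m
    constructor
    · rintro ⟨i, hi, rfl⟩
      obtain ⟨v, hv, h | h⟩ := hR.root_eq hΔ haΔ hC i
      · exact Or.inl ⟨v, ⟨hv, h ▸ hi⟩, h.symm⟩
      · exact Or.inr ⟨v, ⟨hv, h ▸ hi⟩, h.symm⟩
    · rintro (⟨v, ⟨hv, hq⟩, rfl⟩ | ⟨v, ⟨hv, hq⟩, rfl⟩)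
      · obtain ⟨i, hi⟩ := hR.exists_root hC hv
        exact ⟨i, by rwa [Set.mem_ofPred_eq, hi], hi⟩
      · obtain ⟨i, hi⟩ := hR.exists_root hC hv
        have hi' : P.root (P.reflectionPerm i i) = -rootVec P a v := by
          rw [P.root_reflectionPerm, P.reflection_apply_self, hi]
        exact ⟨P.reflectionPerm i i, by rwa [Set.mem_ofPred_eq, hi'], hi'⟩
  have hdisj : Disjoint (rootVec P a '' {v | v ∈ R ∧ q (rootVec P a v)})
      ((fun v => -rootVec P a v) '' {v | v ∈ R ∧ q (-rootVec P a v)}) := by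
    rw [Set.disjoint_left]
    rintro _ ⟨v, ⟨hv, -⟩, rfl⟩ ⟨w, ⟨hw, -⟩, h⟩
    change -rootVec P a w = rootVec P a v at h
    rw [← rootVec_neg] at h
    have h := hinj h
    -- the coordinates of `v` and of `w = -v` are nonnegative
    have hv0 : v = 0 := by
      funext k
      have h₁ := hR.nonneg v hv k
      have h₂ := hR.nonneg w hw k
      have h₃ : -w k = v k := congrFun h k
      have h₄ : -(w k).re = (v k).re := congrArg QuadraticAlgebra.re h₃
      have h₅ : -(w k).im = (v k).im := congrArg QuadraticAlgebra.im h₃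
      ext
      · simp; omega
      · simp; omega
    obtain ⟨i, hi⟩ := hR.exists_root hC hv
    refine P.ne_zero i ?_
    rw [hi, hv0]
    simp [rootVec]
  have hR' : {v | v ∈ R ∧ q (rootVec P a v)}.Finite :=
    R.toFinset.finite_toSet.subset fun v hv => by simpa using hv.1
  have hR'' : {v | v ∈ R ∧ q (-rootVec P a v)}.Finite :=
    R.toFinset.finite_toSet.subset fun v hv => by simpa using hv.1
  rw [← Set.ncard_image_of_injective _ P.root.injective, hset,
    Set.ncard_union_eq hdisj (hR'.image _) (hR''.image _), Set.ncard_image_of_injective _ hinj,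
    Set.ncard_image_of_injective (f := fun v => -rootVec P a v) _ (neg_injective.comp hinj),
    hcount, hcount]

/-- The counting equation, expressed through the list of positive roots. -/
lemma CountEq.valueCountEq (hR : IsPositiveRootList C R) (hΔ : IsSimpleSystem P Δ)
    (ha : Function.Injective a) (haΔ : Set.range a = Δ)
    (hC : ∀ i j, P.pairing (a i) (a j) = goldenHom (C i j)) {t : Fin 3 → Fin r} {d : ℕ}
    {S : Set (Fin r)} {z : Fin 3 → ℂ}
    (h : CountEq P (fun _ => 1) (subroots P (a '' S)) d
      (∑ k, z k • ((1 : ℂ) ⊗ₜ[ℝ] P.coroot (a (t k)))))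
    {R' : List (Fin r → GoldenInt)}
    (hR' : ∀ p : (Fin r → GoldenInt) → Bool,
      R'.countP p = R.countP fun v => p v ∧ open Classical in decide (∀ k, k ∈ S ∨ v k = 0)) :
    ValueCountEq (R'.map (corootValues C t)) d z := by
  classical
  have hcount : ∀ w : ℂ, {i ∈ subroots P (a '' S) |
      eval P i (∑ k, z k • ((1 : ℂ) ⊗ₜ[ℝ] P.coroot (a (t k)))) = w}.ncard =
        (R'.map (corootValues C t)).countP (fun u => tripleValue z u = w) +
        (R'.map (corootValues C t)).countP (fun u => tripleValue z u = -w) := by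
    intro w
    have := hR.ncard_eq hΔ ha haΔ hC fun m =>
      m ∈ Submodule.span ℝ (P.root '' (a '' S)) ∧
        evalLin P m (∑ k, z k • ((1 : ℂ) ⊗ₜ[ℝ] P.coroot (a (t k)))) = w
    simp only [neg_mem_iff, map_neg, LinearMap.neg_apply, neg_eq_iff_eq_neg,
      rootVec_mem_span_iff hΔ ha haΔ, evalLin_rootVec hC] at this
    rw [List.countP_map, List.countP_map, hR', hR']
    refine Eq.trans this ?_
    congr 1 <;> refine List.countP_congr fun v _ => ?_ <;> simp <;> tauto
  unfold CountEq at h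
  rw [hcount, hcount] at h
  simp only [Complex.ofReal_one, neg_zero] at h
  unfold ValueCountEq
  omega

end Golden

section Icosahedral

variable {ι M N : Type*} [AddCommGroup M] [Module ℝ M] [AddCommGroup N] [Module ℝ N]
  {P : RootPairing ι ℝ M N} {Δ : Set ι} {r : ℕ} {a : Fin r → ι}
  {C : Matrix (Fin r) (Fin r) GoldenInt} {R : List (Fin r → GoldenInt)} {c : ι → ℝ}

/-! ### Solvable points of the icosahedral root systems -/

/-- If the finite check succeeds for all nonempty proper sets of simple roots, then solvable points
can only be associated to the set of all simple roots. -/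
theorem IsSolvable.isDistinguished_of_parabolicExcluded [Finite ι] [P.IsRootSystem] [P.IsReduced]
    (hR : IsPositiveRootList C R) {L : List ((Fin 3 → Fin r) × ℕ)}
    (hL : ∀ S : Finset (Fin r), S.Nonempty → S ≠ Finset.univ →
      ∃ p ∈ L, (1 ≤ p.2 ∧ p.2 ≤ 3) ∧ S.card = p.2 ∧
        ∀ k, k ∈ S ↔ ∃ i : Fin 3, (i : ℕ) < p.2 ∧ p.1 i = k)
    (hcheck : ∀ S ∈ L, ParabolicExcluded C R S.1 S.2)
    (hΔ : IsSimpleSystem P Δ) (ha : Function.Injective a) (haΔ : Set.range a = Δ)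
    (hC : ∀ i j, P.pairing (a i) (a j) = goldenHom (C i j))
    (hc : IsInvariant P c) (hc0 : ∃ i, c i ≠ 0) {s : ℝ} (hcs : ∀ i, c i = s) {x : ℂ ⊗[ℝ] N}
    (h : IsSolvable P Δ c x) : IsDistinguished P Δ c x := by
  classical
  have hs : s ≠ 0 := by
    obtain ⟨i, hi⟩ := hc0
    rwa [hcs] at hi
  obtain ⟨J, hJ, hnil, hx⟩ := h
  rcases J.eq_empty_or_nonempty with rfl | hJne
  · exact absurd hx (not_isNilpotentFor_empty hc0 hnil)
  by_cases hJΔ : J = Δ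
  · subst hJΔ
    exact hx
  exfalso
  obtain ⟨x', hx', hconj, hcount⟩ := hnil
  replace hx := hx.conj hc hconj.symm
  -- scale the parameter to `1` and move the point into the dominant chamber of the subsystem
  replace hcount := hcount.scale hs hcs
  replace hx := hx.scale hs hcs
  replace hx' := Submodule.smul_mem _ ((s : ℂ)⁻¹) hx'
  obtain ⟨σ, hσ, y, hy, hyσ, hdom⟩ := hΔ.exists_dominant hJ hx'
  replace hcount := hcount.of_perm σ (fun _ => rfl) hσ hyσ
  replace hx := hx.of_perm σ (fun _ => rfl) (fun i => by simp) hyσ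
  obtain ⟨S, hS⟩ : ∃ S : Finset (Fin r), a '' S = J :=
    ⟨(Set.toFinite (a ⁻¹' J)).toFinset, by
      rw [Set.Finite.coe_toFinset, Set.image_preimage_eq_inter_range, haΔ,
        Set.inter_eq_left.2 hJ]⟩
  subst hS
  have hSne : S.Nonempty := by simpa using hJne
  have hSuniv : S ≠ Finset.univ := by
    rintro rfl
    exact hJΔ (by simpa using haΔ)
  obtain ⟨⟨t, d⟩, hp, hd, hcard, hmem⟩ := hL S hSne hSuniv
  simp only at hd hcard hmem
  have hexc := hcheck _ hp
  have hJcard : (a '' (S : Set (Fin r))).ncard = d := by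
    rw [Set.ncard_image_of_injective _ ha, Set.ncard_coe_finset, hcard]
  rw [hJcard] at hcount hx
  obtain ⟨z, hz, rfl⟩ := exists_coords_of_mem_corootSpan (a := a) (t := t) (d := d) (by
    rintro _ ⟨k, hk, rfl⟩
    obtain ⟨i, hi, rfl⟩ := (hmem k).1 hk
    exact ⟨i, hi, rfl⟩) hy
  have hcount' : ValueCountEq ((parabolicList R t d).map (corootValues C t)) d z := by
    refine CountEq.valueCountEq hR hΔ ha haΔ hC hcount fun p => ?_
    rw [parabolicList, List.countP_filter]
    refine List.countP_congr fun v _ => ?_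
    simp [hmem]
  have hx'' : ValueCountEq (R.map (corootValues C t)) d z := by
    refine CountEq.valueCountEq (S := Set.univ) hR hΔ ha haΔ hC ?_ fun p => by simp
    rwa [Set.image_univ, haΔ, hΔ.subroots_eq_univ]
  refine AllExcluded.not_valueCountEq hexc hd hz ?_ hcount' hx''
  -- the positive roots of the subsystem are nonnegative at a dominant point
  intro u hu hval
  obtain ⟨v, hv, rfl⟩ := List.mem_map.1 hu
  rw [← evalLin_rootVec hC, rootVec, map_sum (evalLin P), LinearMap.sum_apply] at hval
  rw [parabolicList, List.mem_filter] at hv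
  have hre := congrArg Complex.re hval
  rw [Complex.re_sum] at hre
  have hnonneg : 0 ≤ ∑ k, (evalLin P (goldenHom (v k) • P.root (a k))
      (∑ k, z k • ((1 : ℂ) ⊗ₜ[ℝ] P.coroot (a (t k))))).re := by
    refine Finset.sum_nonneg fun k _ => ?_
    rw [map_smul, LinearMap.smul_apply, ← eval_eq, Complex.real_smul, Complex.re_ofReal_mul]
    have hk := of_decide_eq_true hv.2 k
    rw [← hmem] at hk
    rcases hk with hk | hk
    · exact mul_nonneg (goldenHom_nonneg (hR.nonneg v hv.1 k)) (hdom _ ⟨k, hk, rfl⟩)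
    · simp [hk]
  rw [hre] at hnonneg
  norm_num at hnonneg

lemma pairing_of_label_two [Finite ι] {i j : ι}
    (hmul : P.pairing i j * P.pairing j i = 4 * Real.cos (Real.pi / (2 : ℕ)) ^ 2) :
    P.pairing i j = 0 := by
  have : P.pairing i j * P.pairing j i = 0 := by
    rw [hmul]
    simp
  rcases mul_eq_zero.1 this with h | h
  · exact h
  · exact P.pairing_eq_zero_iff.1 h

variable [P.IsReduced]

lemma eq_or_eq_neg_of_root_eq_smul [Finite ι] {i j : ι} {s : ℝ} (h : P.root i = s • P.root j) :
    s = 1 ∨ s = -1 := by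
  have hdep : ¬ LinearIndependent ℝ ![P.root i, P.root j] := by
    intro hli
    have := LinearIndependent.pair_iff.1 hli 1 (-s)
      (by rw [one_smul, neg_smul, ← h, add_neg_cancel])
    exact one_ne_zero this.1
  have hj := P.ne_zero j
  rcases RootPairing.IsReduced.eq_or_eq_neg i j hdep with h' | h'
  · left
    rw [h'] at h
    exact smul_left_injective ℝ hj (by simpa using h.symm)
  · right
    rw [h'] at h
    exact smul_left_injective ℝ hj (by simpa using h.symm)

/-- For an edge with label `3`, the root `s_i s_j α_i` is a multiple of `α_j`, hence equal to it. -/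
lemma pairing_of_label_three [Finite ι] (hc : IsInvariant P c) {i j : ι}
    (hij : P.pairing i j ≤ 0)
    (hmul : P.pairing i j * P.pairing j i = 4 * Real.cos (Real.pi / (3 : ℕ)) ^ 2) :
    P.pairing i j = -1 ∧ c i = c j := by
  have h1 : P.pairing i j * P.pairing j i = 1 := by
    rw [hmul]
    norm_num [Real.cos_pi_div_three]
  have hroot : P.root (P.reflectionPerm i (P.reflectionPerm j i)) =
      (-P.pairing i j) • P.root j := by
    rw [P.root_reflectionPerm, P.root_reflectionPerm, P.reflection_apply_root, map_sub, map_smul,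
      P.reflection_apply_self, P.reflection_apply_root, smul_sub, smul_smul, h1]
    module
  have hp : P.pairing i j = -1 := by
    rcases eq_or_eq_neg_of_root_eq_smul hroot with h | h <;> linarith
  refine ⟨hp, ?_⟩
  have : P.reflectionPerm i (P.reflectionPerm j i) = j := by
    apply P.root.injective
    rw [hroot, hp]
    simp
  rw [← this, hc, hc]

/-- For an edge with label `5`, the root `s_i s_j s_i s_j α_i` is a multiple of `α_j`, hence equal
to it. -/
lemma pairing_of_label_five [Finite ι] (hc : IsInvariant P c) {i j : ι}
    (hij : P.pairing i j ≤ 0)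
    (hmul : P.pairing i j * P.pairing j i = 4 * Real.cos (Real.pi / (5 : ℕ)) ^ 2) :
    P.pairing i j = -Real.goldenRatio ∧ c i = c j := by
  have hφ := Real.goldenRatio_sq
  have hφ1 := Real.one_lt_goldenRatio
  have h1 : P.pairing i j * P.pairing j i = Real.goldenRatio + 1 := by
    rw [hmul, ← hφ]
    push_cast
    rw [Real.cos_pi_div_five, Real.goldenRatio]
    ring
  have hroot : P.root (P.reflectionPerm i (P.reflectionPerm j
      (P.reflectionPerm i (P.reflectionPerm j i)))) =
      (P.pairing i j * (1 - Real.goldenRatio)) • P.root j := by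
    have e : P.root (P.reflectionPerm i (P.reflectionPerm j i)) =
        Real.goldenRatio • P.root i - P.pairing i j • P.root j := by
      rw [P.root_reflectionPerm, P.root_reflectionPerm, P.reflection_apply_root, map_sub,
        map_smul, P.reflection_apply_self, P.reflection_apply_root, smul_sub, smul_smul, h1]
      module
    rw [P.root_reflectionPerm, P.root_reflectionPerm, e]
    simp only [map_sub, map_smul, P.reflection_apply_self, P.reflection_apply_root, map_neg]
    have e2 : P.pairing i j • P.pairing j i • P.root i =
        (Real.goldenRatio + 1) • P.root i := by rw [smul_smul, h1]
    have e3 : Real.goldenRatio • (Real.goldenRatio + 1) • P.root i =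
        (Real.goldenRatio + 1 + Real.goldenRatio) • P.root i := by
      rw [smul_smul]
      congr 1
      linear_combination hφ
    simp only [smul_sub, smul_neg, e2, e3]
    generalize Real.goldenRatio = φ
    module
  have hp : P.pairing i j = -Real.goldenRatio := by
    rcases eq_or_eq_neg_of_root_eq_smul hroot with h | h <;> nlinarith
  refine ⟨hp, ?_⟩
  have : P.reflectionPerm i (P.reflectionPerm j
      (P.reflectionPerm i (P.reflectionPerm j i))) = j := by
    apply P.root.injective
    rw [hroot, hp, show -Real.goldenRatio * (1 - Real.goldenRatio) = 1 by
      linear_combination hφ, one_smul]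
  rw [← this, hc, hc, hc, hc]

/-- The Cartan matrix entry for an edge label `2`, `3` or `5`. -/
def goldenEntry (m : ℕ) : GoldenInt := if m = 2 then 0 else if m = 3 then -1 else ⟨0, -1⟩

variable {m : Matrix (Fin r) (Fin r) ℕ}

/-- The edge labels determine the pairings of the simple roots, and the parameters of simple roots
that are joined by an edge agree. -/
lemma HasDiagram.pairing_eq [Finite ι] (ha : HasDiagram P Δ m a) (hc : IsInvariant P c)
    {i j : Fin r} (hij : i ≠ j)
    (h : m i j = 2 ∨ m i j = 3 ∨ m i j = 5) :
    P.pairing (a i) (a j) = goldenHom (goldenEntry (m i j)) ∧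
      (m i j ≠ 2 → c (a i) = c (a j)) := by
  have hmul := ha.pairing_mul_pairing i j hij
  have h₁ := ha.pairing_nonpos i j hij
  rcases h with h | h | h <;> rw [h] at hmul ⊢
  · exact ⟨by rw [pairing_of_label_two hmul]; simp [goldenEntry], by simp⟩
  · obtain ⟨h₃, h₄⟩ := pairing_of_label_three hc h₁ hmul
    exact ⟨by rw [h₃]; simp [goldenEntry], fun _ => h₄⟩
  · obtain ⟨h₃, h₄⟩ := pairing_of_label_five hc h₁ hmul
    exact ⟨by rw [h₃]; simp [goldenEntry, goldenHom_apply], fun _ => h₄⟩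

variable [Finite ι] [P.IsRootSystem]

lemma IsSimpleSystem.eq_of_forall_simple (hΔ : IsSimpleSystem P Δ) (haΔ : Set.range a = Δ)
    (hc : IsInvariant P c) {s : ℝ} (h : ∀ k, c (a k) = s) (i : ι) : c i = s := by
  induction i using hΔ.root_induction with
  | simple j hj =>
    rw [← haΔ] at hj
    obtain ⟨k, rfl⟩ := hj
    exact h k
  | step i j hj h => rw [hc, h]

lemma label_H₃ : ∀ i j : Fin 3, i ≠ j →
    (CoxeterMatrix.H₃.M i j = 2 ∨ CoxeterMatrix.H₃.M i j = 3 ∨ CoxeterMatrix.H₃.M i j = 5) ∧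
      goldenEntry (CoxeterMatrix.H₃.M i j) = cartanH₃ i j := by
  intro i j h
  fin_cases i <;> fin_cases j <;> first | exact absurd rfl h | decide

lemma label_H₄ : ∀ i j : Fin 4, i ≠ j →
    (CoxeterMatrix.H₄.M i j = 2 ∨ CoxeterMatrix.H₄.M i j = 3 ∨ CoxeterMatrix.H₄.M i j = 5) ∧
      goldenEntry (CoxeterMatrix.H₄.M i j) = cartanH₄ i j := by
  intro i j h
  fin_cases i <;> fin_cases j <;> first | exact absurd rfl h | decide

theorem IsSolvable.isDistinguished_H₃ (hΔ : IsSimpleSystem P Δ) (hc : IsInvariant P c)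
    (hc0 : ∃ i, c i ≠ 0) {a : Fin 3 → ι} (ha : HasDiagram P Δ CoxeterMatrix.H₃.M a)
    {x : ℂ ⊗[ℝ] N} (h : IsSolvable P Δ c x) : IsDistinguished P Δ c x := by
  have hp := fun {i j : Fin 3} => ha.pairing_eq hc (i := i) (j := j)
  have hC : ∀ i j, P.pairing (a i) (a j) = goldenHom (cartanH₃ i j) := by
    intro i j
    rcases eq_or_ne i j with rfl | hij
    · rw [P.pairing_same]
      rw [show cartanH₃ i i = 2 by revert i; decide, map_ofNat]
    · rw [(hp hij (label_H₃ i j hij).1).1, (label_H₃ i j hij).2]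
  have hcs : ∀ i, c i = c (a 0) := by
    refine hΔ.eq_of_forall_simple ha.range_eq hc fun k => ?_
    have h₁ := (hp (i := 0) (j := 1) (by decide) (by decide)).2 (by decide)
    have h₂ := (hp (i := 1) (j := 2) (by decide) (by decide)).2 (by decide)
    fin_cases k
    · rfl
    · exact h₁.symm
    · exact (h₁.trans h₂).symm
  exact h.isDistinguished_of_parabolicExcluded isPositiveRootList_H₃ mem_properSubsetsH₃
    parabolicExcluded_H₃ hΔ ha.injective ha.range_eq hC hc hc0 hcs

theorem IsSolvable.isDistinguished_H₄ (hΔ : IsSimpleSystem P Δ) (hc : IsInvariant P c)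
    (hc0 : ∃ i, c i ≠ 0) {a : Fin 4 → ι} (ha : HasDiagram P Δ CoxeterMatrix.H₄.M a)
    {x : ℂ ⊗[ℝ] N} (h : IsSolvable P Δ c x) : IsDistinguished P Δ c x := by
  have hp := fun {i j : Fin 4} => ha.pairing_eq hc (i := i) (j := j)
  have hC : ∀ i j, P.pairing (a i) (a j) = goldenHom (cartanH₄ i j) := by
    intro i j
    rcases eq_or_ne i j with rfl | hij
    · rw [P.pairing_same]
      rw [show cartanH₄ i i = 2 by revert i; decide, map_ofNat]
    · rw [(hp hij (label_H₄ i j hij).1).1, (label_H₄ i j hij).2]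
  have hcs : ∀ i, c i = c (a 0) := by
    refine hΔ.eq_of_forall_simple ha.range_eq hc fun k => ?_
    have h₁ := (hp (i := 0) (j := 1) (by decide) (by decide)).2 (by decide)
    have h₂ := (hp (i := 1) (j := 2) (by decide) (by decide)).2 (by decide)
    have h₃ := (hp (i := 2) (j := 3) (by decide) (by decide)).2 (by decide)
    fin_cases k
    · rfl
    · exact h₁.symm
    · exact (h₁.trans h₂).symm
    · exact (h₁.trans (h₂.trans h₃)).symm
  exact h.isDistinguished_of_parabolicExcluded isPositiveRootList_H₄ mem_properSubsetsH₄
    parabolicExcluded_H₄ hΔ ha.injective ha.range_eq hC hc hc0 hcs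

end Icosahedral

end SolvablePoints

theorem proposition3p5 {ι M N : Type*} [Finite ι] [AddCommGroup M] [Module ℝ M]
    [AddCommGroup N] [Module ℝ N]
    (P : RootPairing ι ℝ M N) [P.IsRootSystem] [P.IsReduced]
    (Δ : Set ι) (hΔ : SolvablePoints.IsSimpleSystem P Δ)
    (c : ι → ℝ) (hc : SolvablePoints.IsInvariant P c) :
    -- the parameter function is not identically zero
    ((∃ i, c i ≠ 0) →
      -- dihedral types
      (∀ (n : ℕ), 3 ≤ n → ∀ (a : Fin 2 → ι),
        SolvablePoints.HasDiagram P Δ !![1, n; n, 1] a →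
        ∀ (B : N →ₗ[ℝ] N →ₗ[ℝ] ℝ), SolvablePoints.IsNormalizedInner P B →
        ∃ (β : ℕ → ι) (e : ℕ → Module.Basis (Fin 2) ℝ N) (γ : ℕ → N),
          SolvablePoints.IsDihedralRoots P Δ n a β ∧
          (∀ k, 1 ≤ k → k ≤ n / 2 →
            SolvablePoints.IsDualPair P B (β (k - 1)) (β (n - k)) (e k) ∧
            γ k = c (β (k - 1)) • e k 0 + c (β (n - k)) • e k 1) ∧
          (Odd n →
            γ ((n + 1) / 2) =
              (c (β ((n - 1) / 2)) / 2) • P.coroot (β ((n - 1) / 2)) ∧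
            (∀ x : ℂ ⊗[ℝ] N, SolvablePoints.IsSolvable P Δ c x ↔
              ∃ k, 1 ≤ k ∧ k ≤ (n + 1) / 2 ∧
                SolvablePoints.IsConjugate P x ((1 : ℂ) ⊗ₜ[ℝ] γ k)) ∧
            (∀ k, 1 ≤ k → k ≤ (n + 1) / 2 →
              (∀ i, γ k =
                (c i / (4 * Real.sin ((2 * k - 1) / (2 * n) * Real.pi) *
                  Real.sin (Real.pi / (2 * n)))) • (P.coroot (a 0) + P.coroot (a 1))) ∧
              (SolvablePoints.IsDistinguished P Δ c ((1 : ℂ) ⊗ₜ[ℝ] γ k) ↔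
                k ≠ (n + 1) / 2))) ∧
          (Even n →
            (∀ x : ℂ ⊗[ℝ] N, SolvablePoints.IsSolvable P Δ c x ↔
              ∃ k, 1 ≤ k ∧ k ≤ n / 2 ∧
                SolvablePoints.IsConjugate P x ((1 : ℂ) ⊗ₜ[ℝ] γ k)) ∧
            (∀ k, 1 ≤ k → k ≤ n / 2 →
              (SolvablePoints.IsDistinguished P Δ c ((1 : ℂ) ⊗ₜ[ℝ] γ k) ↔
                (c (β (k - 1)) + c (β (n - k)) * Real.cos ((2 * k - 1) * Real.pi / n)) *
                  (c (β (k - 1)) * Real.cos ((2 * k - 1) * Real.pi / n) + c (β (n - k)))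
                    ≠ 0)))) ∧
      -- types `H₃` and `H₄`
      (((∃ a, SolvablePoints.HasDiagram P Δ CoxeterMatrix.H₃.M a) ∨
          (∃ a, SolvablePoints.HasDiagram P Δ CoxeterMatrix.H₄.M a)) →
        ∀ x : ℂ ⊗[ℝ] N, SolvablePoints.IsSolvable P Δ c x ↔
          SolvablePoints.IsDistinguished P Δ c x)) ∧
    -- the parameter function is identically zero
    ((∀ i, c i = 0) → ∀ x : ℂ ⊗[ℝ] N, SolvablePoints.IsSolvable P Δ c x ↔ x = 0) := by
  refine ⟨fun hc0 => ⟨fun n hn a ha B hB =>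
    SolvablePoints.isSolvable_dihedral hΔ hc hc0 hn ha hB, fun hH x => ⟨fun hx => ?_, fun hx =>
    hx.isSolvable hΔ⟩⟩, fun h x => SolvablePoints.isSolvable_iff_of_forall_eq_zero h x⟩
  rcases hH with ⟨a, ha⟩ | ⟨a, ha⟩
  · exact hx.isDistinguished_H₃ hΔ hc hc0 ha
  · exact hx.isDistinguished_H₄ hΔ hc hc0 ha
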